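/- **Setting.** Let $S,A$ be finite sets (states, actions), $p(i,a,j)$ transition probabilities, $c:S\times A\times S\to\mathbb R$ a cost, $\alpha\in\mathbb R$, $i_0\in S$ a fixed reference state, and $\pi_\theta(i,a)$, $\theta\in\mathbb R^{x_1}$, a family of randomized policies, twice continuously differentiable in $\theta$, with $\pi_\theta(i,a)>0$. Fix $\theta$. Assume that the transition matrix $P_\theta(i,j)=\sum_a\pi_\theta(i,a)p(i,a,j)$ is irreducible and aperiodic, with stationary distribution $d_\theta$; let $D_\theta=\mathrm{diag}(d_\theta)$ and $Q_\theta(i,j)=\sum_a\pi_\theta(i,a)e^{\alpha c(i,a,j)}p(i,a,j)$. Let $\Phi\in\mathbb R^{|S|\times x_2}$ (rows $\phi(i)^T$) have nonzero, nonnegative, pairwise orthogonal columns $\phi^k$ such that the submatrix of $P_\theta$ on $\bigcup_k\{i:\phi^k(i)>0\}$ is irreducible, and let $\Psi\in\mathbb R^{|S|\times x_3}$ have rows $\psi(i)^T$. Let $(X_n,Z_n)_{n\ge 0}$ be the states and actions of the chain run with the policy $\pi_\theta$ from an arbitrary initial law. Let $a(n)\in(0,1)$, $b(n)>0$ with $\sum_n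 a(n)=\sum_n b(n)=\infty$, $\sum_n (a(n)^2+b(n)^2)<\infty$, $b(n)/a(n)\to0$, and let $\delta_1,\delta_2>0$. Put $$A_n=\sum_{m=0}^n e^{\alpha c(X_m,Z_m,X_{m+1})}\phi(X_m)\phi(X_{m+1})^T,\qquad B_n=\sum_{m=0}^n\phi(X_m)\phi(X_m)^T .$$ Let $r_0\in\mathbb R^{x_2}$ be nonzero with nonnegative entries, and $$r_{n+1}=r_n+a(n)\Big(\frac{B_n^{-1}A_n}{\phi(i_0)^Tr_n\vee\delta_1}-I\Big)r_n$$ whenever $B_n$ is invertible; as long as $B_n$ is singular, $r_{n+1}$ may be any nonzero vector with nonnegative entries. For $r\in\mathbb R^{x_2}$ let $$\rho_r(i,a,j)=\frac{e^{\alpha c(i,a,j)}\,r^T\phi(j)}{(r^T\phi(i)\;r^T\phi(i_0))\vee\delta_2}.$$ With $\tilde\rho_n=\rho_{r_n}(X_n,Z_n,X_{n+1})$ and arbitrary $u_0,\tilde w_0\in\mathbb R^{x_1\times x_3}$, let $$\delta^{TD}_n=(\tilde\rho_n-1)\nabla_\theta\log\pi_\theta(X_n,Z_n)-\tilde w_n\psi(i_0)+\tilde\rho_n\tilde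 w_n\psi(X_{n+1})-\tilde w_n\psi(X_n),$$ $$u_{n+1}=u_n+b(n)\,(\delta^{TD}_n-u_n\psi(X_n))\,\psi(X_n)^T,$$ $$\tilde w_{n+1}=\tilde w_n+b(n)\,u_n\psi(X_n)\,(\psi(X_n)+\psi(i_0)-\tilde\rho_n\psi(X_{n+1}))^T .$$ **Limit objects.** Let $\gamma_\theta$ be the Perron–Frobenius eigenvalue of $\mathcal M_\theta=\sqrt{D_\theta}\,\Phi(\Phi^TD_\theta\Phi)^{-1}\Phi^TD_\theta Q_\theta\sqrt{D_\theta}^{-1}$, and let $r_\theta\in\mathbb R^{x_2}$ be the vector for which $Y_\theta=\sqrt{D_\theta}\Phi r_\theta$ is an eigenvector of $\mathcal M_\theta$ for $\gamma_\theta$, positive on $\bigcup_k\{i:\phi^k(i)>0\}$, and $\phi(i_0)^Tr_\theta=\gamma_\theta$. Assume $\delta_1<\gamma_\theta$. Put $g^1=\rho_{r_\theta}$, $\tilde R_\theta(i,j)=\sum_a\pi_\theta(i,a)p(i,a,j)g^1(i,a,j)$, let $E$ be the matrix whose $i_0$-th column is the all-ones vector and whose other entries are $0$, let $B^1_\theta$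 be the matrix with rows $\sum_a\nabla_\theta\pi_\theta(i,a)^T\sum_j(g^1(i,a,j)-1)p(i,a,j)$, $i\in S$, and let $$C^1=\Psi^TD_\theta\Psi,\qquad A^1=\Psi^TD_\theta(I+E-\tilde R_\theta)\Psi,\qquad b^1=\Psi^TD_\theta B^1_\theta .$$ **Theorem.** Assume that $A^1$ and $C^1$ are nonsingular. Then all complex eigenvalues of $\begin{pmatrix}-C^1&-A^1\\ (A^1)^T&0\end{pmatrix}$ have negative real part, and $\tilde w_n\to\big((A^1)^{-1}b^1\big)^T$ almost surely. -/

import Mathlib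

open Matrix Filter Topology MeasureTheory

noncomputable section

namespace RiskSensitive

/-- A finite controlled Markov chain: transition probabilities `p i a j` and single-stage
costs `c i a j`. -/
structure MDP (S A : Type*) [Fintype S] where
  p : S → A → S → ℝ
  c : S → A → S → ℝ
  p_nonneg : ∀ i a j, 0 ≤ p i a j
  p_sum : ∀ i a, ∑ j, p i a j = 1

/-- A family of stationary randomized policies, parameterized by `θ ∈ ℝ^x₁`, twice continuously
differentiable in `θ` and with all action probabilities positive. -/
structure PolicyFamily (S A : Type*) [Fintype A] (x₁ : ℕ) where
  prob : EuclideanSpace ℝ (Fin x₁) → S → A → ℝ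
  prob_pos : ∀ θ i a, 0 < prob θ i a
  prob_sum : ∀ θ i, ∑ a, prob θ i a = 1
  contDiff : ∀ i a, ContDiff ℝ 2 (fun θ => prob θ i a)

/-- The step sizes `a(n)` of the value recursion and `b(n)` of the gradient recursion. -/
structure StepSizes (a b : ℕ → ℝ) : Prop where
  a_pos : ∀ n, 0 < a n
  b_pos : ∀ n, 0 < b n
  a_sum : Tendsto (fun N => ∑ n ∈ Finset.range N, a n) atTop atTop
  b_sum : Tendsto (fun N => ∑ n ∈ Finset.range N, b n) atTop atTop
  sq_summable : Summable (fun n => a n ^ 2 + b n ^ 2)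
  ratio : Tendsto (fun n => b n / a n) atTop (𝓝 0)

section Matrices

variable {S A : Type*} [Fintype S] [DecidableEq S] [Fintype A]

/-- The transition matrix `P_π` of the chain under the randomized policy `q`. -/
def transMatrix (M : MDP S A) (q : S → A → ℝ) : Matrix S S ℝ :=
  Matrix.of fun i j => ∑ a, q i a * M.p i a j

/-- The matrix `Q_π`, with entries `∑ₐ π(i,a) e^{α c(i,a,j)} p(i,a,j)`. -/
def expMatrix (M : MDP S A) (α : ℝ) (q : S → A → ℝ) : Matrix S S ℝ :=
  Matrix.of fun i j => ∑ a, q i a * Real.exp (α * M.c i a j) * M.p i a j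

/-- Aperiodicity: for every state `i`, the greatest common divisor of the return times
`n > 0` with `Pⁿ(i,i) > 0` is one. -/
def IsAperiodic (P : Matrix S S ℝ) : Prop :=
  ∀ i, ∀ m : ℕ, (∀ n : ℕ, 0 < n → 0 < (P ^ n) i i → m ∣ n) → m = 1

/-- `d` is a stationary distribution of the stochastic matrix `P`. -/
structure IsStationary (P : Matrix S S ℝ) (d : S → ℝ) : Prop where
  nonneg : ∀ i, 0 ≤ d i
  sum_one : ∑ i, d i = 1
  invariant : d ᵥ* P = d

/-- The set of states at which some feature (column of `Φ`) is positive. -/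
def featureSupport {x₂ : ℕ} (Φ : Matrix S (Fin x₂) ℝ) : Set S :=
  {i | ∃ k, 0 < Φ i k}

/-- The assumption on the value features: the columns of `Φ` are nonzero, nonnegative and
pairwise orthogonal, and the submatrix of `P` on the states where some feature is positive is
irreducible. -/
structure FeatureAssumption {x₂ : ℕ} (P : Matrix S S ℝ) (Φ : Matrix S (Fin x₂) ℝ) : Prop where
  nonneg : ∀ i k, 0 ≤ Φ i k
  col_ne_zero : ∀ k, ∃ i, Φ i k ≠ 0
  orthogonal : ∀ k l, k ≠ l → ∑ i, Φ i k * Φ i l = 0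
  irreducible : (P.submatrix (Subtype.val : featureSupport Φ → S) Subtype.val).IsIrreducible

/-- The square root of the diagonal matrix with diagonal `d`. -/
def sqrtDiag (d : S → ℝ) : Matrix S S ℝ := Matrix.diagonal fun i => √(d i)

/-- The matrix `𝓜 = √D Φ (Φᵀ D Φ)⁻¹ Φᵀ D Q √D⁻¹`. -/
def projMatrix {x₂ : ℕ} (d : S → ℝ) (Φ : Matrix S (Fin x₂) ℝ) (Q : Matrix S S ℝ) :
    Matrix S S ℝ :=
  sqrtDiag d * Φ * (Φᵀ * Matrix.diagonal d * Φ)⁻¹ * Φᵀ * Matrix.diagonal d * Q * (sqrtDiag d)⁻¹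

/-- `γ` is the Perron–Frobenius eigenvalue of `𝓜` and `r` is the coefficient vector of the
Perron–Frobenius eigenvector `Y = √D Φ r`, which is positive on the states carrying a feature,
normalized by `γ = φ(i₀)ᵀ r`. -/
structure IsPerronCritic {x₂ : ℕ} (d : S → ℝ) (Φ : Matrix S (Fin x₂) ℝ) (Q : Matrix S S ℝ)
    (i₀ : S) (γ : ℝ) (r : Fin x₂ → ℝ) : Prop where
  eigen : projMatrix d Φ Q *ᵥ ((sqrtDiag d * Φ) *ᵥ r) = γ • ((sqrtDiag d * Φ) *ᵥ r)
  pos : ∀ i ∈ featureSupport Φ, 0 < ((sqrtDiag d * Φ) *ᵥ r) i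
  normalized : γ = Φ i₀ ⬝ᵥ r

/-- The approximate importance sampling ratio
`e^{α c(i,a,j)} rᵀφ(j) / ((rᵀφ(i) · rᵀφ(i₀)) ∨ δ₂)` computed with the weights `r`. -/
def isRatio {x₂ : ℕ} (M : MDP S A) (α : ℝ) (Φ : Matrix S (Fin x₂) ℝ) (i₀ : S) (δ₂ : ℝ)
    (r : Fin x₂ → ℝ) (i : S) (a : A) (j : S) : ℝ :=
  Real.exp (α * M.c i a j) * (r ⬝ᵥ Φ j) / max ((r ⬝ᵥ Φ i) * (r ⬝ᵥ Φ i₀)) δ₂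

/-- The matrix `R̃(i,j) = ∑ₐ π(i,a) p(i,a,j) g(i,a,j)`. -/
def ratioMatrix (M : MDP S A) (q : S → A → ℝ) (g : S → A → S → ℝ) : Matrix S S ℝ :=
  Matrix.of fun i j => ∑ a, q i a * M.p i a j * g i a j

/-- The matrix whose `i₀`-th column is the all-ones vector and whose other columns vanish. -/
def refMatrix (i₀ : S) : Matrix S S ℝ := Matrix.of fun _ j => if j = i₀ then 1 else 0

/-- The matrix with rows `∑ₐ ∇_θ π_θ(i,a)ᵀ ∑ⱼ (g(i,a,j) - 1) p(i,a,j)`. -/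
def gradMatrix {x₁ : ℕ} (M : MDP S A) (pol : PolicyFamily S A x₁)
    (θ : EuclideanSpace ℝ (Fin x₁)) (g : S → A → S → ℝ) : Matrix S (Fin x₁) ℝ :=
  Matrix.of fun i l =>
    ∑ a, gradient (fun t => pol.prob t i a) θ l * ∑ j, (g i a j - 1) * M.p i a j

/-- `C¹ = Ψᵀ D Ψ`. -/
def C1 {x₃ : ℕ} (d : S → ℝ) (Ψ : Matrix S (Fin x₃) ℝ) : Matrix (Fin x₃) (Fin x₃) ℝ :=
  Ψᵀ * Matrix.diagonal d * Ψ

/-- `A¹ = Ψᵀ D (I + E - R̃) Ψ`. -/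
def A1 {x₃ : ℕ} (d : S → ℝ) (Ψ : Matrix S (Fin x₃) ℝ) (R : Matrix S S ℝ) (i₀ : S) :
    Matrix (Fin x₃) (Fin x₃) ℝ :=
  Ψᵀ * Matrix.diagonal d * (1 + refMatrix i₀ - R) * Ψ

/-- `b¹ = Ψᵀ D B¹`. -/
def b1 {x₁ x₃ : ℕ} (d : S → ℝ) (Ψ : Matrix S (Fin x₃) ℝ) (B : Matrix S (Fin x₁) ℝ) :
    Matrix (Fin x₃) (Fin x₁) ℝ :=
  Ψᵀ * Matrix.diagonal d * B

end Matrices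

/-- A real square matrix is Hurwitz if all its complex eigenvalues have negative real part. -/
def IsHurwitz {n : Type*} [Fintype n] [DecidableEq n] (G : Matrix n n ℝ) : Prop :=
  ∀ z ∈ spectrum ℂ (G.map (algebraMap ℝ ℂ)), z.re < 0

section Processes

variable {S A : Type*} [Fintype S]

/-- The states `X n` and actions `Z n` form the controlled chain under the stationary randomized
policy `q`: given the past up to the state at time `n`, the action at time `n` is drawn from
`q (X n)` and the next state from `p (X n) (Z n)`. The initial law is arbitrary. -/
structure IsControlledChain {Ω : Type*} [MeasurableSpace Ω] (μ : Measure Ω) (M : MDP S A)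
    (q : S → A → ℝ) (X : ℕ → Ω → S) (Z : ℕ → Ω → A) : Prop where
  measurable_state : ∀ n i, MeasurableSet {ω | X n ω = i}
  measurable_action : ∀ n a, MeasurableSet {ω | Z n ω = a}
  step : ∀ (n : ℕ) (s : ℕ → S) (z : ℕ → A),
    μ.real {ω | (∀ k ≤ n + 1, X k ω = s k) ∧ ∀ k ≤ n, Z k ω = z k} =
      μ.real {ω | (∀ k ≤ n, X k ω = s k) ∧ ∀ k < n, Z k ω = z k} *
        (q (s n) (z n) * M.p (s n) (z n) (s (n + 1)))

variable {x₁ x₂ x₃ : ℕ}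

/-- `A_n = ∑_{m ≤ n} e^{α c(i_m,z_m,i_{m+1})} φ(i_m) φ(i_{m+1})ᵀ` along a path. -/
def empA (M : MDP S A) (α : ℝ) (Φ : Matrix S (Fin x₂) ℝ) (i : ℕ → S) (z : ℕ → A) (n : ℕ) :
    Matrix (Fin x₂) (Fin x₂) ℝ :=
  ∑ m ∈ Finset.range (n + 1),
    Real.exp (α * M.c (i m) (z m) (i (m + 1))) • vecMulVec (Φ (i m)) (Φ (i (m + 1)))

/-- `B_n = ∑_{m ≤ n} φ(i_m) φ(i_m)ᵀ` along a path. -/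
def empB (Φ : Matrix S (Fin x₂) ℝ) (i : ℕ → S) (n : ℕ) : Matrix (Fin x₂) (Fin x₂) ℝ :=
  ∑ m ∈ Finset.range (n + 1), vecMulVec (Φ (i m)) (Φ (i m))

/-- The value weights `r_n` along a path `(i_n, z_n)`, for the step sizes `a n`: they start at a
nonzero nonnegative vector and satisfy
`r_{n+1} = r_n + a(n) (B_n⁻¹ A_n / (φ(i₀)ᵀ r_n ∨ δ₁) - I) r_n` as soon as `B_n` is invertible.
As long as `B_n` is singular, so that this recursion is not defined, `r_{n+1}` may be any nonzero
nonnegative vector (for instance `r_n`). -/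
structure IsValueIterate (M : MDP S A) (α : ℝ) (Φ : Matrix S (Fin x₂) ℝ) (i₀ : S) (δ₁ : ℝ)
    (a : ℕ → ℝ) (i : ℕ → S) (z : ℕ → A) (r : ℕ → Fin x₂ → ℝ) : Prop where
  init_nonneg : ∀ k, 0 ≤ r 0 k
  init_ne_zero : r 0 ≠ 0
  step : ∀ n, IsUnit (empB Φ i n).det →
    r (n + 1) = r n + a n •
      (((max (Φ i₀ ⬝ᵥ r n) δ₁)⁻¹ • ((empB Φ i n)⁻¹ * empA M α Φ i z n) - 1) *ᵥ r n)
  warmup : ∀ n, ¬ IsUnit (empB Φ i n).det → (∀ k, 0 ≤ r (n + 1) k) ∧ r (n + 1) ≠ 0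

/-- The temporal difference error
`(ρ - 1) ∇_θ log π_θ(i,a) - w ψ(i₀) + ρ w ψ(j) - w ψ(i)` of a transition `(i, a, j)`. -/
def tdError [Fintype A] (pol : PolicyFamily S A x₁) (θ : EuclideanSpace ℝ (Fin x₁))
    (Ψ : Matrix S (Fin x₃) ℝ) (i₀ : S) (ρ : ℝ) (w : Matrix (Fin x₁) (Fin x₃) ℝ)
    (i : S) (a : A) (j : S) : Fin x₁ → ℝ :=
  (ρ - 1) • (gradient (fun t => Real.log (pol.prob t i a)) θ).ofLp
    - w *ᵥ Ψ i₀ + ρ • (w *ᵥ Ψ j) - w *ᵥ Ψ i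

/-- The coupled iterates `(u_n, w_n)` along a path `(i_n, z_n)` with importance sampling ratios
`ρ n` and step sizes `b n`. The initial matrices are arbitrary. -/
structure IsGTD2Iterate [Fintype A] (pol : PolicyFamily S A x₁)
    (θ : EuclideanSpace ℝ (Fin x₁)) (Ψ : Matrix S (Fin x₃) ℝ) (i₀ : S) (b : ℕ → ℝ)
    (i : ℕ → S) (z : ℕ → A) (ρ : ℕ → ℝ) (u w : ℕ → Matrix (Fin x₁) (Fin x₃) ℝ) : Prop where
  step_u : ∀ n, u (n + 1) = u n + b n •
    vecMulVec (tdError pol θ Ψ i₀ (ρ n) (w n) (i n) (z n) (i (n + 1)) - u n *ᵥ Ψ (i n)) (Ψ (i n))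
  step_w : ∀ n, w (n + 1) = w n + b n •
    vecMulVec (u n *ᵥ Ψ (i n)) (Ψ (i n) + Ψ i₀ - ρ n • Ψ (i (n + 1)))

end Processes

end RiskSensitive

end

/-!
Fix a path of the chain. The recursions are random only through the transitions along the path,
and they are controlled by one almost sure property of it, `HasConvergentFluctuations`: for square
summable weights `b n` and every function `f` of a transition, the series of `b n` times the
deviation of `f` at time `n` from its stationary mean converges. To prove it
(`ae_hasConvergentFluctuations`), let `F n i` be the conditional expectation of the remaining
series given the state `i` at time `n`. It exists because the powers of `P` mix geometrically
(`summable_norm_pow_mulVec`), it solves a Poisson equation that depends on `n`, and it turns the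
partial sums into an `L²`-bounded martingale plus a term that tends to zero. The weights
`1 / (n + 1)` give the law of large numbers, and the step sizes `b n` the averaging of the
gradient recursion.

*Value weights.* By the law of large numbers, `B_n⁻¹ A_n → (Φᵀ D Φ)⁻¹ Φᵀ D Q Φ`. The columns of
`Φ` have disjoint supports, so in the coordinates `r k / r_θ k` and after division by `γ` the
limit is an irreducible stochastic matrix, `criticMatrix`. Split the weights into their mean with
respect to its invariant distribution, the scale, and the quotient, the direction. A step of the
direction is a lazy step of the stochastic matrix, at the speed of a clock which diverges
(`tendsto_sum_clock`). Lazy steps contract the variance, so the direction tends to the constant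
vector (`tendsto_one_of_direction_recursion`). The scale then satisfies a scalar recursion for
which the truncation at `δ₁ < γ` is harmless, since truncated scales grow
(`tendsto_one_of_scale_recursion`). Hence `r_n → r_θ` (`IsValueIterate.tendsto`), and the
importance sampling ratios converge to those of `r_θ`.

*Gradient recursion.* Each row of `(u, w)` follows a linear recursion whose mean matrix has the
blocks `-C`, `-A`, `Aᵀ`, `0` and whose mean has its equilibrium at `u = 0` and `w` the
corresponding column of `A⁻¹ b`. The quadratic form of this matrix is only `-⟨u, C u⟩`, but after
the shear `u ↦ u + η A w` with small `η` it is negative definite (`exists_shear_dissipative`).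
This gives the location of the spectrum (`isHurwitz_of_dissipative`) and a Euclidean norm that the
averaged recursion contracts. The fluctuations are removed by a change of variables: their
convergent series have tails that tend to zero, and adding the tail applied to the iterate
replaces the random operators by their mean, up to errors that are negligible with respect to the
step size. So no boundedness of the iterates has to be known beforehand
(`tendsto_zero_of_linear_recursion`).
-/

namespace RiskSensitive

/-! ### Deterministic recursions with vanishing step sizes -/

theorem tendsto_zero_of_summable_sq {b : ℕ → ℝ} (h : Summable fun n => b n ^ 2) :
    Tendsto b atTop (𝓝 0) :=
  tendsto_zero_iff_abs_tendsto_zero b |>.2 <| by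
    simpa [Real.sqrt_sq_eq_abs, Function.comp_def] using h.tendsto_atTop_zero.sqrt

/-- A nonnegative sequence that is contracted at rates with divergent sum, up to perturbations
that are negligible with respect to these rates, tends to zero. -/
theorem tendsto_zero_of_le_contraction {v t ε : ℕ → ℝ} (hv : ∀ n, 0 ≤ v n)
    (ht : ∀ᶠ n in atTop, 0 ≤ t n ∧ t n ≤ 1)
    (hsum : Tendsto (fun N => ∑ n ∈ Finset.range N, t n) atTop atTop)
    (hε : Tendsto ε atTop (𝓝 0))
    (hrec : ∀ᶠ n in atTop, v (n + 1) ≤ (1 - t n) * v n + t n * ε n) :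
    Tendsto v atTop (𝓝 0) := by
  refine tendsto_order.2 ⟨fun a ha => Eventually.of_forall fun n => ha.trans_le (hv n), ?_⟩
  intro δ' hδ'
  set δ := δ' / 2 with hδ_def
  have hδ : 0 < δ := by positivity
  obtain ⟨n₀, hn₀⟩ := eventually_atTop.1 ((ht.and hrec).and (hε.eventually_le_const hδ))
  set C := max (v n₀ - δ) 0 with hC_def
  have hC : 0 ≤ C := le_max_right _ _
  have key : ∀ k, v (n₀ + k) - δ ≤ C * Real.exp (-∑ i ∈ Finset.range k, t (n₀ + i)) := by
    intro k
    induction k with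
    | zero => simp [hC_def]
    | succ k ih =>
      obtain ⟨⟨⟨h0, h1⟩, h2⟩, h3⟩ := hn₀ (n₀ + k) (Nat.le_add_right _ _)
      have hexp : 1 - t (n₀ + k) ≤ Real.exp (-t (n₀ + k)) := by
        have := Real.add_one_le_exp (-t (n₀ + k)); linarith
      calc v (n₀ + (k + 1)) - δ
          ≤ (1 - t (n₀ + k)) * (v (n₀ + k) - δ) := by
            have := mul_le_mul_of_nonneg_left h3 h0
            rw [← add_assoc]; linarith
        _ ≤ (1 - t (n₀ + k)) * (C * Real.exp (-∑ i ∈ Finset.range k, t (n₀ + i))) :=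
            mul_le_mul_of_nonneg_left ih (by linarith)
        _ ≤ Real.exp (-t (n₀ + k)) * (C * Real.exp (-∑ i ∈ Finset.range k, t (n₀ + i))) :=
            mul_le_mul_of_nonneg_right hexp (by positivity)
        _ = C * Real.exp (-∑ i ∈ Finset.range (k + 1), t (n₀ + i)) := by
            rw [Finset.sum_range_succ, neg_add, Real.exp_add]; ring
  have hlim : Tendsto (fun k => C * Real.exp (-∑ i ∈ Finset.range k, t (n₀ + i))) atTop
      (𝓝 (C * 0)) := by
    refine Tendsto.const_mul _ (Real.tendsto_exp_neg_atTop_nhds_zero.comp ?_)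
    have h := tendsto_atTop_add_const_right atTop (-∑ i ∈ Finset.range n₀, t i)
      (hsum.comp (tendsto_add_atTop_nat n₀))
    refine h.congr fun k => ?_
    simp only [Function.comp]
    rw [add_comm k n₀, Finset.sum_range_add]; ring
  rw [mul_zero] at hlim
  obtain ⟨k₀, hk₀⟩ := eventually_atTop.1 (hlim.eventually_lt_const hδ)
  filter_upwards [eventually_ge_atTop (n₀ + k₀)] with n hn
  obtain ⟨k, rfl⟩ := Nat.exists_eq_add_of_le (le_of_add_le_left hn)
  have h1 := key k
  have h2 := hk₀ k (by omega)
  linarith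

/-- Convergence of a linear stochastic-approximation recursion along a path. The operators `L n`
and the forcing terms `h n` need not converge, it suffices that their fluctuations, weighted by
the step sizes, are summable in the conditional sense: then the tails `S n` and `T n` of the two
series turn `y n = x n + S n (x n) + T n` into a recursion with the averaged operator. -/
theorem tendsto_zero_of_linear_recursion {E : Type*} [NormedAddCommGroup E] [NormedSpace ℝ E]
    {b : ℕ → ℝ} (hb_pos : ∀ n, 0 < b n) (hb_zero : Tendsto b atTop (𝓝 0))
    (hb_sum : Tendsto (fun N => ∑ n ∈ Finset.range N, b n) atTop atTop)
    {Lbar : E →L[ℝ] E} {c : ℝ} (hc : 0 < c)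
    (hcontr : ∀ᶠ β in 𝓝[>] (0 : ℝ), ∀ x, ‖x + β • Lbar x‖ ≤ (1 - c * β) * ‖x‖)
    {L D : ℕ → E →L[ℝ] E} {h e x : ℕ → E} {K : ℝ}
    (hL : ∀ n, ‖L n‖ ≤ K) (hh : ∀ n, ‖h n‖ ≤ K)
    (hD : Tendsto D atTop (𝓝 0)) (he : Tendsto e atTop (𝓝 0))
    {sL : E →L[ℝ] E}
    (hsL : Tendsto (fun N => ∑ n ∈ Finset.range N, b n • (L n - Lbar)) atTop (𝓝 sL))
    {sh : E} (hsh : Tendsto (fun N => ∑ n ∈ Finset.range N, b n • h n) atTop (𝓝 sh))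
    (hx : ∀ n, x (n + 1) = x n + b n • ((L n + D n) (x n) + (h n + e n))) :
    Tendsto x atTop (𝓝 0) := by
  set S : ℕ → E →L[ℝ] E := fun n => sL - ∑ m ∈ Finset.range n, b m • (L m - Lbar) with hS_def
  set T : ℕ → E := fun n => sh - ∑ m ∈ Finset.range n, b m • h m with hT_def
  have hS : Tendsto S atTop (𝓝 0) := by simpa using (tendsto_const_nhds (x := sL)).sub hsL
  have hT : Tendsto T atTop (𝓝 0) := by simpa using (tendsto_const_nhds (x := sh)).sub hsh
  have hS_succ : ∀ n, S (n + 1) = S n - b n • (L n - Lbar) := fun n => by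
    simp only [hS_def, Finset.sum_range_succ]; abel
  have hT_succ : ∀ n, T (n + 1) = T n - b n • h n := fun n => by
    simp only [hT_def, Finset.sum_range_succ]; abel
  set y : ℕ → E := fun n => x n + S n (x n) + T n with hy_def
  set R : ℕ → E := fun n => D n (x n) + e n - Lbar (S n (x n) + T n)
    + S (n + 1) (L n (x n) + D n (x n) + (h n + e n)) with hR_def
  have hy_succ : ∀ n, y (n + 1) = (y n + b n • Lbar (y n)) + b n • R n := by
    intro n
    have h1 : S (n + 1) (x (n + 1)) = S n (x n) - b n • (L n (x n) - Lbar (x n))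
        + b n • S (n + 1) (L n (x n) + D n (x n) + (h n + e n)) := by
      rw [hx, map_add, map_smul, _root_.add_apply]
      conv_lhs => lhs; rw [hS_succ]
      simp
    simp only [hy_def, hR_def]
    rw [h1, hT_succ, hx]
    simp only [_root_.add_apply, map_add, smul_add, smul_sub]
    abel
  set η : ℕ → ℝ := fun n => ‖D n‖ + ‖e n‖ + ‖Lbar‖ * (‖S n‖ + ‖T n‖)
    + ‖S (n + 1)‖ * (K + ‖D n‖ + (K + ‖e n‖)) with hη_def
  have hη : Tendsto η atTop (𝓝 0) := by
    have hS1 : Tendsto (fun n => ‖S (n + 1)‖) atTop (𝓝 0) :=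
      (tendsto_zero_iff_norm_tendsto_zero.1 hS).comp (tendsto_add_atTop_nat 1)
    have hS0 := tendsto_zero_iff_norm_tendsto_zero.1 hS
    have hT0 := tendsto_zero_iff_norm_tendsto_zero.1 hT
    have hD0 := tendsto_zero_iff_norm_tendsto_zero.1 hD
    have he0 := tendsto_zero_iff_norm_tendsto_zero.1 he
    have := ((hD0.add he0).add ((hS0.add hT0).const_mul ‖Lbar‖)).add
      (hS1.mul ((hD0.const_add K).add (he0.const_add K)))
    simpa using this
  have hη_nonneg : ∀ n, 0 ≤ η n := fun n => by
    have hK : 0 ≤ K := (norm_nonneg _).trans (hL n)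
    positivity
  have hR : ∀ n, ‖R n‖ ≤ η n * (‖x n‖ + 1) := by
    intro n
    have hK : 0 ≤ K := (norm_nonneg _).trans (hL n)
    have hx0 := norm_nonneg (x n)
    have a1 : ‖D n (x n)‖ ≤ ‖D n‖ * ‖x n‖ := (D n).le_opNorm _
    have a2 : ‖S n (x n)‖ ≤ ‖S n‖ * ‖x n‖ := (S n).le_opNorm _
    have a3 : ‖Lbar (S n (x n) + T n)‖ ≤ ‖Lbar‖ * (‖S n‖ * ‖x n‖ + ‖T n‖) :=
      (Lbar.le_opNorm _).trans (mul_le_mul_of_nonneg_left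
        ((norm_add_le _ _).trans (by gcongr)) (norm_nonneg _))
    have a4 : ‖L n (x n)‖ ≤ K * ‖x n‖ := (L n).le_of_opNorm_le (hL n) _
    have a5 : ‖L n (x n) + D n (x n) + (h n + e n)‖ ≤
        K * ‖x n‖ + ‖D n‖ * ‖x n‖ + (K + ‖e n‖) :=
      (norm_add_le _ _).trans (add_le_add ((norm_add_le _ _).trans (add_le_add a4 a1))
        ((norm_add_le _ _).trans (add_le_add (hh n) le_rfl)))
    have a6 : ‖S (n + 1) (L n (x n) + D n (x n) + (h n + e n))‖ ≤
        ‖S (n + 1)‖ * (K * ‖x n‖ + ‖D n‖ * ‖x n‖ + (K + ‖e n‖)) :=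
      ((S (n + 1)).le_opNorm _).trans (mul_le_mul_of_nonneg_left a5 (norm_nonneg _))
    have a7 : ‖R n‖ ≤ ‖D n (x n)‖ + ‖e n‖ + ‖Lbar (S n (x n) + T n)‖
        + ‖S (n + 1) (L n (x n) + D n (x n) + (h n + e n))‖ :=
      (norm_add_le _ _).trans (add_le_add ((norm_sub_le _ _).trans
        (add_le_add (norm_add_le _ _) le_rfl)) le_rfl)
    have b1 : ‖S (n + 1)‖ * (K * ‖x n‖ + ‖D n‖ * ‖x n‖ + (K + ‖e n‖)) ≤
        ‖S (n + 1)‖ * (K + ‖D n‖ + (K + ‖e n‖)) * (‖x n‖ + 1) := by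
      rw [mul_assoc]
      refine mul_le_mul_of_nonneg_left ?_ (norm_nonneg _)
      have : 0 ≤ (K + ‖e n‖) * ‖x n‖ := by positivity
      have : 0 ≤ (K + ‖D n‖) := by positivity
      nlinarith
    have b2 : ‖Lbar‖ * (‖S n‖ * ‖x n‖ + ‖T n‖) ≤
        ‖Lbar‖ * (‖S n‖ + ‖T n‖) * (‖x n‖ + 1) := by
      rw [mul_assoc]
      refine mul_le_mul_of_nonneg_left ?_ (norm_nonneg _)
      have : 0 ≤ ‖T n‖ * ‖x n‖ := by positivity
      nlinarith [norm_nonneg (S n)]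
    have b3 : ‖D n‖ * ‖x n‖ + ‖e n‖ ≤ (‖D n‖ + ‖e n‖) * (‖x n‖ + 1) := by
      have : 0 ≤ ‖e n‖ * ‖x n‖ := by positivity
      nlinarith [norm_nonneg (D n)]
    have : η n * (‖x n‖ + 1) = (‖D n‖ + ‖e n‖) * (‖x n‖ + 1)
        + ‖Lbar‖ * (‖S n‖ + ‖T n‖) * (‖x n‖ + 1)
        + ‖S (n + 1)‖ * (K + ‖D n‖ + (K + ‖e n‖)) * (‖x n‖ + 1) := by
      simp only [hη_def]; ring
    linarith
  -- where `S n` is small, `x n` is controlled by `y n`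
  have hxy : ∀ᶠ n in atTop, ‖x n‖ ≤ 2 * (‖y n‖ + ‖T n‖) := by
    filter_upwards [(tendsto_zero_iff_norm_tendsto_zero.1 hS).eventually_le_const
      (by norm_num : (0 : ℝ) < 1 / 2)] with n hn
    have h1 : x n = y n - S n (x n) - T n := by simp only [hy_def]; abel
    have h2 : ‖S n (x n)‖ ≤ 1 / 2 * ‖x n‖ := (S n).le_of_opNorm_le hn _
    have h3 : ‖x n‖ ≤ ‖y n‖ + ‖S n (x n)‖ + ‖T n‖ := by
      conv_lhs => rw [h1]
      exact (norm_sub_le _ _).trans (add_le_add (norm_sub_le _ _) le_rfl)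
    linarith
  have hb_gt : Tendsto b atTop (𝓝[>] 0) :=
    tendsto_nhdsWithin_iff.2 ⟨hb_zero, Eventually.of_forall hb_pos⟩
  have hy : Tendsto (fun n => ‖y n‖) atTop (𝓝 0) := by
    refine tendsto_zero_of_le_contraction (t := fun n => c / 2 * b n)
      (ε := fun n => 6 / c * η n) (fun n => norm_nonneg _) ?_ ?_ ?_ ?_
    · have : Tendsto (fun n => c / 2 * b n) atTop (𝓝 0) := by simpa using hb_zero.const_mul (c / 2)
      filter_upwards [this.eventually_le_const one_pos] with n hn
      exact ⟨by have := hb_pos n; positivity, hn⟩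
    · simp only [← Finset.mul_sum]
      exact hb_sum.const_mul_atTop (by positivity)
    · simpa using hη.const_mul (6 / c)
    · filter_upwards [hxy, hb_gt.eventually hcontr,
        (tendsto_zero_iff_norm_tendsto_zero.1 hT).eventually_le_const one_pos,
        hη.eventually_le_const (by positivity : 0 < c / 4)] with n h1 h2 h3 h4
      have hb := hb_pos n
      have h5 : ‖y (n + 1)‖ ≤ (1 - c * b n) * ‖y n‖ + b n * ‖R n‖ := by
        rw [hy_succ]
        refine (norm_add_le _ _).trans (add_le_add (h2 _) ?_)
        rw [norm_smul, Real.norm_of_nonneg hb.le]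
      have h6 : ‖R n‖ ≤ c / 2 * ‖y n‖ + 3 * η n := by
        have := mul_le_mul_of_nonneg_left (by linarith : ‖x n‖ + 1 ≤ 2 * ‖y n‖ + 3) (hη_nonneg n)
        nlinarith [hR n, norm_nonneg (y n)]
      have h7 := mul_le_mul_of_nonneg_left h6 hb.le
      have h8 : c / 2 * b n * (6 / c * η n) = 3 * b n * η n := by field_simp; ring
      rw [h8]; linarith
  rw [tendsto_zero_iff_norm_tendsto_zero]
  have hlim : Tendsto (fun n => 2 * (‖y n‖ + ‖T n‖)) atTop (𝓝 0) := by
    simpa using (hy.add (tendsto_zero_iff_norm_tendsto_zero.1 hT)).const_mul 2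
  exact tendsto_of_tendsto_of_tendsto_of_le_of_le' tendsto_const_nhds hlim
    (Eventually.of_forall fun n => norm_nonneg _) hxy

/-! ### Irreducible stochastic matrices -/

section Stochastic

variable {κ : Type*}

/-- A matrix has no proper closed set if a nonempty set of indices which cannot be left along
positive entries is the whole index set. For nonnegative matrices this is irreducibility, except
that a `1 × 1` zero matrix is allowed. -/
def NoProperClosedSet (K : Matrix κ κ ℝ) : Prop :=
  ∀ T : Set κ, T.Nonempty → (∀ k ∈ T, ∀ l, 0 < K k l → l ∈ T) → T = Set.univ

theorem noProperClosedSet_of_isIrreducible {K : Matrix κ κ ℝ} (hK : K.IsIrreducible) :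
    NoProperClosedSet K := by
  rintro T ⟨i, hi⟩ hT
  refine Set.eq_univ_of_forall fun j => ?_
  let := toQuiver K
  have key : ∀ {j} (_ : Quiver.Path i j), j ∈ T := by
    intro j p
    induction p with
    | nil => exact hi
    | cons p e ih => exact hT _ ih _ e.down
  obtain ⟨p, -⟩ := hK.connected i j
  exact key p

variable [Fintype κ]

/-- The support of a nonnegative invariant vector is a closed set, hence everything. -/
theorem pos_of_vecMul_eq {K : Matrix κ κ ℝ} (h0 : ∀ k l, 0 ≤ K k l) (hK : NoProperClosedSet K)
    {v : κ → ℝ} (hv : ∀ k, 0 ≤ v k) (hv0 : v ≠ 0) (hinv : v ᵥ* K = v) (k : κ) : 0 < v k := by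
  have hT : {k | 0 < v k} = Set.univ := by
    refine hK _ ?_ ?_
    · by_contra h
      rw [Set.not_nonempty_iff_eq_empty, Set.eq_empty_iff_forall_notMem] at h
      exact hv0 (funext fun k => le_antisymm (not_lt.1 (h k)) (hv k))
    · intro k hk l hkl
      have h1 : v l = ∑ j, v j * K j l := by
        conv_lhs => rw [← hinv]
        rfl
      change 0 < v l
      rw [h1]
      exact Finset.sum_pos' (fun j _ => mul_nonneg (hv j) (h0 j l))
        ⟨k, Finset.mem_univ k, mul_pos hk hkl⟩
  exact (Set.eq_univ_iff_forall.1 hT) k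

/-- The absolute values of a left eigenvector for the eigenvalue one of a stochastic matrix form
an invariant vector. -/
theorem exists_pos_stationary [DecidableEq κ] [Nonempty κ] {K : Matrix κ κ ℝ}
    (hK : K ∈ rowStochastic ℝ κ) (hirr : NoProperClosedSet K) :
    ∃ π : κ → ℝ, (∀ k, 0 < π k) ∧ ∑ k, π k = 1 ∧ π ᵥ* K = π := by
  have hdet : (1 - K).det = 0 := by
    refine exists_mulVec_eq_zero_iff.1 ⟨1, one_ne_zero, ?_⟩
    rw [sub_mulVec, one_mulVec, hK.2, sub_self]
  obtain ⟨v, hv0, hv⟩ := exists_vecMul_eq_zero_iff.2 hdet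
  have hvK : v ᵥ* K = v := by
    rw [vecMul_sub, vecMul_one, sub_eq_zero] at hv
    exact hv.symm
  have hle : ∀ l ∈ Finset.univ, |v l| ≤ ∑ k, |v k| * K k l := by
    intro l _
    have h1 : v l = ∑ k, v k * K k l := by
      conv_lhs => rw [← hvK]
      rfl
    rw [h1]
    refine (Finset.abs_sum_le_sum_abs _ _).trans (Finset.sum_le_sum fun k _ => ?_)
    rw [abs_mul, abs_of_nonneg (hK.1 k l)]
  have hsum : ∑ l, |v l| = ∑ l, ∑ k, |v k| * K k l := by
    rw [Finset.sum_comm]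
    refine Finset.sum_congr rfl fun k _ => ?_
    rw [← Finset.mul_sum, sum_row_of_mem_rowStochastic hK, mul_one]
  have heq := (Finset.sum_eq_sum_iff_of_le hle).1 hsum
  set p : κ → ℝ := fun k => |v k| with hp_def
  have hpK : p ᵥ* K = p := funext fun l => (heq l (Finset.mem_univ l)).symm
  have hp0 : p ≠ 0 := fun h => hv0 (funext fun k => abs_eq_zero.1 (congrFun h k))
  have hpos := pos_of_vecMul_eq hK.1 hirr (fun k => abs_nonneg (v k)) hp0 hpK
  have hs : 0 < ∑ k, p k := Finset.sum_pos (fun k _ => hpos k) Finset.univ_nonempty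
  refine ⟨(∑ k, p k)⁻¹ • p, fun k => ?_, ?_, ?_⟩
  · have := hpos k
    simp only [Pi.smul_apply, smul_eq_mul]; positivity
  · simp only [Pi.smul_apply, smul_eq_mul, ← Finset.mul_sum]
    exact inv_mul_cancel₀ hs.ne'
  · rw [smul_vecMul, hpK]

theorem sum_vecMul_apply {K : Matrix κ κ ℝ} {π : κ → ℝ} (hπ : π ᵥ* K = π) (f : κ → ℝ) :
    ∑ k, ∑ l, π k * K k l * f l = ∑ l, π l * f l := by
  rw [Finset.sum_comm]
  refine Finset.sum_congr rfl fun l _ => ?_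
  rw [← Finset.sum_mul]
  congr 1
  exact congrFun hπ l

/-- The Dirichlet form of a stochastic matrix with respect to an invariant distribution. -/
theorem dirichlet_form_eq [DecidableEq κ] {K : Matrix κ κ ℝ} (hK : K ∈ rowStochastic ℝ κ)
    {π : κ → ℝ} (hπ : π ᵥ* K = π) (x : κ → ℝ) :
    ∑ k, π k * (x k * (x k - (K *ᵥ x) k)) =
      (∑ k, ∑ l, π k * K k l * (x k - x l) ^ 2) / 2 := by
  have h1 : ∑ k, ∑ l, π k * K k l * (x k - x l) ^ 2 =
      ∑ k, ∑ l, π k * K k l * x k ^ 2 + ∑ k, ∑ l, π k * K k l * x l ^ 2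
        - 2 * ∑ k, ∑ l, π k * K k l * (x k * x l) := by
    simp only [Finset.mul_sum, ← Finset.sum_add_distrib, ← Finset.sum_sub_distrib]
    refine Finset.sum_congr rfl fun k _ => Finset.sum_congr rfl fun l _ => by ring
  have h2 : ∑ k, ∑ l, π k * K k l * x k ^ 2 = ∑ k, π k * x k ^ 2 := by
    refine Finset.sum_congr rfl fun k _ => ?_
    rw [← Finset.sum_mul, ← Finset.mul_sum, sum_row_of_mem_rowStochastic hK, mul_one]
  have h3 : ∑ k, ∑ l, π k * K k l * (x k * x l) = ∑ k, π k * (x k * (K *ᵥ x) k) := by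
    refine Finset.sum_congr rfl fun k _ => ?_
    simp only [mulVec, dotProduct, Finset.mul_sum]
    exact Finset.sum_congr rfl fun l _ => by ring
  rw [h1, h2, sum_vecMul_apply hπ (fun l => x l ^ 2), h3]
  rw [eq_div_iff two_ne_zero, Finset.sum_mul]
  simp only [Finset.mul_sum, ← Finset.sum_add_distrib, ← Finset.sum_sub_distrib]
  exact Finset.sum_congr rfl fun k _ => by ring

/-- The spectral gap of an irreducible stochastic matrix, for the additive symmetrization, by
compactness of the unit sphere of the space of mean-zero vectors. -/
theorem exists_spectral_gap [DecidableEq κ] {K : Matrix κ κ ℝ} (hK : K ∈ rowStochastic ℝ κ)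
    (hirr : NoProperClosedSet K) {π : κ → ℝ} (hpos : ∀ k, 0 < π k) (hsum : ∑ k, π k = 1)
    (hπ : π ᵥ* K = π) :
    ∃ c, 0 < c ∧ ∀ x : κ → ℝ, ∑ k, π k * x k = 0 →
      c * ∑ k, π k * x k ^ 2 ≤ ∑ k, π k * (x k * (x k - (K *ᵥ x) k)) := by
  set F : (κ → ℝ) → ℝ := fun x => ∑ k, π k * (x k * (x k - (K *ᵥ x) k)) with hF_def
  have hF_cont : Continuous F := by
    simp only [hF_def, mulVec, dotProduct]
    fun_prop
  have hF_pos : ∀ x, ∑ k, π k * x k = 0 → x ≠ 0 → 0 < F x := by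
    intro x hx hx0
    have hterm : ∀ k l, 0 ≤ π k * K k l * (x k - x l) ^ 2 := fun k l =>
      mul_nonneg (mul_nonneg (hpos k).le (hK.1 k l)) (sq_nonneg _)
    have hF := dirichlet_form_eq hK hπ x
    have hnn : 0 ≤ ∑ k, ∑ l, π k * K k l * (x k - x l) ^ 2 :=
      Finset.sum_nonneg fun k _ => Finset.sum_nonneg fun l _ => hterm k l
    have hFn : 0 ≤ F x := by simp only [hF_def]; rw [hF]; positivity
    refine lt_of_le_of_ne hFn fun h0 => hx0 ?_
    have hz : ∑ k, ∑ l, π k * K k l * (x k - x l) ^ 2 = 0 := by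
      have : F x = (∑ k, ∑ l, π k * K k l * (x k - x l) ^ 2) / 2 := hF
      linarith
    have hz' : ∀ k l, π k * K k l * (x k - x l) ^ 2 = 0 := fun k l =>
      (Finset.sum_eq_zero_iff_of_nonneg (fun l _ => hterm k l)).1
        ((Finset.sum_eq_zero_iff_of_nonneg
          (fun k _ => Finset.sum_nonneg fun l _ => hterm k l)).1 hz k (Finset.mem_univ k))
        l (Finset.mem_univ l)
    funext k₀
    have hT : {l | x l = x k₀} = Set.univ := by
      refine hirr _ ⟨k₀, rfl⟩ fun k hk l hkl => ?_
      have h1 := hz' k l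
      have h2 : π k * K k l ≠ 0 := (mul_pos (hpos k) hkl).ne'
      have h3 : x k - x l = 0 := by simpa [h2] using h1
      change x l = x k₀
      rw [← show x k = x k₀ from hk]
      linarith
    have hc : ∀ l, x l = x k₀ := Set.eq_univ_iff_forall.1 hT
    have : ∑ k, π k * x k = x k₀ := by
      simp only [hc, ← Finset.sum_mul, hsum, one_mul]
    simpa [this] using hx
  set s : Set (κ → ℝ) := {x | ∑ k, π k * x k = 0} ∩ Metric.sphere 0 1 with hs_def
  have hs : IsCompact s := by
    refine (isCompact_sphere 0 1).inter_left ?_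
    exact isClosed_eq (by fun_prop) continuous_const
  have hbound : ∃ c, 0 < c ∧ ∀ x ∈ s, c ≤ F x := by
    rcases s.eq_empty_or_nonempty with he | hne
    · exact ⟨1, one_pos, by simp [he]⟩
    · obtain ⟨x₀, hx₀, hmin⟩ := hs.exists_isMinOn hne hF_cont.continuousOn
      refine ⟨F x₀, hF_pos x₀ hx₀.1 ?_, fun x hx => hmin hx⟩
      rintro rfl
      simpa using hx₀.2
  obtain ⟨c, hc, hcF⟩ := hbound
  refine ⟨c, hc, fun x hx => ?_⟩
  change _ ≤ F x
  by_cases hx0 : x = 0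
  · subst hx0
    simp [hF_def]
  have hn : 0 < ‖x‖ := norm_pos_iff.2 hx0
  have h1 : ∑ k, π k * x k ^ 2 ≤ ‖x‖ ^ 2 := by
    calc ∑ k, π k * x k ^ 2 ≤ ∑ k, π k * ‖x‖ ^ 2 := by
          refine Finset.sum_le_sum fun k _ => mul_le_mul_of_nonneg_left ?_ (hpos k).le
          rw [← sq_abs]
          exact pow_le_pow_left₀ (abs_nonneg _) (norm_le_pi_norm x k) 2
      _ = ‖x‖ ^ 2 := by rw [← Finset.sum_mul, hsum, one_mul]
  have h2 : c ≤ F (‖x‖⁻¹ • x) := by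
    refine hcF _ ⟨?_, ?_⟩
    · change ∑ k, π k * (‖x‖⁻¹ * x k) = 0
      simp only [mul_left_comm _ ‖x‖⁻¹, ← Finset.mul_sum, hx, mul_zero]
    · simp [norm_smul, hn.ne']
  have h3 : F (‖x‖⁻¹ • x) = (‖x‖ ^ 2)⁻¹ * F x := by
    simp only [hF_def, mulVec_smul, Pi.smul_apply, smul_eq_mul, Finset.mul_sum]
    refine Finset.sum_congr rfl fun k _ => ?_
    field_simp
  rw [h3] at h2
  calc c * ∑ k, π k * x k ^ 2 ≤ c * ‖x‖ ^ 2 := mul_le_mul_of_nonneg_left h1 hc.le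
    _ ≤ (‖x‖ ^ 2)⁻¹ * F x * ‖x‖ ^ 2 := mul_le_mul_of_nonneg_right h2 (by positivity)
    _ = F x := by field_simp

/-- Jensen's inequality: a stochastic matrix contracts `ℓ²` of an invariant distribution. -/
theorem sum_mulVec_sq_le [DecidableEq κ] {K : Matrix κ κ ℝ} (hK : K ∈ rowStochastic ℝ κ)
    {π : κ → ℝ} (hpos : ∀ k, 0 ≤ π k) (hπ : π ᵥ* K = π) (x : κ → ℝ) :
    ∑ k, π k * (K *ᵥ x) k ^ 2 ≤ ∑ k, π k * x k ^ 2 := by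
  rw [← sum_vecMul_apply hπ (fun l => x l ^ 2)]
  refine Finset.sum_le_sum fun k _ => ?_
  have h1 : 0 ≤ ∑ l, K k l * (x l - (K *ᵥ x) k) ^ 2 :=
    Finset.sum_nonneg fun l _ => mul_nonneg (hK.1 k l) (sq_nonneg _)
  have h2 : ∑ l, K k l * (x l - (K *ᵥ x) k) ^ 2 =
      ∑ l, K k l * x l ^ 2 - 2 * (K *ᵥ x) k * ∑ l, K k l * x l
        + (K *ᵥ x) k ^ 2 * ∑ l, K k l := by
    simp only [Finset.mul_sum, ← Finset.sum_add_distrib, ← Finset.sum_sub_distrib]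
    exact Finset.sum_congr rfl fun l _ => by ring
  have h3 : ∑ l, K k l * x l = (K *ᵥ x) k := rfl
  rw [h2, sum_row_of_mem_rowStochastic hK, h3] at h1
  have h4 : ∑ l, π k * K k l * x l ^ 2 = π k * ∑ l, K k l * x l ^ 2 := by
    simp only [Finset.mul_sum, mul_assoc]
  rw [h4]
  exact mul_le_mul_of_nonneg_left (by nlinarith) (hpos k)

/-- The lazy version `(1 - β) I + β K` of a stochastic matrix contracts the variance at a rate
proportional to `β`, even if `K` is periodic. -/
theorem variance_lazy_le [DecidableEq κ] {K : Matrix κ κ ℝ} (hK : K ∈ rowStochastic ℝ κ)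
    {π : κ → ℝ} (hpos : ∀ k, 0 ≤ π k) (hπ : π ᵥ* K = π) {c : ℝ} {x : κ → ℝ}
    (hgap : c * ∑ k, π k * x k ^ 2 ≤ ∑ k, π k * (x k * (x k - (K *ᵥ x) k)))
    {β : ℝ} (h0 : 0 ≤ β) (h1 : β ≤ 1) :
    ∑ k, π k * ((1 - β) * x k + β * (K *ᵥ x) k) ^ 2 ≤
      (1 - 2 * β * (1 - β) * c) * ∑ k, π k * x k ^ 2 := by
  have e1 : ∑ k, π k * ((1 - β) * x k + β * (K *ᵥ x) k) ^ 2 =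
      (1 - β ^ 2) * ∑ k, π k * x k ^ 2
        - 2 * β * (1 - β) * ∑ k, π k * (x k * (x k - (K *ᵥ x) k))
        + β ^ 2 * ∑ k, π k * (K *ᵥ x) k ^ 2 := by
    simp only [Finset.mul_sum, ← Finset.sum_add_distrib, ← Finset.sum_sub_distrib]
    exact Finset.sum_congr rfl fun l _ => by ring
  have e2 := mul_le_mul_of_nonneg_left (sum_mulVec_sq_le hK hpos hπ x) (sq_nonneg β)
  have e3 := mul_le_mul_of_nonneg_left hgap
    (mul_nonneg (mul_nonneg zero_le_two h0) (sub_nonneg.2 h1))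
  linarith

end Stochastic

/-! ### Mixing of irreducible aperiodic stochastic matrices -/

section Mixing

variable {S : Type*} [Fintype S] [DecidableEq S]

theorem pow_add_apply_pos {P : Matrix S S ℝ} (h0 : ∀ i j, 0 ≤ P i j) {m n : ℕ} {i j k : S}
    (h1 : 0 < (P ^ m) i j) (h2 : 0 < (P ^ n) j k) : 0 < (P ^ (m + n)) i k := by
  rw [pow_add, mul_apply]
  exact Finset.sum_pos' (fun l _ => mul_nonneg (pow_apply_nonneg h0 m i l)
    (pow_apply_nonneg h0 n l k)) ⟨j, Finset.mem_univ j, mul_pos h1 h2⟩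

/-- The times at which a return to `i` is possible form an additive semigroup with greatest common
divisor one, so they contain all large integers. -/
theorem eventually_pow_pos {P : Matrix S S ℝ} (hirr : P.IsIrreducible) (hper : IsAperiodic P) :
    ∀ᶠ n in atTop, ∀ i j, 0 < (P ^ n) i j := by
  have h0 := hirr.nonneg
  refine eventually_all.2 fun i => eventually_all.2 fun j => ?_
  obtain ⟨k, -, hk⟩ := (isIrreducible_iff_exists_pow_pos h0).1 hirr i j
  set s : Set ℕ := {n | 0 < n ∧ 0 < (P ^ n) i i} with hs_def
  have hgcd : Nat.setGcd s = 1 := hper i _ fun n hn hp => Nat.setGcd_dvd_of_mem ⟨hn, hp⟩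
  obtain ⟨N, hN⟩ := Nat.exists_mem_closure_of_ge s
  have hcl : ∀ n ∈ AddSubmonoid.closure s, 0 < (P ^ n) i i := by
    intro n hn
    induction hn using AddSubmonoid.closure_induction with
    | mem n hn => exact hn.2
    | zero => simp
    | add m n _ _ hm hn => exact pow_add_apply_pos h0 hm hn
  filter_upwards [eventually_ge_atTop (N + k)] with n hn
  have h1 := hcl (n - k) (hN _ (by omega) (by rw [hgcd]; exact one_dvd _))
  have h2 := pow_add_apply_pos h0 h1 hk
  rwa [Nat.sub_add_cancel (by omega)] at h2

theorem norm_mulVec_le_of_mem_rowStochastic {P : Matrix S S ℝ} (hP : P ∈ rowStochastic ℝ S)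
    (f : S → ℝ) : ‖P *ᵥ f‖ ≤ ‖f‖ := by
  refine (pi_norm_le_iff_of_nonneg (norm_nonneg _)).2 fun i => ?_
  calc ‖(P *ᵥ f) i‖ ≤ ∑ j, ‖P i j * f j‖ := norm_sum_le _ _
    _ ≤ ∑ j, P i j * ‖f‖ := by
      refine Finset.sum_le_sum fun j _ => ?_
      rw [norm_mul, Real.norm_of_nonneg (hP.1 i j)]
      exact mul_le_mul_of_nonneg_left (norm_le_pi_norm f j) (hP.1 i j)
    _ = ‖f‖ := by rw [← Finset.sum_mul, sum_row_of_mem_rowStochastic hP, one_mul]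

/-- Doeblin's argument: if `P ^ m` has positive entries, it contracts the mean-zero functions, so
that the series of the functions `P ^ k f` converges absolutely. -/
theorem summable_norm_pow_mulVec {P : Matrix S S ℝ} (hP : P ∈ rowStochastic ℝ S)
    (hirr : P.IsIrreducible) (hper : IsAperiodic P) {d : S → ℝ} (hd : IsStationary P d)
    {f : S → ℝ} (hf : d ⬝ᵥ f = 0) : Summable fun k => ‖(P ^ k) *ᵥ f‖ := by
  obtain ⟨m, hm⟩ := (eventually_pow_pos hirr hper).exists
  obtain ⟨δ, hδ, hδm⟩ : ∃ δ, 0 < δ ∧ ∀ i j, δ ≤ (P ^ m) i j := by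
    rcases isEmpty_or_nonempty S with hS | hS
    · exact ⟨1, one_pos, fun i => hS.elim i⟩
    · obtain ⟨q, hq⟩ := Finite.exists_min fun q : S × S => (P ^ m) q.1 q.2
      exact ⟨_, hm q.1 q.2, fun i j => hq (i, j)⟩
  have hPk : ∀ k, P ^ k ∈ rowStochastic ℝ S := fun k => Submonoid.pow_mem _ hP k
  have hdk : ∀ k, d ⬝ᵥ ((P ^ k) *ᵥ f) = 0 := by
    intro k
    induction k with
    | zero => simpa using hf
    | succ k ih => rw [pow_succ', ← mulVec_mulVec, dotProduct_mulVec, hd.invariant, ih]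
  have hd1 : ∀ j, d j ≤ 1 := fun j => by
    rw [← hd.sum_one]
    exact Finset.single_le_sum (fun i _ => hd.nonneg i) (Finset.mem_univ j)
  have hcontr : ∀ f : S → ℝ, d ⬝ᵥ f = 0 → ‖(P ^ m) *ᵥ f‖ ≤ (1 - δ) * ‖f‖ := by
    intro f hf
    rcases isEmpty_or_nonempty S with hS | ⟨⟨i₀⟩⟩
    · have : f = 0 := Subsingleton.elim _ _
      simp [this]
    have hnn : ∀ i j, 0 ≤ (P ^ m) i j - δ * d j := fun i j => by
      have := mul_le_mul_of_nonneg_left (hd1 j) hδ.le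
      linarith [hδm i j]
    have hrow : ∀ i, ∑ j, ((P ^ m) i j - δ * d j) = 1 - δ := fun i => by
      rw [Finset.sum_sub_distrib, sum_row_of_mem_rowStochastic (hPk m), ← Finset.mul_sum,
        hd.sum_one, mul_one]
    have hδ1 : 0 ≤ 1 - δ := by
      rw [← hrow i₀]
      exact Finset.sum_nonneg fun j _ => hnn i₀ j
    refine (pi_norm_le_iff_of_nonneg (by positivity)).2 fun i => ?_
    have h1 : ((P ^ m) *ᵥ f) i = ∑ j, ((P ^ m) i j - δ * d j) * f j := by
      have : ∑ j, δ * d j * f j = 0 := by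
        simp only [mul_assoc, ← Finset.mul_sum]
        rw [show ∑ j, d j * f j = 0 from hf, mul_zero]
      simp only [sub_mul, Finset.sum_sub_distrib, this, sub_zero]
      rfl
    rw [h1]
    calc ‖∑ j, ((P ^ m) i j - δ * d j) * f j‖ ≤ ∑ j, ‖((P ^ m) i j - δ * d j) * f j‖ :=
          norm_sum_le _ _
      _ ≤ ∑ j, ((P ^ m) i j - δ * d j) * ‖f‖ := by
        refine Finset.sum_le_sum fun j _ => ?_
        rw [norm_mul, Real.norm_of_nonneg (hnn i j)]
        exact mul_le_mul_of_nonneg_left (norm_le_pi_norm f j) (hnn i j)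
      _ = (1 - δ) * ‖f‖ := by rw [← Finset.sum_mul, hrow]
  set c : ℕ → ℝ := fun k => ‖(P ^ k) *ᵥ f‖ with hc_def
  have hc0 : ∀ k, 0 ≤ c k := fun k => norm_nonneg _
  have hstep : ∀ k, c (m + k) ≤ (1 - δ) * c k := fun k => by
    simp only [hc_def]
    rw [pow_add, ← mulVec_mulVec]
    exact hcontr _ (hdk k)
  refine summable_of_sum_range_le (c := (∑ k ∈ Finset.range m, c k) / δ) hc0 fun n => ?_
  have h1 : ∑ k ∈ Finset.range n, c k ≤ ∑ k ∈ Finset.range (m + n), c k :=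
    Finset.sum_le_sum_of_subset_of_nonneg (Finset.range_mono (Nat.le_add_left _ _))
      fun k _ _ => hc0 k
  have h2 : ∑ k ∈ Finset.range (m + n), c k ≤
      ∑ k ∈ Finset.range m, c k + (1 - δ) * ∑ k ∈ Finset.range n, c k := by
    rw [Finset.sum_range_add, Finset.mul_sum]
    exact add_le_add le_rfl (Finset.sum_le_sum fun k _ => hstep k)
  rw [le_div_iff₀ hδ]
  linarith

end Mixing

/-! ### A time-inhomogeneous Poisson equation -/

/-- Young's inequality for the correlation of a square summable and a summable sequence. -/
theorem summable_sq_tsum_mul {b c : ℕ → ℝ} (hb : ∀ n, 0 ≤ b n) (hc : ∀ n, 0 ≤ c n)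
    (hb2 : Summable fun n => b n ^ 2) (hc1 : Summable c) :
    Summable fun n => (∑' k, b (n + k) * c k) ^ 2 := by
  have hprod : Summable fun p : ℕ × ℕ => b (p.1 + p.2) ^ 2 * c p.2 := by
    have h1 : Summable fun p : ℕ × ℕ => b p.1 ^ 2 * c p.2 :=
      Summable.mul_of_nonneg (f := fun n => b n ^ 2) (g := c) hb2 hc1
        (fun n => sq_nonneg (b n)) hc
    have hinj : Function.Injective fun p : ℕ × ℕ => (p.1 + p.2, p.2) := by
      rintro ⟨x, y⟩ ⟨x', y'⟩ h
      simp only [Prod.mk.injEq] at h ⊢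
      omega
    have h2 := h1.comp_injective hinj
    simpa only [Function.comp_def] using h2
  obtain ⟨hrow, hsum⟩ := (summable_prod_of_nonneg
    (fun p => mul_nonneg (sq_nonneg _) (hc p.2))).1 hprod
  refine Summable.of_nonneg_of_le (fun n => sq_nonneg _) (fun n => ?_) (hsum.mul_left (∑' k, c k))
  obtain ⟨B, hB⟩ : ∃ B, ∀ k, b k ≤ B := by
    obtain ⟨B, hB⟩ := (tendsto_zero_of_summable_sq hb2).bddAbove_range
    exact ⟨B, fun k => hB ⟨k, rfl⟩⟩
  have hbc : Summable fun k => b (n + k) * c k :=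
    Summable.of_nonneg_of_le (fun k => mul_nonneg (hb _) (hc k))
      (fun k => mul_le_mul_of_nonneg_right (hB _) (hc k)) (hc1.mul_left B)
  refine le_of_tendsto (hbc.hasSum.pow 2) (Eventually.of_forall fun s => ?_)
  refine (Finset.sum_sq_le_sum_mul_sum_of_sq_le_mul s (fun k _ => hc k)
    (fun k _ => mul_nonneg (sq_nonneg (b (n + k))) (hc k)) fun k _ => le_of_eq (by ring)).trans ?_
  exact mul_le_mul (hc1.sum_le_tsum s fun k _ => hc k)
    ((hrow n).sum_le_tsum s fun k _ => mul_nonneg (sq_nonneg _) (hc k))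
    (Finset.sum_nonneg fun k _ => mul_nonneg (sq_nonneg _) (hc k)) (tsum_nonneg hc)

/-- The conditional expectation `F n i` of the weighted future sum `∑ₖ b (n + k) g (Xₙ₊ₖ)` given
`Xₙ = i`. Because it weights the future with the actual step sizes, the resulting decomposition
needs no monotonicity of `b`. -/
theorem exists_poisson_solution {S : Type*} [Fintype S] [DecidableEq S] {P : Matrix S S ℝ}
    {g : S → ℝ} (hg : Summable fun k => ‖(P ^ k) *ᵥ g‖) {b : ℕ → ℝ} (hb : ∀ n, 0 ≤ b n)
    (hb2 : Summable fun n => b n ^ 2) :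
    ∃ (F : ℕ → S → ℝ) (G : ℕ → ℝ), (∀ n i, F n i = b n * g i + (P *ᵥ F (n + 1)) i) ∧
      (∀ n i, |F n i| ≤ G n) ∧ Summable fun n => G n ^ 2 := by
  set c : ℕ → ℝ := fun k => ‖(P ^ k) *ᵥ g‖ with hc_def
  have hc : ∀ k, 0 ≤ c k := fun k => norm_nonneg _
  obtain ⟨B, hB⟩ : ∃ B, ∀ k, b k ≤ B := by
    obtain ⟨B, hB⟩ := (tendsto_zero_of_summable_sq hb2).bddAbove_range
    exact ⟨B, fun k => hB ⟨k, rfl⟩⟩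
  have hbc : ∀ n, Summable fun k => b (n + k) * c k := fun n =>
    Summable.of_nonneg_of_le (fun k => mul_nonneg (hb _) (hc k))
      (fun k => mul_le_mul_of_nonneg_right (hB _) (hc k)) (hg.mul_left B)
  have hle : ∀ n k i, ‖b (n + k) * ((P ^ k) *ᵥ g) i‖ ≤ b (n + k) * c k := fun n k i => by
    rw [norm_mul, Real.norm_of_nonneg (hb _)]
    exact mul_le_mul_of_nonneg_left (norm_le_pi_norm _ i) (hb _)
  have hsummable : ∀ n i, Summable fun k => b (n + k) * ((P ^ k) *ᵥ g) i := fun n i =>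
    Summable.of_norm_bounded (hbc n) fun k => hle n k i
  refine ⟨fun n i => ∑' k, b (n + k) * ((P ^ k) *ᵥ g) i, fun n => ∑' k, b (n + k) * c k,
    fun n i => ?_, fun n i => tsum_of_norm_bounded (hbc n).hasSum fun k => hle n k i,
    summable_sq_tsum_mul hb hc hb2 hg⟩
  refine (hsummable n i).tsum_eq_zero_add.trans ?_
  congr 1
  · simp
  · change _ = ∑ j, P i j * ∑' k, b (n + 1 + k) * ((P ^ k) *ᵥ g) j
    simp_rw [← tsum_mul_left]
    rw [← Summable.tsum_finsetSum fun j _ => (hsummable (n + 1) j).mul_left (P i j)]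
    refine tsum_congr fun k => ?_
    have h1 : ((P ^ (k + 1)) *ᵥ g) i = ∑ j, P i j * ((P ^ k) *ᵥ g) j := by
      rw [pow_succ', ← mulVec_mulVec]; rfl
    change b (n + (k + 1)) * ((P ^ (k + 1)) *ᵥ g) i = _
    rw [h1, Finset.mul_sum, show n + (k + 1) = n + 1 + k by ring]
    refine Finset.sum_congr rfl fun j _ => ?_
    simp only [mulVec, dotProduct]
    ring

/-! ### Martingales of a controlled Markov chain -/

section Chain

variable {S A : Type*}

/-- The states up to time `n` and the actions before time `n`. -/
@[ext]
structure History (S A : Type*) (n : ℕ) where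
  state : Fin (n + 1) → S
  action : Fin n → A

instance [Fintype S] [Fintype A] (n : ℕ) : Finite (History S A n) :=
  Finite.of_injective (fun t => (t.state, t.action)) fun t t' h => by
    obtain ⟨h1, h2⟩ := Prod.ext_iff.1 h
    exact History.ext h1 h2

instance (n : ℕ) : MeasurableSpace (History S A n) := ⊤

instance (n : ℕ) : DiscreteMeasurableSpace (History S A n) := ⟨fun _ => trivial⟩

/-- The history of the processes `X` and `Z` at time `n`. -/
def history {Ω : Type*} (X : ℕ → Ω → S) (Z : ℕ → Ω → A) (n : ℕ) (ω : Ω) : History S A n :=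
  ⟨fun k => X k ω, fun k => Z k ω⟩

theorem integral_comp_of_finite {Ω T : Type*} [MeasurableSpace Ω] {μ : Measure Ω}
    [IsFiniteMeasure μ] [Fintype T] {Y : Ω → T} (hY : ∀ t, MeasurableSet (Y ⁻¹' {t}))
    (F : T → ℝ) : ∫ ω, F (Y ω) ∂μ = ∑ t, μ.real (Y ⁻¹' {t}) * F t := by
  let _ : MeasurableSpace T := ⊤
  have hYm : Measurable Y := measurable_to_countable' hY
  have h1 := integral_map (μ := μ) hYm.aemeasurable
    (StronglyMeasurable.of_discrete (f := F)).aestronglyMeasurable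
  rw [← h1, integral_fintype Integrable.of_finite]
  refine Finset.sum_congr rfl fun t _ => ?_
  rw [map_measureReal_apply hYm (measurableSet_singleton t), smul_eq_mul]

variable [Fintype S] [Fintype A] {Ω : Type*} [MeasurableSpace Ω] {μ : Measure Ω}
  {M : MDP S A} {q : S → A → ℝ} {X : ℕ → Ω → S} {Z : ℕ → Ω → A}

theorem measurable_history (hX : IsControlledChain μ M q X Z) (n : ℕ) :
    Measurable (history X Z n) := by
  refine measurable_to_countable' fun t => ?_
  have : history X Z n ⁻¹' {t} =
      (⋂ k : Fin (n + 1), {ω | X k ω = t.state k}) ∩ ⋂ k : Fin n, {ω | Z k ω = t.action k} := by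
    ext ω
    simp only [history, Set.mem_preimage, Set.mem_singleton_iff, Set.mem_inter_iff,
      Set.mem_iInter, Set.mem_ofPred_eq]
    rw [History.ext_iff, funext_iff, funext_iff]
  rw [this]
  exact (MeasurableSet.iInter fun k => hX.measurable_state _ _).inter
    (MeasurableSet.iInter fun k => hX.measurable_action _ _)

/-- A function of the transition at time `n` with zero conditional mean is orthogonal to every
function of the history at time `n`. -/
theorem integral_history_mul_eq_zero [IsFiniteMeasure μ] (hX : IsControlledChain μ M q X Z)
    (n : ℕ) (ψ : History S A n → ℝ) {φ : S → A → S → ℝ}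
    (hφ : ∀ i, ∑ a, ∑ j, q i a * M.p i a j * φ i a j = 0) :
    ∫ ω, ψ (history X Z n ω) * φ (X n ω) (Z n ω) (X (n + 1) ω) ∂μ = 0 := by
  classical
  have : Fintype (History S A n) := Fintype.ofFinite _
  set Y : Ω → History S A n × A × S := fun ω => (history X Z n ω, Z n ω, X (n + 1) ω) with hY_def
  have hpre : ∀ t a j, Y ⁻¹' {(t, a, j)} =
      history X Z n ⁻¹' {t} ∩ ({ω | Z n ω = a} ∩ {ω | X (n + 1) ω = j}) := by
    intro t a j
    ext ω
    simp [hY_def]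
  have hY : ∀ t, MeasurableSet (Y ⁻¹' {t}) := by
    rintro ⟨t, a, j⟩
    rw [hpre]
    exact (measurable_history hX n (measurableSet_singleton t)).inter
      ((hX.measurable_action _ _).inter (hX.measurable_state _ _))
  have hmass : ∀ t a j, μ.real (Y ⁻¹' {(t, a, j)}) =
      μ.real (history X Z n ⁻¹' {t}) *
        (q (t.state (Fin.last n)) a * M.p (t.state (Fin.last n)) a j) := by
    intro t a j
    have hstep := hX.step n (fun k => if h : k < n + 1 then t.state ⟨k, h⟩ else j)
      (fun k => if h : k < n then t.action ⟨k, h⟩ else a)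
    simp only [Nat.lt_irrefl, dite_false, Nat.lt_succ_self, dite_true] at hstep
    convert hstep using 2
    · ext ω
      rw [hpre]
      simp only [history, Set.mem_inter_iff, Set.mem_preimage, Set.mem_singleton_iff,
        Set.mem_ofPred_eq]
      rw [History.ext_iff, funext_iff, funext_iff]
      constructor
      · rintro ⟨⟨h1, h2⟩, h3, h4⟩
        refine ⟨fun k hk => ?_, fun k hk => ?_⟩
        · split_ifs with h
          · exact h1 ⟨k, h⟩
          · obtain rfl : k = n + 1 := by omega
            exact h4
        · split_ifs with h
          · exact h2 ⟨k, h⟩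
          · obtain rfl : k = n := by omega
            exact h3
      · rintro ⟨h1, h2⟩
        refine ⟨⟨fun k => ?_, fun k => ?_⟩, ?_, ?_⟩
        · have := h1 k k.2.le
          simpa [k.2] using this
        · have := h2 k k.2.le
          simpa [k.2] using this
        · simpa using h2 n le_rfl
        · simpa using h1 (n + 1) le_rfl
    · congr 1
      ext ω
      simp only [history, Set.mem_preimage, Set.mem_singleton_iff, Set.mem_ofPred_eq]
      rw [History.ext_iff, funext_iff, funext_iff]
      constructor
      · rintro ⟨h1, h2⟩
        refine ⟨fun k hk => ?_, fun k hk => ?_⟩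
        · rw [dif_pos (by omega)]
          exact h1 ⟨k, by omega⟩
        · rw [dif_pos hk]
          exact h2 ⟨k, hk⟩
      · rintro ⟨h1, h2⟩
        refine ⟨fun k => ?_, fun k => ?_⟩
        · have := h1 k (by omega)
          simpa [k.2] using this
        · have := h2 k k.2
          simpa [k.2] using this
    · rfl
  have hint := integral_comp_of_finite (μ := μ) hY
    (fun t => ψ t.1 * φ (t.1.state (Fin.last n)) t.2.1 t.2.2)
  refine Eq.trans ?_ (hint.trans ?_)
  · rfl
  · rw [Fintype.sum_prod_type]
    refine Finset.sum_eq_zero fun t _ => ?_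
    rw [Fintype.sum_prod_type]
    have h0 := hφ (t.state (Fin.last n))
    calc ∑ a, ∑ j, μ.real (Y ⁻¹' {(t, a, j)}) * (ψ t * φ (t.state (Fin.last n)) a j)
        = μ.real (history X Z n ⁻¹' {t}) * ψ t * ∑ a, ∑ j,
            q (t.state (Fin.last n)) a * M.p (t.state (Fin.last n)) a j
              * φ (t.state (Fin.last n)) a j := by
          simp only [hmass, Finset.mul_sum]
          exact Finset.sum_congr rfl fun a _ => Finset.sum_congr rfl fun j _ => by ring
      _ = 0 := by rw [h0, mul_zero]

/-- The filtration generated by the histories. -/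
def historyFiltration (hX : IsControlledChain μ M q X Z) :
    Filtration ℕ (‹MeasurableSpace Ω›) where
  seq n := MeasurableSpace.comap (history X Z n) ⊤
  mono' m n hmn := by
    have : history X Z m =
        (fun t : History S A n => (⟨fun k => t.state ⟨k, by omega⟩,
          fun k => t.action ⟨k, by omega⟩⟩ : History S A m)) ∘ history X Z n := rfl
    change MeasurableSpace.comap (history X Z m) ⊤ ≤ _
    rw [this, ← MeasurableSpace.comap_comp]
    exact MeasurableSpace.comap_mono le_top
  le' n := (measurable_history hX n).comap_le

/-- Almost sure convergence of a martingale which is bounded in `L²`: a series of functions of the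
transitions with zero conditional means and square summable bounds. -/
theorem ae_tendsto_sum_of_square_summable [IsProbabilityMeasure μ]
    (hX : IsControlledChain μ M q X Z) {φ : ℕ → S → A → S → ℝ}
    (hφ : ∀ n i, ∑ a, ∑ j, q i a * M.p i a j * φ n i a j = 0) {β : ℕ → ℝ}
    (hβ : ∀ n i a j, |φ n i a j| ≤ β n) (hβ2 : Summable fun n => β n ^ 2) :
    ∀ᵐ ω ∂μ, ∃ c, Tendsto
      (fun N => ∑ n ∈ Finset.range N, φ n (X n ω) (Z n ω) (X (n + 1) ω)) atTop (𝓝 c) := by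
  set W : ℕ → Ω → ℝ := fun N ω =>
    ∑ n ∈ Finset.range N, φ n (X n ω) (Z n ω) (X (n + 1) ω) with hW_def
  set ψ : ∀ N, History S A N → ℝ := fun N t =>
    ∑ n : Fin N, φ n (t.state n.castSucc) (t.action n) (t.state n.succ) with hψ_def
  have hWψ : ∀ N ω, W N ω = ψ N (history X Z N ω) := fun N ω => by
    simp only [hW_def, hψ_def, history, Fin.val_succ, Fin.val_castSucc]
    exact Finset.sum_range fun n => φ n (X n ω) (Z n ω) (X (n + 1) ω)
  have hint : ∀ N (f : History S A N → ℝ), Integrable (fun ω => f (history X Z N ω)) μ :=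
    fun N f => (Integrable.of_finite (f := f)).comp_measurable (measurable_history hX N)
  have hWint : ∀ N, Integrable (W N) μ := fun N => by
    rw [show W N = fun ω => ψ N (history X Z N ω) from funext (hWψ N)]
    exact hint N _
  have hWsucc : ∀ N ω, W (N + 1) ω = W N ω + φ N (X N ω) (Z N ω) (X (N + 1) ω) := fun N ω =>
    Finset.sum_range_succ _ _
  have hmart : Martingale W (historyFiltration hX) μ := by
    refine martingale_of_setIntegral_eq_succ (fun N => ?_) hWint fun N s hs => ?_
    · rw [show W N = ψ N ∘ history X Z N from funext (hWψ N)]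
      exact (StronglyMeasurable.of_discrete (f := ψ N)).comp_measurable (comap_measurable _)
    · obtain ⟨T, -, rfl⟩ := hs
      have hTm : MeasurableSet (history X Z N ⁻¹' T) :=
        measurable_history hX N (MeasurableSet.of_discrete (s := T))
      classical
      have h0 := integral_history_mul_eq_zero hX N (T.indicator 1) (hφ N)
      have h1 : ∫ ω in history X Z N ⁻¹' T, (W (N + 1) ω - W N ω) ∂μ = 0 := by
        rw [← integral_indicator hTm, ← h0]
        refine integral_congr_ae (Eventually.of_forall fun ω => ?_)
        by_cases hω : history X Z N ω ∈ T <;>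
          simp [Set.indicator, hω, hWsucc]
      rw [integral_sub (hWint _).integrableOn (hWint _).integrableOn] at h1
      linarith
  have hsq : ∀ N, ∫ ω, W N ω ^ 2 ∂μ ≤ ∑ n ∈ Finset.range N, β n ^ 2 := by
    intro N
    induction N with
    | zero => simp [hW_def]
    | succ N ih =>
      have hWsq : Integrable (fun ω => W N ω ^ 2) μ := by
        simp only [hWψ]
        exact hint N fun t => ψ N t ^ 2
      have hφint : ∀ f : S → A → S → ℝ,
          Integrable (fun ω => f (X N ω) (Z N ω) (X (N + 1) ω)) μ := fun f =>
        hint (N + 1) fun t => f (t.state (Fin.last N).castSucc) (t.action (Fin.last N))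
          (t.state (Fin.last (N + 1)))
      have hcross : Integrable
          (fun ω => W N ω * φ N (X N ω) (Z N ω) (X (N + 1) ω)) μ := by
        have := hint (N + 1) fun t => (ψ (N + 1) t - φ N (t.state (Fin.last N).castSucc)
          (t.action (Fin.last N)) (t.state (Fin.last (N + 1)))) *
            φ N (t.state (Fin.last N).castSucc) (t.action (Fin.last N))
              (t.state (Fin.last (N + 1)))
        refine this.congr (Eventually.of_forall fun ω => ?_)
        change (ψ (N + 1) (history X Z (N + 1) ω) - φ N (X N ω) (Z N ω) (X (N + 1) ω)) *
          φ N (X N ω) (Z N ω) (X (N + 1) ω) = _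
        rw [← hWψ, hWsucc, add_sub_cancel_right]
      have h0 : ∫ ω, W N ω * φ N (X N ω) (Z N ω) (X (N + 1) ω) ∂μ = 0 := by
        simp only [hWψ]
        exact integral_history_mul_eq_zero hX N (ψ N) (hφ N)
      have hφ2 : Integrable (fun ω => φ N (X N ω) (Z N ω) (X (N + 1) ω) ^ 2) μ :=
        hφint fun i a j => φ N i a j ^ 2
      have h1 : ∫ ω, W (N + 1) ω ^ 2 ∂μ = ∫ ω, W N ω ^ 2 ∂μ
          + 2 * ∫ ω, W N ω * φ N (X N ω) (Z N ω) (X (N + 1) ω) ∂μ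
          + ∫ ω, φ N (X N ω) (Z N ω) (X (N + 1) ω) ^ 2 ∂μ := by
        have e1 := integral_add (hWsq.add (hcross.const_mul 2)) hφ2
        have e2 := integral_add hWsq (hcross.const_mul 2)
        rw [integral_const_mul] at e2
        rw [← e2]
        refine Eq.trans ?_ e1
        refine integral_congr_ae (Eventually.of_forall fun ω => ?_)
        simp only [hWsucc, Pi.add_apply]
        ring
      have h2 : ∫ ω, φ N (X N ω) (Z N ω) (X (N + 1) ω) ^ 2 ∂μ ≤ β N ^ 2 := by
        calc ∫ ω, φ N (X N ω) (Z N ω) (X (N + 1) ω) ^ 2 ∂μ ≤ ∫ _, β N ^ 2 ∂μ := by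
              refine integral_mono hφ2 (integrable_const _) fun ω => ?_
              simp only
              rw [← sq_abs]
              exact pow_le_pow_left₀ (abs_nonneg _) (hβ _ _ _ _) 2
          _ = β N ^ 2 := by simp
      rw [Finset.sum_range_succ, h1, h0]
      linarith
  refine hmart.submartingale.exists_ae_tendsto_of_bdd
    (R := (1 + ∑' n, β n ^ 2).toNNReal) fun N => ?_
  rw [eLpNorm_one_eq_lintegral_enorm, ← ofReal_integral_norm_eq_lintegral_enorm (hWint N)]
  refine ENNReal.ofReal_le_ofReal ?_
  have hWsq : Integrable (fun ω => W N ω ^ 2) μ := by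
    simp only [hWψ]
    exact hint N fun t => ψ N t ^ 2
  calc ∫ ω, ‖W N ω‖ ∂μ ≤ ∫ ω, (1 + W N ω ^ 2) ∂μ := by
        refine integral_mono (hWint N).norm ((integrable_const _).add hWsq) fun ω => ?_
        simp only [Real.norm_eq_abs]
        nlinarith [sq_abs (W N ω), sq_nonneg (|W N ω| - 1), abs_nonneg (W N ω)]
    _ = 1 + ∫ ω, W N ω ^ 2 ∂μ := by
        rw [integral_add (integrable_const _) hWsq]; simp
    _ ≤ 1 + ∑' n, β n ^ 2 := by
        refine add_le_add le_rfl ((hsq N).trans ?_)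
        exact hβ2.sum_le_tsum _ fun n _ => sq_nonneg _

end Chain

/-! ### Fluctuations around the stationary mean -/

section Fluctuations

variable {S A : Type*} [Fintype S] [Fintype A] {M : MDP S A} {q : S → A → ℝ} {d : S → ℝ}

/-- The mean of a function of a transition of the chain in stationarity. -/
def stationaryMean {V : Type*} [AddCommGroup V] [Module ℝ V] (M : MDP S A) (q : S → A → ℝ)
    (d : S → ℝ) (f : S → A → S → V) : V :=
  ∑ i, ∑ a, ∑ j, (d i * (q i a * M.p i a j)) • f i a j

theorem map_stationaryMean {V W : Type*} [AddCommGroup V] [Module ℝ V] [AddCommGroup W]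
    [Module ℝ W] (T : V →ₗ[ℝ] W) (f : S → A → S → V) :
    T (stationaryMean M q d f) = stationaryMean M q d fun i a j => T (f i a j) := by
  simp only [stationaryMean, map_sum, map_smul]

theorem stationaryMean_const_right (hq1 : ∀ i, ∑ a, q i a = 1) (f : S → ℝ) :
    (stationaryMean M q d fun i _ _ => f i) = ∑ i, d i * f i := by
  simp only [stationaryMean, smul_eq_mul, ← Finset.sum_mul, ← Finset.mul_sum, M.p_sum, mul_one,
    hq1]

open Classical in
/-- Along the path `(x, z)`, the fluctuations of the indicators of the transitions around their
stationary means, weighted by `b`, form convergent series. -/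
def HasConvergentFluctuations (M : MDP S A) (q : S → A → ℝ) (d : S → ℝ) (b : ℕ → ℝ)
    (x : ℕ → S) (z : ℕ → A) : Prop :=
  ∀ i a j, ∃ c, Tendsto (fun N => ∑ n ∈ Finset.range N,
    b n * ((if x n = i ∧ z n = a ∧ x (n + 1) = j then 1 else 0) - d i * (q i a * M.p i a j)))
    atTop (𝓝 c)

/-- By linearity, the convergence for the indicators of the transitions gives the convergence for
every function of the transitions. -/
theorem HasConvergentFluctuations.tendsto {V : Type*} [NormedAddCommGroup V] [NormedSpace ℝ V]
    {b : ℕ → ℝ} {x : ℕ → S} {z : ℕ → A} (h : HasConvergentFluctuations M q d b x z)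
    (f : S → A → S → V) :
    ∃ c, Tendsto (fun N => ∑ n ∈ Finset.range N,
      b n • (f (x n) (z n) (x (n + 1)) - stationaryMean M q d f)) atTop (𝓝 c) := by
  classical
  choose c hc using h
  refine ⟨∑ i, ∑ a, ∑ j, c i a j • f i a j, ?_⟩
  have h1 : ∀ n, b n • (f (x n) (z n) (x (n + 1)) - stationaryMean M q d f) =
      ∑ i, ∑ a, ∑ j, (b n * ((if x n = i ∧ z n = a ∧ x (n + 1) = j then 1 else 0)
        - d i * (q i a * M.p i a j))) • f i a j := by
    intro n
    have h2 : f (x n) (z n) (x (n + 1)) = ∑ i, ∑ a, ∑ j,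
        (if x n = i ∧ z n = a ∧ x (n + 1) = j then (1 : ℝ) else 0) • f i a j := by
      rw [Finset.sum_eq_single (x n), Finset.sum_eq_single (z n),
        Finset.sum_eq_single (x (n + 1))]
      · simp
      · intro j _ hj
        simp [hj.symm]
      · simp
      · intro a _ ha
        simp [ha.symm]
      · simp
      · intro i _ hi
        simp [hi.symm]
      · simp
    conv_lhs => rw [h2]
    simp only [stationaryMean, Finset.smul_sum, ← Finset.sum_sub_distrib]
    refine Finset.sum_congr rfl fun i _ => Finset.sum_congr rfl fun a _ =>
      Finset.sum_congr rfl fun j _ => ?_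
    rw [← sub_smul, smul_smul]
  simp only [h1]
  have h3 : ∀ N, ∑ n ∈ Finset.range N, ∑ i, ∑ a, ∑ j,
      (b n * ((if x n = i ∧ z n = a ∧ x (n + 1) = j then 1 else 0)
        - d i * (q i a * M.p i a j))) • f i a j =
      ∑ i, ∑ a, ∑ j, (∑ n ∈ Finset.range N,
        b n * ((if x n = i ∧ z n = a ∧ x (n + 1) = j then 1 else 0)
        - d i * (q i a * M.p i a j))) • f i a j := by
    intro N
    rw [Finset.sum_comm]
    refine Finset.sum_congr rfl fun i _ => ?_
    rw [Finset.sum_comm]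
    refine Finset.sum_congr rfl fun a _ => ?_
    rw [Finset.sum_comm]
    refine Finset.sum_congr rfl fun j _ => ?_
    rw [Finset.sum_smul]
  simp only [h3]
  exact tendsto_finsetSum _ fun i _ => tendsto_finsetSum _ fun a _ =>
    tendsto_finsetSum _ fun j _ => (hc i a j).smul_const _

/-- Kronecker's lemma for the weights `1 / (n + 1)`. -/
theorem tendsto_average_of_tendsto_series {V : Type*} [NormedAddCommGroup V] [NormedSpace ℝ V]
    {g : ℕ → V} {c : V}
    (h : Tendsto (fun N => ∑ n ∈ Finset.range N, ((n : ℝ) + 1)⁻¹ • g n) atTop (𝓝 c)) :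
    Tendsto (fun N : ℕ => (N : ℝ)⁻¹ • ∑ n ∈ Finset.range N, g n) atTop (𝓝 0) := by
  set s : ℕ → V := fun N => ∑ n ∈ Finset.range N, ((n : ℝ) + 1)⁻¹ • g n with hs_def
  have h1 : ∀ N : ℕ, ∑ n ∈ Finset.range N, g n = (N : ℝ) • s N - ∑ n ∈ Finset.range N, s n := by
    intro N
    induction N with
    | zero => simp
    | succ N ih =>
      have hs : s (N + 1) = s N + ((N : ℝ) + 1)⁻¹ • g N := Finset.sum_range_succ _ _
      have hN : (N : ℝ) + 1 ≠ 0 := by positivity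
      rw [Finset.sum_range_succ, Finset.sum_range_succ, ih, hs]
      push_cast
      rw [smul_add, smul_smul, mul_inv_cancel₀ hN, one_smul, add_smul, one_smul]
      abel
  have h2 : Tendsto (fun N : ℕ => s N - (N : ℝ)⁻¹ • ∑ n ∈ Finset.range N, s n) atTop
      (𝓝 (c - c)) := h.sub h.cesaro_smul
  rw [sub_self] at h2
  refine h2.congr' ?_
  filter_upwards [eventually_gt_atTop 0] with N hN
  have hN' : (N : ℝ) ≠ 0 := by positivity
  rw [h1, smul_sub, smul_smul, inv_mul_cancel₀ hN', one_smul]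

/-- The law of large numbers along the path. -/
theorem HasConvergentFluctuations.tendsto_average {V : Type*} [NormedAddCommGroup V]
    [NormedSpace ℝ V] {x : ℕ → S} {z : ℕ → A}
    (h : HasConvergentFluctuations M q d (fun n => ((n : ℝ) + 1)⁻¹) x z) (f : S → A → S → V) :
    Tendsto (fun N : ℕ => (N : ℝ)⁻¹ • ∑ n ∈ Finset.range N, f (x n) (z n) (x (n + 1))) atTop
      (𝓝 (stationaryMean M q d f)) := by
  obtain ⟨c, hc⟩ := h.tendsto f
  have h1 := (tendsto_average_of_tendsto_series hc).add_const (stationaryMean M q d f)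
  rw [zero_add] at h1
  refine h1.congr' ?_
  filter_upwards [eventually_gt_atTop 0] with N hN
  have hN' : (N : ℝ) ≠ 0 := by positivity
  rw [Finset.sum_sub_distrib, Finset.sum_const, Finset.card_range, smul_sub,
    ← Nat.cast_smul_eq_nsmul ℝ, smul_smul, inv_mul_cancel₀ hN', one_smul, sub_add_cancel]

theorem HasConvergentFluctuations.tendsto_average_succ {x : ℕ → S} {z : ℕ → A} {f : S → A → S → ℝ}
    (h : HasConvergentFluctuations M q d (fun n => ((n : ℝ) + 1)⁻¹) x z) :
    Tendsto (fun n : ℕ => ((n : ℝ) + 1)⁻¹ *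
      ∑ m ∈ Finset.range (n + 1), f (x m) (z m) (x (m + 1))) atTop
      (𝓝 (stationaryMean M q d f)) := by
  have := (h.tendsto_average f).comp (tendsto_add_atTop_nat 1)
  simpa [Function.comp_def] using this

theorem transMatrix_mem_rowStochastic [DecidableEq S] (hq0 : ∀ i a, 0 ≤ q i a)
    (hq1 : ∀ i, ∑ a, q i a = 1) : transMatrix M q ∈ rowStochastic ℝ S := by
  refine mem_rowStochastic_iff_sum.2 ⟨fun i j => Finset.sum_nonneg fun a _ =>
    mul_nonneg (hq0 i a) (M.p_nonneg i a j), fun i => ?_⟩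
  simp only [transMatrix, of_apply]
  rw [Finset.sum_comm]
  simp only [← Finset.mul_sum, M.p_sum, mul_one, hq1]

variable {Ω : Type*} [MeasurableSpace Ω] {μ : Measure Ω} {X : ℕ → Ω → S} {Z : ℕ → Ω → A}

/-- With the solution `F` of the Poisson equation, the partial sums are a martingale plus the
telescoping terms `F 0 (X 0) - F N (X N)`. -/
theorem ae_tendsto_series [DecidableEq S] [IsProbabilityMeasure μ]
    (hX : IsControlledChain μ M q X Z) (hq0 : ∀ i a, 0 ≤ q i a) (hq1 : ∀ i, ∑ a, q i a = 1)
    (hirr : (transMatrix M q).IsIrreducible) (hper : IsAperiodic (transMatrix M q))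
    (hd : IsStationary (transMatrix M q) d) {b : ℕ → ℝ} (hb : ∀ n, 0 ≤ b n)
    (hb2 : Summable fun n => b n ^ 2) (f : S → A → S → ℝ) :
    ∀ᵐ ω ∂μ, ∃ c, Tendsto (fun N => ∑ n ∈ Finset.range N,
      b n * (f (X n ω) (Z n ω) (X (n + 1) ω) - stationaryMean M q d f)) atTop (𝓝 c) := by
  set P := transMatrix M q with hP_def
  have hP : P ∈ rowStochastic ℝ S := transMatrix_mem_rowStochastic hq0 hq1
  -- the conditional mean given the state, and its centered version
  set f' : S → ℝ := fun i => ∑ a, ∑ j, q i a * M.p i a j * f i a j with hf'_def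
  set m := stationaryMean M q d f with hm_def
  have hm : ∑ i, d i * f' i = m := by
    simp only [hm_def, hf'_def, stationaryMean, Finset.mul_sum, smul_eq_mul, mul_assoc]
  have hcent : d ⬝ᵥ (fun i => f' i - m) = 0 := by
    simp only [dotProduct, mul_sub, Finset.sum_sub_distrib, hm, ← Finset.sum_mul, hd.sum_one,
      one_mul, sub_self]
  obtain ⟨F, G, hF, hFG, hG2⟩ := exists_poisson_solution
    (summable_norm_pow_mulVec hP hirr hper hd hcent) hb hb2
  have hmass : ∀ i, ∑ a, ∑ j, q i a * M.p i a j = 1 := fun i => by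
    simp only [← Finset.mul_sum, M.p_sum, mul_one, hq1]
  have hPF : ∀ n i, (P *ᵥ F n) i = ∑ a, ∑ j, q i a * M.p i a j * F n j := fun n i => by
    simp only [hP_def, mulVec, dotProduct, transMatrix, of_apply, Finset.sum_mul]
    exact Finset.sum_comm
  set φ : ℕ → S → A → S → ℝ := fun n i a j =>
    b n * (f i a j - f' i) + (F (n + 1) j - (P *ᵥ F (n + 1)) i) with hφ_def
  have hφ : ∀ n i, ∑ a, ∑ j, q i a * M.p i a j * φ n i a j = 0 := by
    intro n i
    have h1 : ∑ a, ∑ j, q i a * M.p i a j * φ n i a j =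
        b n * (∑ a, ∑ j, q i a * M.p i a j * f i a j
          - f' i * ∑ a, ∑ j, q i a * M.p i a j)
        + (∑ a, ∑ j, q i a * M.p i a j * F (n + 1) j
          - (P *ᵥ F (n + 1)) i * ∑ a, ∑ j, q i a * M.p i a j) := by
      simp only [hφ_def, Finset.mul_sum, ← Finset.sum_sub_distrib, ← Finset.sum_add_distrib]
      exact Finset.sum_congr rfl fun a _ => Finset.sum_congr rfl fun j _ => by ring
    rw [h1, hmass, ← hPF]
    simp only [hf'_def, mul_one, sub_self, mul_zero, add_zero]
  obtain ⟨C, hC⟩ : ∃ C, ∀ i a j, |f i a j - f' i| ≤ C := by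
    obtain ⟨C, hC⟩ := (Set.finite_range fun t : S × A × S =>
      |f t.1 t.2.1 t.2.2 - f' t.1|).bddAbove
    exact ⟨C, fun i a j => hC ⟨(i, a, j), rfl⟩⟩
  have hβ : ∀ n i a j, |φ n i a j| ≤ C * b n + 2 * G (n + 1) := by
    intro n i a j
    have h1 : |(P *ᵥ F (n + 1)) i| ≤ G (n + 1) := by
      refine (norm_le_pi_norm (P *ᵥ F (n + 1)) i).trans
        ((norm_mulVec_le_of_mem_rowStochastic hP _).trans ?_)
      exact (pi_norm_le_iff_of_nonneg ((abs_nonneg _).trans (hFG (n + 1) i))).2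
        fun j => hFG (n + 1) j
    calc |φ n i a j| ≤ |b n * (f i a j - f' i)| + |F (n + 1) j - (P *ᵥ F (n + 1)) i| :=
          abs_add_le _ _
      _ ≤ b n * C + (G (n + 1) + G (n + 1)) := by
          refine add_le_add ?_ ((abs_sub _ _).trans (add_le_add (hFG _ _) h1))
          rw [abs_mul, abs_of_nonneg (hb n)]
          exact mul_le_mul_of_nonneg_left (hC i a j) (hb n)
      _ = C * b n + 2 * G (n + 1) := by ring
  have hβ2 : Summable fun n => (C * b n + 2 * G (n + 1)) ^ 2 := by
    have hG2' := (summable_nat_add_iff 1).2 hG2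
    refine Summable.of_nonneg_of_le (fun n => sq_nonneg _) (fun n => ?_)
      ((hb2.mul_left (2 * C ^ 2)).add (hG2'.mul_left 8))
    nlinarith [sq_nonneg (C * b n - 2 * G (n + 1))]
  filter_upwards [ae_tendsto_sum_of_square_summable hX hφ hβ hβ2] with ω ⟨c, hc⟩
  have hF0 : Tendsto (fun N => F N (X N ω)) atTop (𝓝 0) := by
    have hG0 : Tendsto (fun n => |G n|) atTop (𝓝 0) := by
      simpa using (tendsto_zero_of_summable_sq hG2).abs
    exact squeeze_zero_norm (fun n => (hFG n _).trans (le_abs_self _)) hG0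
  refine ⟨c + F 0 (X 0 ω) - 0, ((hc.add_const (F 0 (X 0 ω))).sub hF0).congr fun N => ?_⟩
  induction N with
  | zero => simp
  | succ N ih =>
    rw [Finset.sum_range_succ, Finset.sum_range_succ, ← ih, hφ_def]
    have := hF N (X N ω)
    simp only
    linarith

theorem ae_hasConvergentFluctuations [DecidableEq S] [IsProbabilityMeasure μ]
    (hX : IsControlledChain μ M q X Z) (hq0 : ∀ i a, 0 ≤ q i a) (hq1 : ∀ i, ∑ a, q i a = 1)
    (hirr : (transMatrix M q).IsIrreducible) (hper : IsAperiodic (transMatrix M q))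
    (hd : IsStationary (transMatrix M q) d) {b : ℕ → ℝ} (hb : ∀ n, 0 ≤ b n)
    (hb2 : Summable fun n => b n ^ 2) :
    ∀ᵐ ω ∂μ, HasConvergentFluctuations M q d b (fun n => X n ω) (fun n => Z n ω) := by
  classical
  refine ae_all_iff.2 fun i => ae_all_iff.2 fun a => ae_all_iff.2 fun j => ?_
  have h := ae_tendsto_series hX hq0 hq1 hirr hper hd hb hb2
    (fun i' a' j' => if i' = i ∧ a' = a ∧ j' = j then 1 else 0)
  have hm : stationaryMean M q d (fun i' a' j' => if i' = i ∧ a' = a ∧ j' = j then (1 : ℝ) else 0)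
      = d i * (q i a * M.p i a j) := by
    simp only [stationaryMean]
    rw [Finset.sum_eq_single i, Finset.sum_eq_single a, Finset.sum_eq_single j] <;>
      simp +contextual
  rw [hm] at h
  filter_upwards [h] with ω ⟨c, hc⟩
  refine ⟨c, hc.congr fun N => Finset.sum_congr rfl fun n _ => ?_⟩
  congr

end Fluctuations

/-! ### Scale and clock of the value weights -/

/-- The scale `m` of the value weights tends to one once their direction has converged. The
truncation at `δ < 1` is harmless: both `m` and `1 / m` are pulled below one. -/
theorem tendsto_one_of_scale_recursion {a m s e : ℕ → ℝ} {δ : ℝ} (ha0 : ∀ n, 0 < a n)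
    (ha1 : ∀ n, a n < 1) (ha_sum : Tendsto (fun N => ∑ n ∈ Finset.range N, a n) atTop atTop)
    (hδ : 0 < δ) (hδ1 : δ < 1) (hm : ∀ n, 0 < m n) (hs : Tendsto s atTop (𝓝 1))
    (he : Tendsto e atTop (𝓝 0))
    (hrec : ∀ᶠ n in atTop,
      m (n + 1) = m n * (1 - a n + a n * (max (m n * s n) δ)⁻¹ * (1 + e n))) :
    Tendsto m atTop (𝓝 1) := by
  have hpos : ∀ᶠ n in atTop, 0 < s n ∧ 0 < 1 + e n := by
    have h1 : Tendsto (fun n => 1 + e n) atTop (𝓝 1) := by simpa using he.const_add 1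
    exact (hs.eventually_const_lt one_pos).and (h1.eventually_const_lt one_pos)
  have hone : Tendsto (fun n => 1 + e n) atTop (𝓝 1) := by simpa using he.const_add 1
  have hup : Tendsto (fun n => max (m n - 1) 0) atTop (𝓝 0) := by
    refine tendsto_zero_of_le_contraction (t := a) (ε := fun n => |(1 + e n) / s n - 1|)
      (fun n => le_max_right _ _) (Eventually.of_forall fun n => ⟨(ha0 n).le, (ha1 n).le⟩)
      ha_sum ?_ ?_
    · have := ((hone.div hs one_ne_zero).sub_const 1).abs
      simpa using this
    · filter_upwards [hrec, hpos] with n h1 ⟨h2, h3⟩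
      have hmn := hm n
      have han := ha0 n
      have han1 := ha1 n
      have h4 : m n * (max (m n * s n) δ)⁻¹ ≤ 1 / s n := by
        rw [← div_eq_mul_inv, div_le_div_iff₀ (lt_max_of_lt_right hδ) h2, one_mul]
        exact le_max_left _ _
      have h5 : m n * (max (m n * s n) δ)⁻¹ * (1 + e n) ≤ 1 + |(1 + e n) / s n - 1| := by
        have := mul_le_mul_of_nonneg_right h4 h3.le
        have h6 : 1 / s n * (1 + e n) = (1 + e n) / s n := by ring
        have := le_abs_self ((1 + e n) / s n - 1)
        linarith
      have h7 := mul_le_mul_of_nonneg_left h5 han.le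
      have h8 := mul_le_mul_of_nonneg_left (le_max_left (m n - 1) 0) (sub_nonneg.2 han1.le)
      have h9 : 0 ≤ (1 - a n) * max (m n - 1) 0 :=
        mul_nonneg (sub_nonneg.2 han1.le) (le_max_right _ _)
      refine max_le ?_ (by positivity)
      rw [h1]
      linarith
  have hlow : Tendsto (fun n => max ((m n)⁻¹ - 1) 0) atTop (𝓝 0) := by
    refine tendsto_zero_of_le_contraction (t := fun n => (1 - δ) / 2 * a n)
      (ε := fun n => 2 / (1 - δ) * |max (s n) 1 / (1 + e n) - 1|)
      (fun n => le_max_right _ _) (Eventually.of_forall fun n => ⟨?_, ?_⟩) ?_ ?_ ?_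
    · have := ha0 n
      have : 0 < 1 - δ := by linarith
      positivity
    · nlinarith [ha0 n, ha1 n]
    · simp only [← Finset.mul_sum]
      exact ha_sum.const_mul_atTop (by linarith)
    · have h1 : Tendsto (fun n => max (s n) 1 / (1 + e n)) atTop (𝓝 (max 1 1 / 1)) :=
        (hs.max tendsto_const_nhds).div hone one_ne_zero
      simpa using ((h1.sub_const 1).abs).const_mul (2 / (1 - δ))
    · have h0 : Tendsto (fun n => |max (s n) 1 / (1 + e n) - 1|) atTop (𝓝 0) := by
        have h1 : Tendsto (fun n => max (s n) 1 / (1 + e n)) atTop (𝓝 (max 1 1 / 1)) :=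
          (hs.max tendsto_const_nhds).div hone one_ne_zero
        simpa using (h1.sub_const 1).abs
      filter_upwards [hrec, hpos, h0.eventually_le_const (by linarith : 0 < (1 - δ) / 2)]
        with n h1 ⟨h2, h3⟩ hε
      set ε := |max (s n) 1 / (1 + e n) - 1| with hε_def
      have hε0 : 0 ≤ ε := abs_nonneg _
      have hmn := hm n
      have han := ha0 n
      have han1 := ha1 n
      set p := (m n)⁻¹ with hp_def
      have hp : 0 < p := inv_pos.2 hmn
      set Q := max (p - 1) 0 with hQ_def
      have hQ0 : 0 ≤ Q := le_max_right _ _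
      have hQ1 : p - 1 ≤ Q := le_max_left _ _
      have hmax : 0 < max (m n * s n) δ := lt_max_of_lt_right hδ
      set f := m n * (max (m n * s n) δ)⁻¹ * (1 + e n) with hf_def
      have hf : 0 < f := by positivity
      have hm' : m (n + 1) = (1 - a n) * m n + a n * f := by rw [h1, hf_def]; ring
      -- convexity of the reciprocal
      have hconv : (m (n + 1))⁻¹ ≤ (1 - a n) * p + a n * f⁻¹ := by
        rw [hm', hp_def, inv_le_iff_one_le_mul₀ (by nlinarith)]
        have e1 : m n * (m n)⁻¹ = 1 := mul_inv_cancel₀ hmn.ne'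
        have e2 : f * f⁻¹ = 1 := mul_inv_cancel₀ hf.ne'
        have e3 : 2 ≤ m n * f⁻¹ + f * (m n)⁻¹ := by
          rw [← div_eq_mul_inv, ← div_eq_mul_inv, div_add_div _ _ hf.ne' hmn.ne',
            le_div_iff₀ (by positivity)]
          nlinarith [sq_nonneg (m n - f)]
        have e4 : ((1 - a n) * (m n)⁻¹ + a n * f⁻¹) * ((1 - a n) * m n + a n * f) =
            (1 - a n) ^ 2 * (m n * (m n)⁻¹) + a n ^ 2 * (f * f⁻¹)
              + a n * (1 - a n) * (m n * f⁻¹ + f * (m n)⁻¹) := by ring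
        rw [e4, e1, e2]
        have e5 := mul_le_mul_of_nonneg_left e3 (mul_nonneg han.le (sub_nonneg.2 han1.le))
        nlinarith
      have hfinv : f⁻¹ ≤ (1 + δ * Q) * (1 + ε) := by
        have e1 : f⁻¹ = max (s n) (δ * p) / (1 + e n) := by
          rw [hf_def, mul_inv, mul_inv, inv_inv, ← hp_def, mul_max_of_nonneg _ _ hp.le,
            div_eq_mul_inv]
          congr 2
          · rw [← mul_assoc, hp_def, inv_mul_cancel₀ hmn.ne', one_mul]
          · ring
        have e2 : max (s n) (δ * p) ≤ (1 + δ * Q) * max (s n) 1 := by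
          have : 0 ≤ δ * Q := by positivity
          have k1 : s n ≤ max (s n) 1 := le_max_left _ _
          have k2 : 1 ≤ max (s n) 1 := le_max_right _ _
          refine max_le (by nlinarith) ?_
          nlinarith
        have e3 : max (s n) 1 / (1 + e n) ≤ 1 + ε := by
          have := le_abs_self (max (s n) 1 / (1 + e n) - 1)
          linarith
        rw [e1]
        calc max (s n) (δ * p) / (1 + e n) ≤ (1 + δ * Q) * max (s n) 1 / (1 + e n) := by gcongr
          _ = (1 + δ * Q) * (max (s n) 1 / (1 + e n)) := by ring
          _ ≤ (1 + δ * Q) * (1 + ε) := by gcongr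
      have hδ' : 1 - δ ≠ 0 := by linarith
      have e6 : (1 - δ) / 2 * a n * (2 / (1 - δ) * ε) = a n * ε := by field_simp
      rw [e6]
      have e7 := mul_le_mul_of_nonneg_left hfinv han.le
      have e8 := mul_le_mul_of_nonneg_left hQ1 (sub_nonneg.2 han1.le)
      have e9 : δ * ε * Q ≤ (1 - δ) / 2 * Q :=
        mul_le_mul_of_nonneg_right (by nlinarith) hQ0
      have e10 := mul_le_mul_of_nonneg_left e9 han.le
      refine max_le ?_ ?_
      · linarith
      · have : 0 ≤ 1 - (1 - δ) / 2 * a n := by nlinarith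
        positivity
  have h1 : Tendsto (fun n => 1 + max (m n - 1) 0) atTop (𝓝 1) := by simpa using hup.const_add 1
  have h2 : Tendsto (fun n => (1 + max ((m n)⁻¹ - 1) 0)⁻¹) atTop (𝓝 1) := by
    have : Tendsto (fun n => 1 + max ((m n)⁻¹ - 1) 0) atTop (𝓝 1) := by
      simpa using hlow.const_add 1
    simpa using this.inv₀ one_ne_zero
  refine tendsto_of_tendsto_of_tendsto_of_le_of_le h2 h1 (fun n => ?_) fun n => ?_
  · have := le_max_left ((m n)⁻¹ - 1) 0
    exact inv_le_of_inv_le₀ (hm n) (by linarith)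
  · have := le_max_left (m n - 1) 0
    simp only
    linarith

/-- The clock of the direction of the value weights diverges: otherwise the decay at rate `a n`
would win and bring the weights to the truncated region, where the clock runs at rate
`a n / δ`. -/
theorem tendsto_sum_clock {a m c e : ℕ → ℝ} {δ : ℝ} (ha0 : ∀ n, 0 < a n)
    (ha_sum : Tendsto (fun N => ∑ n ∈ Finset.range N, a n) atTop atTop)
    (hδ : 0 < δ) (hm : ∀ n, 0 < m n) (hc : ∀ n, 0 < c n) (he : Tendsto e atTop (𝓝 0))
    (hrec : ∀ᶠ n in atTop, m (n + 1) = m n * (1 - a n + a n * c n * (1 + e n)))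
    (hcm : Tendsto m atTop (𝓝 0) → ∀ᶠ n in atTop, c n = δ⁻¹) :
    Tendsto (fun N => ∑ n ∈ Finset.range N, a n * c n) atTop atTop := by
  have hac : ∀ n, 0 ≤ a n * c n := fun n => (mul_pos (ha0 n) (hc n)).le
  rw [← not_summable_iff_tendsto_nat_atTop_of_nonneg hac]
  intro hsum
  have hna : ¬ Summable a :=
    (not_summable_iff_tendsto_nat_atTop_of_nonneg fun n => (ha0 n).le).2 ha_sum
  refine hna ?_
  have hm0 : Tendsto m atTop (𝓝 0) := by
    obtain ⟨n₀, hn₀⟩ := eventually_atTop.1 (hrec.and (he.eventually_le_const one_pos))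
    set T : ℕ → ℝ := fun n => ∑ i ∈ Finset.range n, a i - 2 * ∑ i ∈ Finset.range n, a i * c i
      with hT_def
    have hbound : ∀ n ≥ n₀, m n * Real.exp (T n) ≤ m n₀ * Real.exp (T n₀) := by
      intro n hn
      induction n, hn using Nat.le_induction with
      | base => exact le_rfl
      | succ n hn ih =>
        obtain ⟨h1, h2⟩ := hn₀ n hn
        have h3 : T (n + 1) = T n + (a n - 2 * (a n * c n)) := by
          simp only [hT_def, Finset.sum_range_succ]; ring
        have h4 : 1 - a n + a n * c n * (1 + e n) ≤ Real.exp (-(a n - 2 * (a n * c n))) := by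
          have := Real.add_one_le_exp (-(a n - 2 * (a n * c n)))
          have := mul_le_mul_of_nonneg_left h2 (hac n)
          linarith
        calc m (n + 1) * Real.exp (T (n + 1))
            ≤ m n * Real.exp (-(a n - 2 * (a n * c n))) * Real.exp (T (n + 1)) := by
              rw [h1]
              have := hm n
              gcongr
          _ = m n * Real.exp (T n) := by
              rw [h3, mul_assoc, ← Real.exp_add]
              congr 2
              ring
          _ ≤ _ := ih
    have hT : Tendsto T atTop atTop := by
      have h1 := ha_sum
      refine tendsto_atTop_mono (fun n => ?_)
        (tendsto_atTop_add_const_right atTop (-(2 * ∑' i, a i * c i)) h1)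
      have := hsum.sum_le_tsum (Finset.range n) fun i _ => hac i
      simp only [hT_def]
      linarith
    have hlim : Tendsto (fun n => m n₀ * Real.exp (T n₀) * Real.exp (-T n)) atTop (𝓝 0) := by
      simpa using (Real.tendsto_exp_neg_atTop_nhds_zero.comp hT).const_mul
        (m n₀ * Real.exp (T n₀))
    refine tendsto_of_tendsto_of_tendsto_of_le_of_le' tendsto_const_nhds hlim
      (Eventually.of_forall fun n => (hm n).le) ?_
    filter_upwards [eventually_ge_atTop n₀] with n hn
    calc m n = m n * Real.exp (T n) * Real.exp (-T n) := by
          rw [mul_assoc, ← Real.exp_add]; simp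
      _ ≤ _ := mul_le_mul_of_nonneg_right (hbound n hn) (Real.exp_pos _).le
  refine summable_of_isBigO_nat (hsum.mul_left δ) (Eventually.isBigO ?_)
  filter_upwards [hcm hm0] with n hn
  rw [hn, Real.norm_of_nonneg (ha0 n).le]
  have : δ * (a n * δ⁻¹) = a n := by field_simp
  rw [this]

/-! ### Direction of the value weights -/

section Value

variable {κ : Type*} [Fintype κ] [DecidableEq κ]

/-- The normalized direction of the value weights tends to the constant vector. One step is, up
to negligible errors `ξ n`, a lazy step of the stochastic matrix `K`, which contracts the variance
with respect to the invariant distribution. -/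
theorem tendsto_one_of_direction_recursion {K : Matrix κ κ ℝ} (hK : K ∈ rowStochastic ℝ κ)
    (hirr : NoProperClosedSet K) {π : κ → ℝ} (hπ0 : ∀ k, 0 < π k) (hπ1 : ∑ k, π k = 1)
    (hπK : π ᵥ* K = π) {β : ℕ → ℝ} {z ξ : ℕ → κ → ℝ} (hβ0 : ∀ n, 0 < β n)
    (hβ : Tendsto β atTop (𝓝 0))
    (hβ_sum : Tendsto (fun N => ∑ n ∈ Finset.range N, β n) atTop atTop)
    {B : ℝ} (hz : ∀ n k, |z n k - 1| ≤ B) (hπz : ∀ n, ∑ k, π k * z n k = 1)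
    (hξ : ∀ k, Tendsto (fun n => ξ n k) atTop (𝓝 0))
    (hrec : ∀ᶠ n in atTop, ∀ k, z (n + 1) k * (1 + β n * ∑ l, π l * ξ n l) =
      (1 - β n) * z n k + β n * ((K *ᵥ z n) k + ξ n k)) (k : κ) :
    Tendsto (fun n => z n k) atTop (𝓝 1) := by
  obtain ⟨c, hc, hgap⟩ := exists_spectral_gap hK hirr hπ0 hπ1 hπK
  set x : ℕ → κ → ℝ := fun n k => (1 - β n) * (z n k - 1) + β n * (K *ᵥ fun l => z n l - 1) k
    with hx_def
  set e : ℕ → ℝ := fun n => ∑ l, π l * ξ n l with he_def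
  have he : Tendsto e atTop (𝓝 0) := by
    have := tendsto_finsetSum (Finset.univ : Finset κ) fun l _ => (hξ l).const_mul (π l)
    simpa using this
  set ζ : ℕ → κ → ℝ := fun n k => (ξ n k - e n - e n * x n k) / (1 + β n * e n) with hζ_def
  have hK1 : ∀ n k, (K *ᵥ fun l => z n l - 1) k = (K *ᵥ z n) k - 1 := by
    intro n k
    have : (fun l => z n l - 1) = z n - 1 := rfl
    rw [this, mulVec_sub, hK.2]
    rfl
  have hB : 0 ≤ B := (abs_nonneg _).trans (hz 0 k)
  have hβ1 : ∀ᶠ n in atTop, β n ≤ 1 / 2 := hβ.eventually_le_const (by norm_num)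
  have hx : ∀ᶠ n in atTop, ∀ k, |x n k| ≤ B := by
    filter_upwards [hβ1] with n hn k
    have h1 : |(K *ᵥ fun l => z n l - 1) k| ≤ B := by
      refine (norm_le_pi_norm (K *ᵥ fun l => z n l - 1) k).trans
        ((norm_mulVec_le_of_mem_rowStochastic hK _).trans ?_)
      exact (pi_norm_le_iff_of_nonneg hB).2 fun l => hz n l
    have h2 : 0 ≤ 1 - β n := by linarith
    calc |x n k| ≤ |(1 - β n) * (z n k - 1)| + |β n * (K *ᵥ fun l => z n l - 1) k| := abs_add_le _ _
      _ ≤ (1 - β n) * B + β n * B := by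
          rw [abs_mul, abs_mul, abs_of_nonneg h2, abs_of_pos (hβ0 n)]
          exact add_le_add (mul_le_mul_of_nonneg_left (hz n k) h2)
            (mul_le_mul_of_nonneg_left h1 (hβ0 n).le)
      _ = B := by ring
  have hβe : Tendsto (fun n => 1 + β n * e n) atTop (𝓝 1) := by
    simpa using (hβ.mul he).const_add 1
  have hζ : ∀ k, Tendsto (fun n => ζ n k) atTop (𝓝 0) := by
    intro k
    have h1 : Tendsto (fun n => e n * x n k) atTop (𝓝 0) := by
      refine squeeze_zero_norm' ?_ (by simpa using he.abs.mul_const B)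
      filter_upwards [hx] with n hn
      rw [Real.norm_eq_abs, abs_mul]
      exact mul_le_mul_of_nonneg_left (hn k) (abs_nonneg _)
    have h2 := (((hξ k).sub he).sub h1).div hβe one_ne_zero
    rw [sub_zero, sub_zero, zero_div] at h2
    exact h2
  have hstep : ∀ᶠ n in atTop, ∀ k, z (n + 1) k - 1 = x n k + β n * ζ n k := by
    filter_upwards [hrec, hβe.eventually_const_lt one_pos] with n h1 h2 k
    have h3 := h1 k
    have h4 : (1 + β n * e n) * ζ n k = ξ n k - e n - e n * x n k := by
      simp only [hζ_def]
      field_simp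
    have h5 : (1 + β n * e n) * (z (n + 1) k - 1) = (1 + β n * e n) * (x n k + β n * ζ n k) := by
      have h6 : x n k = (1 - β n) * (z n k - 1) + β n * ((K *ᵥ z n) k - 1) := by
        simp only [hx_def, hK1]
      have h7 : z (n + 1) k * (1 + β n * e n) =
        (1 - β n) * z n k + β n * ((K *ᵥ z n) k + ξ n k) := h3
      linear_combination h7 - β n * h4 - h6
    exact mul_left_cancel₀ h2.ne' h5
  set V : ℕ → ℝ := fun n => ∑ k, π k * (z n k - 1) ^ 2 with hV_def
  have hV0 : ∀ n, 0 ≤ V n := fun n =>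
    Finset.sum_nonneg fun k _ => mul_nonneg (hπ0 k).le (sq_nonneg _)
  set ε : ℕ → ℝ := fun n => ∑ k, π k * (2 * B * |ζ n k| + ζ n k ^ 2) with hε_def
  have hε : Tendsto ε atTop (𝓝 0) := by
    have : Tendsto ε atTop (𝓝 (∑ k, π k * (2 * B * |0| + 0 ^ 2))) :=
      tendsto_finsetSum _ fun k _ =>
        (((hζ k).abs.const_mul (2 * B)).add ((hζ k).pow 2)).const_mul (π k)
    simpa using this
  have hV : Tendsto V atTop (𝓝 0) := by
    refine tendsto_zero_of_le_contraction (t := fun n => c * β n) (ε := fun n => c⁻¹ * ε n) hV0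
      ?_ ?_ (by simpa using hε.const_mul c⁻¹) ?_
    · have : Tendsto (fun n => c * β n) atTop (𝓝 0) := by simpa using hβ.const_mul c
      filter_upwards [this.eventually_le_const one_pos] with n hn
      exact ⟨(mul_pos hc (hβ0 n)).le, hn⟩
    · simp only [← Finset.mul_sum]
      exact hβ_sum.const_mul_atTop hc
    · filter_upwards [hstep, hx, hβ1] with n h1 h2 h3
      have hb := hβ0 n
      have hmean : ∑ k, π k * (z n k - 1) = 0 := by
        simp only [mul_sub, Finset.sum_sub_distrib, hπz, mul_one, hπ1, sub_self]
      have h4 := variance_lazy_le hK (fun k => (hπ0 k).le) hπK (hgap _ hmean) hb.le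
        (by linarith : β n ≤ 1)
      have h5 : V (n + 1) ≤ ∑ k, π k * x n k ^ 2 + β n * ε n := by
        simp only [hV_def, hε_def, Finset.mul_sum, ← Finset.sum_add_distrib]
        refine Finset.sum_le_sum fun k _ => ?_
        rw [h1 k]
        have e1 : x n k * ζ n k ≤ B * |ζ n k| := by
          refine (le_abs_self _).trans ?_
          rw [abs_mul]
          exact mul_le_mul_of_nonneg_right (h2 k) (abs_nonneg _)
        have e2 : β n ^ 2 * ζ n k ^ 2 ≤ β n * ζ n k ^ 2 :=
          mul_le_mul_of_nonneg_right (by nlinarith) (sq_nonneg _)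
        have e3 := mul_le_mul_of_nonneg_left e1 hb.le
        have e4 : (x n k + β n * ζ n k) ^ 2 ≤
            x n k ^ 2 + β n * (2 * B * |ζ n k| + ζ n k ^ 2) := by nlinarith
        calc π k * (x n k + β n * ζ n k) ^ 2
            ≤ π k * (x n k ^ 2 + β n * (2 * B * |ζ n k| + ζ n k ^ 2)) :=
              mul_le_mul_of_nonneg_left e4 (hπ0 k).le
          _ = _ := by ring
      have h6 : (1 - 2 * β n * (1 - β n) * c) * V n ≤ (1 - c * β n) * V n := by
        refine mul_le_mul_of_nonneg_right ?_ (hV0 n)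
        have : 0 ≤ c * β n * (1 - 2 * β n) := mul_nonneg (mul_pos hc hb).le (by linarith)
        linarith
      have h7 : c * β n * (c⁻¹ * ε n) = β n * ε n := by field_simp
      rw [h7]
      have h8 : ∑ k, π k * x n k ^ 2 ≤ (1 - 2 * β n * (1 - β n) * c) * V n := h4
      linarith
  have hk : Tendsto (fun n => (z n k - 1) ^ 2) atTop (𝓝 0) := by
    refine squeeze_zero (fun n => sq_nonneg _) (fun n => ?_) (by simpa using hV.const_mul (π k)⁻¹)
    rw [← div_eq_inv_mul, le_div_iff₀ (hπ0 k), mul_comm]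
    exact Finset.single_le_sum (f := fun k => π k * (z n k - 1) ^ 2)
      (fun l _ => mul_nonneg (hπ0 l).le (sq_nonneg _)) (Finset.mem_univ k)
  have hk' : Tendsto (fun n => |z n k - 1|) atTop (𝓝 0) := by
    simpa [Real.sqrt_sq_eq_abs] using hk.sqrt
  have := (tendsto_zero_iff_abs_tendsto_zero _).2 hk'
  simpa using this.add_const 1

/-- Global convergence of the value recursion, in coordinates in which the limiting weights are
constant and the limiting matrix is stochastic. -/
theorem tendsto_one_of_normalized_recursion [Nonempty κ] {K : Matrix κ κ ℝ}
    (hK : K ∈ rowStochastic ℝ κ) (hirr : NoProperClosedSet K) {a : ℕ → ℝ} (ha0 : ∀ n, 0 < a n)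
    (ha1 : ∀ n, a n < 1) (ha : Tendsto a atTop (𝓝 0))
    (ha_sum : Tendsto (fun N => ∑ n ∈ Finset.range N, a n) atTop atTop)
    {δ : ℝ} (hδ : 0 < δ) (hδ1 : δ < 1) {h : κ → ℝ} (hh : ∑ k, h k = 1)
    {Kn : ℕ → Matrix κ κ ℝ} (hKn : Tendsto Kn atTop (𝓝 K)) {y : ℕ → κ → ℝ}
    (hy0 : ∀ n k, 0 ≤ y n k) (hy : ∀ n, y n ≠ 0)
    (hrec : ∀ᶠ n in atTop, y (n + 1) =
      (1 - a n) • y n + (a n * (max (h ⬝ᵥ y n) δ)⁻¹) • (Kn n *ᵥ y n)) (k : κ) :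
    Tendsto (fun n => y n k) atTop (𝓝 1) := by
  obtain ⟨π, hπ0, hπ1, hπK⟩ := exists_pos_stationary hK hirr
  set m : ℕ → ℝ := fun n => ∑ k, π k * y n k with hm_def
  have hm : ∀ n, 0 < m n := by
    intro n
    obtain ⟨k, hk⟩ := Function.ne_iff.1 (hy n)
    exact Finset.sum_pos' (fun k _ => mul_nonneg (hπ0 k).le (hy0 n k))
      ⟨k, Finset.mem_univ k, mul_pos (hπ0 k) (lt_of_le_of_ne (hy0 n k) (Ne.symm hk))⟩
  set z : ℕ → κ → ℝ := fun n k => y n k / m n with hz_def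
  have hz0 : ∀ n k, 0 ≤ z n k := fun n k => div_nonneg (hy0 n k) (hm n).le
  have hyz : ∀ n, y n = m n • z n := fun n => by
    funext k
    simp only [hz_def, Pi.smul_apply, smul_eq_mul]
    rw [mul_div_cancel₀ _ (hm n).ne']
  have hπz : ∀ n, ∑ k, π k * z n k = 1 := fun n => by
    simp only [hz_def, ← mul_div_assoc, ← Finset.sum_div]
    exact div_self (hm n).ne'
  have hzπ : ∀ n k, z n k ≤ (π k)⁻¹ := fun n k => by
    rw [← one_div, le_div_iff₀ (hπ0 k), mul_comm, ← hπz n]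
    exact Finset.single_le_sum (f := fun k => π k * z n k)
      (fun l _ => mul_nonneg (hπ0 l).le (hz0 n l)) (Finset.mem_univ k)
  set c : ℕ → ℝ := fun n => (max (h ⬝ᵥ y n) δ)⁻¹ with hc_def
  have hc0 : ∀ n, 0 < c n := fun n => inv_pos.2 (lt_max_of_lt_right hδ)
  have hcδ : ∀ n, c n ≤ δ⁻¹ := fun n => inv_anti₀ hδ (le_max_right _ _)
  set ξ : ℕ → κ → ℝ := fun n => (Kn n - K) *ᵥ z n with hξ_def
  have hξ : ∀ k, Tendsto (fun n => ξ n k) atTop (𝓝 0) := by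
    intro k
    have h1 : ∀ l, Tendsto (fun n => (Kn n - K) k l * z n l) atTop (𝓝 0) := by
      intro l
      have h2 : Tendsto (fun n => (Kn n - K) k l) atTop (𝓝 0) := by
        have h3 := ((tendsto_pi_nhds.1 ((tendsto_pi_nhds.1 hKn) k)) l).sub_const (K k l)
        simpa using h3
      refine squeeze_zero_norm (fun n => ?_) (by simpa using h2.abs.mul_const (π l)⁻¹)
      rw [Real.norm_eq_abs, abs_mul, abs_of_nonneg (hz0 n l)]
      exact mul_le_mul_of_nonneg_left (hzπ n l) (abs_nonneg _)
    have h4 := tendsto_finsetSum (Finset.univ : Finset κ) fun l _ => h1 l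
    rw [Finset.sum_const_zero] at h4
    exact h4
  set e : ℕ → ℝ := fun n => ∑ l, π l * ξ n l with he_def
  have he : Tendsto e atTop (𝓝 0) := by
    simpa using tendsto_finsetSum (Finset.univ : Finset κ) fun l _ => (hξ l).const_mul (π l)
  have hy_succ : ∀ᶠ n in atTop, ∀ k, y (n + 1) k =
      m n * ((1 - a n) * z n k + a n * c n * ((K *ᵥ z n) k + ξ n k)) := by
    filter_upwards [hrec] with n hn k
    have h1 : Kn n *ᵥ y n = m n • (K *ᵥ z n + ξ n) := by
      rw [hyz n, mulVec_smul, hξ_def]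
      simp only
      rw [sub_mulVec, add_sub_cancel]
    have h2 := congrFun hn k
    rw [h1] at h2
    rw [h2]
    simp only [Pi.add_apply, Pi.smul_apply, smul_eq_mul, hc_def]
    rw [show y n k = m n * z n k from congrFun (hyz n) k]
    ring
  have hm_succ : ∀ᶠ n in atTop, m (n + 1) = m n * (1 - a n + a n * c n * (1 + e n)) := by
    filter_upwards [hy_succ] with n hn
    have h1 : ∑ k, π k * (K *ᵥ z n) k = 1 := by
      rw [← hπz n, ← sum_vecMul_apply hπK (z n)]
      simp only [mulVec, dotProduct, Finset.mul_sum, mul_assoc]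
    have h2 : m (n + 1) = m n * ((1 - a n) * ∑ k, π k * z n k
        + a n * c n * (∑ k, π k * (K *ᵥ z n) k + e n)) := by
      simp only [hm_def, he_def]
      simp only [hn, Finset.mul_sum, ← Finset.sum_add_distrib]
      exact Finset.sum_congr rfl fun k _ => by simp only [hm_def]; ring
    rw [h2, hπz, h1, mul_one]
  -- the clock of the direction
  have hac : Tendsto (fun N => ∑ n ∈ Finset.range N, a n * c n) atTop atTop := by
    refine tendsto_sum_clock ha0 ha_sum hδ hm hc0 he hm_succ fun hm0 => ?_
    have h1 : ∀ k, Tendsto (fun n => y n k) atTop (𝓝 0) := by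
      intro k
      refine squeeze_zero (fun n => hy0 n k) (fun n => ?_)
        (by simpa using hm0.mul_const (π k)⁻¹)
      rw [hyz n]
      exact mul_le_mul_of_nonneg_left (hzπ n k) (hm n).le
    have h2 : Tendsto (fun n => h ⬝ᵥ y n) atTop (𝓝 0) := by
      simpa [dotProduct] using
        tendsto_finsetSum (Finset.univ : Finset κ) fun k _ => (h1 k).const_mul (h k)
    filter_upwards [h2.eventually_le_const hδ] with n hn
    simp only [hc_def, max_eq_right hn]
  set β : ℕ → ℝ := fun n => a n * c n / (1 - a n + a n * c n) with hβ_def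
  have hacpos : ∀ n, 0 < a n * c n := fun n => mul_pos (ha0 n) (hc0 n)
  have hD : ∀ n, 0 < 1 - a n + a n * c n := fun n => by
    have := ha1 n
    have := hacpos n
    linarith
  have hβ0 : ∀ n, 0 < β n := fun n => div_pos (hacpos n) (hD n)
  have hβ : Tendsto β atTop (𝓝 0) := by
    refine squeeze_zero' (Eventually.of_forall fun n => (hβ0 n).le) ?_
      (by simpa using ha.mul_const (2 * δ⁻¹))
    filter_upwards [ha.eventually_le_const (by norm_num : (0 : ℝ) < 1 / 2)] with n hn
    have h1 := hacpos n
    rw [hβ_def]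
    simp only
    rw [div_le_iff₀ (hD n)]
    have h2 := mul_le_mul_of_nonneg_left (hcδ n) (ha0 n).le
    have h3 : 0 ≤ a n * (2 * δ⁻¹) := by have := ha0 n; positivity
    nlinarith
  have hβ_sum : Tendsto (fun N => ∑ n ∈ Finset.range N, β n) atTop atTop := by
    have h1 : Tendsto (fun N => ∑ n ∈ Finset.range N, (1 + δ⁻¹)⁻¹ * (a n * c n)) atTop atTop := by
      simp only [← Finset.mul_sum]
      exact hac.const_mul_atTop (by positivity)
    refine tendsto_atTop_mono (fun N => Finset.sum_le_sum fun n _ => ?_) h1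
    rw [← div_eq_inv_mul]
    refine div_le_div_of_nonneg_left (hacpos n).le (hD n) ?_
    have h2 := mul_le_mul (ha1 n).le (hcδ n) (hc0 n).le zero_le_one
    have := ha0 n
    linarith
  have hz_succ : ∀ᶠ n in atTop, ∀ k, z (n + 1) k * (1 + β n * ∑ l, π l * ξ n l) =
      (1 - β n) * z n k + β n * ((K *ᵥ z n) k + ξ n k) := by
    filter_upwards [hy_succ, hm_succ] with n h1 h2 k
    have hmn := hm n
    have hm' := hm (n + 1)
    have hDn := hD n
    have h3 : m (n + 1) ≠ 0 := hm'.ne'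
    have h4 : z (n + 1) k = y (n + 1) k / m (n + 1) := rfl
    have h5 : (1 + β n * ∑ l, π l * ξ n l) * (1 - a n + a n * c n) * m n = m (n + 1) := by
      rw [h2]
      simp only [hβ_def, he_def]
      field_simp
      ring
    have h6 : 1 + β n * ∑ l, π l * ξ n l = m (n + 1) / ((1 - a n + a n * c n) * m n) := by
      rw [eq_div_iff (by positivity), ← h5]
      ring
    rw [h4, h6, h1 k, hβ_def]
    simp only
    field_simp
    ring
  have hz1 : ∀ k, Tendsto (fun n => z n k) atTop (𝓝 1) := by
    obtain ⟨B, hB⟩ := (Set.finite_range fun k => (π k)⁻¹).bddAbove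
    refine tendsto_one_of_direction_recursion hK hirr hπ0 hπ1 hπK hβ0 hβ hβ_sum (B := B + 1)
      (fun n k => ?_) hπz hξ hz_succ
    have h1 := hz0 n k
    have h2 : z n k ≤ B := (hzπ n k).trans (hB ⟨k, rfl⟩)
    exact abs_le.2 ⟨by linarith, by linarith⟩
  have hm1 : Tendsto m atTop (𝓝 1) := by
    refine tendsto_one_of_scale_recursion (s := fun n => h ⬝ᵥ z n) ha0 ha1 ha_sum hδ hδ1 hm ?_ he ?_
    · have := tendsto_finsetSum (Finset.univ : Finset κ) fun k _ => (hz1 k).const_mul (h k)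
      simpa [hh, dotProduct] using this
    · filter_upwards [hm_succ] with n hn
      rw [hn, hc_def]
      simp only
      conv_lhs => rw [hyz n, dotProduct_smul, smul_eq_mul]
  have := hm1.mul (hz1 k)
  rw [one_mul] at this
  exact this.congr fun n => (congrFun (hyz n) k).symm

end Value

/-! ### The limiting matrix of the value recursion -/

section Critic

variable {S A : Type*} [Fintype S] [Fintype A] {x₂ : ℕ} {M : MDP S A}
  {q : S → A → ℝ} {d : S → ℝ} {Φ : Matrix S (Fin x₂) ℝ} {P : Matrix S S ℝ} {α : ℝ}

theorem IsStationary.pos (hd : IsStationary P d) (hirr : P.IsIrreducible) (i : S) : 0 < d i := by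
  refine pos_of_vecMul_eq hirr.nonneg (noProperClosedSet_of_isIrreducible hirr) hd.nonneg ?_
    hd.invariant i
  rintro rfl
  simpa using hd.sum_one

theorem FeatureAssumption.mul_feature_eq_zero (hΦ : FeatureAssumption P Φ) {k l : Fin x₂}
    (hkl : k ≠ l) (i : S) : Φ i k * Φ i l = 0 :=
  (Finset.sum_eq_zero_iff_of_nonneg fun i _ => mul_nonneg (hΦ.nonneg i k) (hΦ.nonneg i l)).1
    (hΦ.orthogonal k l hkl) i (Finset.mem_univ i)

theorem FeatureAssumption.exists_pos (hΦ : FeatureAssumption P Φ) (k : Fin x₂) :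
    ∃ i, 0 < Φ i k := by
  obtain ⟨i, hi⟩ := hΦ.col_ne_zero k
  exact ⟨i, lt_of_le_of_ne (hΦ.nonneg i k) hi.symm⟩

/-- Where the feature `k` is positive, all other features vanish, because orthogonal nonnegative
columns have disjoint supports. -/
theorem FeatureAssumption.dotProduct_eq (hΦ : FeatureAssumption P Φ) {i : S} {k : Fin x₂}
    (hik : 0 < Φ i k) (r : Fin x₂ → ℝ) : Φ i ⬝ᵥ r = Φ i k * r k := by
  refine Finset.sum_eq_single k (fun l _ hl => ?_) (by simp)
  have := hΦ.mul_feature_eq_zero hl i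
  rw [(mul_eq_zero.1 this).resolve_right hik.ne', zero_mul]

/-- The stationary second moments of the features. -/
noncomputable def featureMass (d : S → ℝ) (Φ : Matrix S (Fin x₂) ℝ) (k : Fin x₂) : ℝ :=
  ∑ i, d i * Φ i k ^ 2

theorem featureMass_pos (hΦ : FeatureAssumption P Φ) (hd : ∀ i, 0 < d i) (k : Fin x₂) :
    0 < featureMass d Φ k := by
  obtain ⟨i, hi⟩ := hΦ.exists_pos k
  exact Finset.sum_pos' (fun j _ => mul_nonneg (hd j).le (sq_nonneg _))
    ⟨i, Finset.mem_univ i, mul_pos (hd i) (pow_pos hi 2)⟩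

variable [DecidableEq S]

theorem transpose_mul_diagonal_mul_eq (hΦ : FeatureAssumption P Φ) :
    Φᵀ * diagonal d * Φ = diagonal (featureMass d Φ) := by
  ext k l
  rw [mul_apply]
  simp only [mul_diagonal, transpose_apply]
  by_cases hkl : k = l
  · subst hkl
    rw [diagonal_apply_eq]
    exact Finset.sum_congr rfl fun i _ => by ring
  · rw [diagonal_apply_ne _ hkl]
    refine Finset.sum_eq_zero fun i _ => ?_
    rw [mul_right_comm, hΦ.mul_feature_eq_zero hkl, zero_mul]

variable {i₀ : S} {γ : ℝ} {r : Fin x₂ → ℝ}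

theorem IsPerronCritic.weight_pos {Q : Matrix S S ℝ} (hr : IsPerronCritic d Φ Q i₀ γ r)
    (hΦ : FeatureAssumption P Φ) (k : Fin x₂) : 0 < r k := by
  obtain ⟨i, hi⟩ := hΦ.exists_pos k
  have h1 := hr.pos i ⟨k, hi⟩
  have h2 : ((sqrtDiag d * Φ) *ᵥ r) i = √(d i) * (Φ i k * r k) := by
    rw [← mulVec_mulVec, sqrtDiag, mulVec_diagonal, ← hΦ.dotProduct_eq hi]
    rfl
  rw [h2] at h1
  have h3 : 0 < Φ i k * r k := pos_of_mul_pos_right h1 (Real.sqrt_nonneg _)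
  exact pos_of_mul_pos_right h3 hi.le

/-- The eigenvector equation in the coordinates of the features. -/
theorem IsPerronCritic.feature_eigen {Q : Matrix S S ℝ} (hr : IsPerronCritic d Φ Q i₀ γ r)
    (hΦ : FeatureAssumption P Φ) (hd : ∀ i, 0 < d i) :
    (Φᵀ * diagonal d * Q * Φ) *ᵥ r = γ • (diagonal (featureMass d Φ) *ᵥ r) := by
  have hsq : sqrtDiag d * sqrtDiag d = diagonal d := by
    rw [sqrtDiag, diagonal_mul_diagonal]
    congr 1
    funext i
    exact Real.mul_self_sqrt (hd i).le
  have hsu : IsUnit (sqrtDiag d).det := by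
    rw [sqrtDiag, det_diagonal]
    exact (Finset.prod_ne_zero_iff.2 fun i _ => (Real.sqrt_pos.2 (hd i)).ne').isUnit
  have hBu : IsUnit (Φᵀ * diagonal d * Φ).det := by
    rw [transpose_mul_diagonal_mul_eq hΦ, det_diagonal]
    exact (Finset.prod_ne_zero_iff.2 fun k _ => (featureMass_pos hΦ hd k).ne').isUnit
  have h1 := congrArg (fun v => (Φᵀ * sqrtDiag d) *ᵥ v) hr.eigen
  simp only [mulVec_smul, mulVec_mulVec] at h1
  have h2 : Φᵀ * sqrtDiag d * (projMatrix d Φ Q * (sqrtDiag d * Φ)) =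
      Φᵀ * diagonal d * Q * Φ := by
    have e1 : Φᵀ * sqrtDiag d * (projMatrix d Φ Q * (sqrtDiag d * Φ)) =
        (Φᵀ * (sqrtDiag d * sqrtDiag d) * Φ) * (Φᵀ * diagonal d * Φ)⁻¹ *
          (Φᵀ * diagonal d * Q * ((sqrtDiag d)⁻¹ * sqrtDiag d) * Φ) := by
      simp only [projMatrix, Matrix.mul_assoc]
    rw [e1, hsq, nonsing_inv_mul _ hsu, mul_nonsing_inv _ hBu, Matrix.one_mul, Matrix.mul_one]
  have h3 : Φᵀ * sqrtDiag d * (sqrtDiag d * Φ) = diagonal (featureMass d Φ) := by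
    rw [← transpose_mul_diagonal_mul_eq hΦ, ← hsq]
    simp only [Matrix.mul_assoc]
  rw [h2, h3] at h1
  exact h1

/-- The limit `(Φᵀ D Φ)⁻¹ Φᵀ D Q Φ` of the matrices of the value recursion, conjugated with the
Perron-Frobenius eigenvector to a stochastic matrix. -/
noncomputable def criticMatrix (d : S → ℝ) (Φ : Matrix S (Fin x₂) ℝ) (Q : Matrix S S ℝ) (γ : ℝ)
    (r : Fin x₂ → ℝ) : Matrix (Fin x₂) (Fin x₂) ℝ :=
  Matrix.of fun k l => (featureMass d Φ k)⁻¹ * (Φᵀ * diagonal d * Q * Φ) k l * r l / (γ * r k)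

theorem crossMoment_apply (Q : Matrix S S ℝ) (k l : Fin x₂) :
    (Φᵀ * diagonal d * Q * Φ) k l = ∑ i, ∑ j, d i * Φ i k * Q i j * Φ j l := by
  have h1 : ∀ j, (Φᵀ * diagonal d * Q) k j = ∑ i, d i * Φ i k * Q i j := fun j => by
    rw [mul_apply]
    exact Finset.sum_congr rfl fun i _ => by rw [mul_diagonal, transpose_apply, mul_comm (d i)]
  rw [mul_apply]
  simp only [h1, Finset.sum_mul]
  exact Finset.sum_comm

theorem criticMatrix_mem_rowStochastic {Q : Matrix S S ℝ} (hQ : ∀ i j, 0 ≤ Q i j)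
    (hr : IsPerronCritic d Φ Q i₀ γ r) (hγ : 0 < γ) (hΦ : FeatureAssumption P Φ)
    (hd : ∀ i, 0 < d i) : criticMatrix d Φ Q γ r ∈ rowStochastic ℝ (Fin x₂) := by
  have hrpos := hr.weight_pos hΦ
  refine mem_rowStochastic_iff_sum.2 ⟨fun k l => ?_, fun k => ?_⟩
  · have h1 := featureMass_pos hΦ hd k
    have h2 := hrpos k
    have h3 := hrpos l
    have h4 : 0 ≤ (Φᵀ * diagonal d * Q * Φ) k l := by
      rw [crossMoment_apply]
      exact Finset.sum_nonneg fun i _ => Finset.sum_nonneg fun j _ => mul_nonneg (mul_nonneg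
        (mul_nonneg (hd i).le (hΦ.nonneg i k)) (hQ i j)) (hΦ.nonneg j l)
    simp only [criticMatrix, of_apply]
    positivity
  · have h1 := congrFun (hr.feature_eigen hΦ hd) k
    rw [Pi.smul_apply, mulVec_diagonal, smul_eq_mul] at h1
    have h2 : ∑ l, (Φᵀ * diagonal d * Q * Φ) k l * r l = γ * (featureMass d Φ k * r k) := h1
    have h3 := (featureMass_pos hΦ hd k).ne'
    have h4 := (hrpos k).ne'
    simp only [criticMatrix, of_apply, ← Finset.sum_div, mul_assoc, ← Finset.mul_sum]
    rw [h2]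
    field_simp

/-- A set of features closed under the critic matrix has a support which is closed under `P`
restricted to the states that carry a feature. -/
theorem noProperClosedSet_criticMatrix {Q : Matrix S S ℝ} (hQ : ∀ i j, 0 ≤ Q i j)
    (hQP : ∀ i j, 0 < P i j → 0 < Q i j)
    (hr : IsPerronCritic d Φ Q i₀ γ r) (hγ : 0 < γ) (hΦ : FeatureAssumption P Φ)
    (hd : ∀ i, 0 < d i) : NoProperClosedSet (criticMatrix d Φ Q γ r) := by
  have hrpos := hr.weight_pos hΦ
  have hpos : ∀ {k l i j}, 0 < Φ i k → 0 < P i j → 0 < Φ j l →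
      0 < criticMatrix d Φ Q γ r k l := by
    intro k l i j hik hij hjl
    have h1 := featureMass_pos hΦ hd k
    have h2 := hrpos k
    have h3 := hrpos l
    have hnn : ∀ i j, 0 ≤ d i * Φ i k * Q i j * Φ j l := fun i j => mul_nonneg (mul_nonneg
      (mul_nonneg (hd i).le (hΦ.nonneg i k)) (hQ i j)) (hΦ.nonneg j l)
    have h4 : 0 < (Φᵀ * diagonal d * Q * Φ) k l := by
      rw [crossMoment_apply]
      exact Finset.sum_pos' (fun i _ => Finset.sum_nonneg fun j _ => hnn i j)
        ⟨i, Finset.mem_univ i, Finset.sum_pos' (fun j _ => hnn i j) ⟨j, Finset.mem_univ j,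
          mul_pos (mul_pos (mul_pos (hd i) hik) (hQP i j hij)) hjl⟩⟩
    simp only [criticMatrix, of_apply]
    positivity
  rintro T ⟨k₀, hk₀⟩ hT
  have hcl := noProperClosedSet_of_isIrreducible hΦ.irreducible
    {i | ∃ k ∈ T, 0 < Φ i k} ?_ ?_
  · refine Set.eq_univ_of_forall fun l => ?_
    obtain ⟨j, hj⟩ := hΦ.exists_pos l
    obtain ⟨k, hkT, hk⟩ := (Set.eq_univ_iff_forall.1 hcl) ⟨j, l, hj⟩
    by_cases hkl : k = l
    · exact hkl ▸ hkT
    · exact absurd (hΦ.mul_feature_eq_zero hkl j) (mul_pos hk hj).ne'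
  · obtain ⟨i, hi⟩ := hΦ.exists_pos k₀
    exact ⟨⟨i, k₀, hi⟩, k₀, hk₀, hi⟩
  · rintro ⟨i, hi⟩ ⟨k, hkT, hik⟩ ⟨j, l, hjl⟩ hij
    exact ⟨l, hT k hkT l (hpos hik hij hjl), hjl⟩

end Critic

/-! ### Convergence of the value weights -/

section ValuePath

variable {S A : Type*} [Fintype S] {x₂ : ℕ} {M : MDP S A}
  {q : S → A → ℝ} {d : S → ℝ} {Φ : Matrix S (Fin x₂) ℝ} {P : Matrix S S ℝ} {α : ℝ}
  {x : ℕ → S} {z : ℕ → A}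

theorem empB_eq_diagonal (hΦ : FeatureAssumption P Φ) (n : ℕ) :
    empB Φ x n = diagonal fun k => ∑ m ∈ Finset.range (n + 1), Φ (x m) k ^ 2 := by
  ext k l
  rw [empB, Matrix.sum_apply]
  simp only [vecMulVec_apply]
  by_cases hkl : k = l
  · subst hkl
    rw [diagonal_apply_eq]
    exact Finset.sum_congr rfl fun i _ => by ring
  · rw [diagonal_apply_ne _ hkl]
    exact Finset.sum_eq_zero fun m _ => hΦ.mul_feature_eq_zero hkl _

theorem empB_inv_mul_empA_apply (hΦ : FeatureAssumption P Φ) {n : ℕ}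
    (hn : IsUnit (empB Φ x n).det) (k l : Fin x₂) :
    ((empB Φ x n)⁻¹ * empA M α Φ x z n) k l =
      (∑ m ∈ Finset.range (n + 1), Φ (x m) k ^ 2)⁻¹ *
        ∑ m ∈ Finset.range (n + 1),
          Real.exp (α * M.c (x m) (z m) (x (m + 1))) * (Φ (x m) k * Φ (x (m + 1)) l) := by
  rw [empB_eq_diagonal hΦ] at hn ⊢
  rw [det_diagonal, isUnit_iff_ne_zero, Finset.prod_ne_zero_iff] at hn
  have hinv : (diagonal fun k => ∑ m ∈ Finset.range (n + 1), Φ (x m) k ^ 2)⁻¹ =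
      diagonal fun k => (∑ m ∈ Finset.range (n + 1), Φ (x m) k ^ 2)⁻¹ := by
    refine inv_eq_left_inv ?_
    rw [diagonal_mul_diagonal, ← diagonal_one]
    congr 1
    funext k
    exact inv_mul_cancel₀ (hn k (Finset.mem_univ k))
  rw [hinv, diagonal_mul, empA, Matrix.sum_apply]
  rfl

/-- The weights stay nonnegative and nonzero because `1 - a n > 0`. -/
theorem IsValueIterate.nonneg_and_ne_zero {i₀ : S} {δ₁ : ℝ} (hδ₁ : 0 < δ₁) {a : ℕ → ℝ}
    (ha0 : ∀ n, 0 < a n) (ha1 : ∀ n, a n < 1) {r : ℕ → Fin x₂ → ℝ} (hΦ : FeatureAssumption P Φ)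
    (hr : IsValueIterate M α Φ i₀ δ₁ a x z r) (n : ℕ) : (∀ k, 0 ≤ r n k) ∧ r n ≠ 0 := by
  induction n with
  | zero => exact ⟨hr.init_nonneg, hr.init_ne_zero⟩
  | succ n ih =>
    by_cases hn : IsUnit (empB Φ x n).det
    · have hG : ∀ k l, 0 ≤ ((empB Φ x n)⁻¹ * empA M α Φ x z n) k l := fun k l => by
        rw [empB_inv_mul_empA_apply hΦ hn]
        exact mul_nonneg (inv_nonneg.2 (Finset.sum_nonneg fun m _ => sq_nonneg _))
          (Finset.sum_nonneg fun m _ => mul_nonneg (Real.exp_pos _).le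
            (mul_nonneg (hΦ.nonneg _ _) (hΦ.nonneg _ _)))
      have hle : ∀ k, (1 - a n) * r n k ≤ r (n + 1) k := fun k => by
        rw [hr.step n hn, sub_mulVec, one_mulVec, smul_mulVec]
        simp only [Pi.add_apply, Pi.smul_apply, Pi.sub_apply, smul_eq_mul]
        have h1 : 0 ≤ (((empB Φ x n)⁻¹ * empA M α Φ x z n) *ᵥ r n) k :=
          Finset.sum_nonneg fun l (_ : l ∈ Finset.univ) => mul_nonneg (hG k l) (ih.1 l)
        have h2 : 0 ≤ a n * ((max (Φ i₀ ⬝ᵥ r n) δ₁)⁻¹ *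
            (((empB Φ x n)⁻¹ * empA M α Φ x z n) *ᵥ r n) k) :=
          mul_nonneg (ha0 n).le (mul_nonneg
            (inv_nonneg.2 (hδ₁.le.trans (le_max_right _ _))) h1)
        linarith
      have h1a : 0 < 1 - a n := sub_pos.2 (ha1 n)
      refine ⟨fun k => (mul_nonneg h1a.le (ih.1 k)).trans (hle k), fun h0 => ih.2 ?_⟩
      funext k
      have h2 := hle k
      rw [h0] at h2
      exact le_antisymm (nonpos_of_mul_nonpos_right h2 h1a) (ih.1 k)
    · exact hr.warmup n hn

/-- The value weights converge along every path on which the empirical moments do. -/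
theorem IsValueIterate.tendsto [DecidableEq S] [Fintype A] {i₀ : S} {δ₁ : ℝ} (hδ₁ : 0 < δ₁)
    {a : ℕ → ℝ} (ha0 : ∀ n, 0 < a n) (ha1 : ∀ n, a n < 1) (ha : Tendsto a atTop (𝓝 0))
    (ha_sum : Tendsto (fun N => ∑ n ∈ Finset.range N, a n) atTop atTop)
    {r : ℕ → Fin x₂ → ℝ} (hq0 : ∀ i a, 0 < q i a) (hq1 : ∀ i, ∑ a, q i a = 1)
    (hirr : (transMatrix M q).IsIrreducible) (hd : IsStationary (transMatrix M q) d)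
    (hΦ : FeatureAssumption (transMatrix M q) Φ) {γ : ℝ} {rθ : Fin x₂ → ℝ}
    (hrθ : IsPerronCritic d Φ (expMatrix M α q) i₀ γ rθ) (hδγ : δ₁ < γ)
    (hxz : HasConvergentFluctuations M q d (fun n => ((n : ℝ) + 1)⁻¹) x z)
    (hr : IsValueIterate M α Φ i₀ δ₁ a x z r) : Tendsto r atTop (𝓝 rθ) := by
  set Q := expMatrix M α q with hQ_def
  have hγ : 0 < γ := hδ₁.trans hδγ
  have hdpos := hd.pos hirr
  have hQ : ∀ i j, 0 ≤ Q i j := fun i j => Finset.sum_nonneg fun a _ =>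
    mul_nonneg (mul_nonneg (hq0 i a).le (Real.exp_pos _).le) (M.p_nonneg i a j)
  have hQP : ∀ i j, 0 < transMatrix M q i j → 0 < Q i j := by
    intro i j hij
    by_contra h
    have h0 : Q i j = 0 := le_antisymm (not_lt.1 h) (hQ i j)
    have h1 := (Finset.sum_eq_zero_iff_of_nonneg fun a _ => mul_nonneg
      (mul_nonneg (hq0 i a).le (Real.exp_pos (α * M.c i a j)).le) (M.p_nonneg i a j)).1 h0
    refine hij.ne' (Finset.sum_eq_zero fun a ha => ?_)
    have h2 := h1 a ha
    have h3 : M.p i a j = 0 := (mul_eq_zero.1 h2).resolve_left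
      (mul_pos (hq0 i a) (Real.exp_pos _)).ne'
    rw [h3, mul_zero]
  have hpos := hrθ.weight_pos hΦ
  have hnn := hr.nonneg_and_ne_zero hδ₁ ha0 ha1 hΦ
  have hne : Nonempty (Fin x₂) := by
    obtain ⟨k, -⟩ := Function.ne_iff.1 hr.init_ne_zero
    exact ⟨k⟩
  -- the empirical moments
  have hB : ∀ k, Tendsto (fun n : ℕ => ((n : ℝ) + 1)⁻¹ *
      ∑ m ∈ Finset.range (n + 1), Φ (x m) k ^ 2) atTop (𝓝 (featureMass d Φ k)) := by
    intro k
    have h1 := hxz.tendsto_average_succ (f := fun i _ _ => Φ i k ^ 2)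
    have h2 : stationaryMean M q d (fun i _ _ => Φ i k ^ 2) = featureMass d Φ k :=
      stationaryMean_const_right hq1 _
    rwa [h2] at h1
  have hA : ∀ k l, Tendsto (fun n : ℕ => ((n : ℝ) + 1)⁻¹ * ∑ m ∈ Finset.range (n + 1),
      Real.exp (α * M.c (x m) (z m) (x (m + 1))) * (Φ (x m) k * Φ (x (m + 1)) l)) atTop
      (𝓝 ((Φᵀ * diagonal d * Q * Φ) k l)) := by
    intro k l
    have h1 := hxz.tendsto_average_succ
      (f := fun i a j => Real.exp (α * M.c i a j) * (Φ i k * Φ j l))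
    have h2 : stationaryMean M q d (fun i a j => Real.exp (α * M.c i a j) * (Φ i k * Φ j l)) =
        (Φᵀ * diagonal d * Q * Φ) k l := by
      rw [crossMoment_apply]
      simp only [stationaryMean, smul_eq_mul]
      refine Finset.sum_congr rfl fun i _ => ?_
      rw [Finset.sum_comm]
      refine Finset.sum_congr rfl fun j _ => ?_
      simp only [hQ_def, expMatrix, of_apply, Finset.mul_sum, Finset.sum_mul]
      exact Finset.sum_congr rfl fun a _ => by ring
    rwa [h2] at h1
  have hunit : ∀ᶠ n in atTop, IsUnit (empB Φ x n).det := by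
    have h1 : ∀ k, ∀ᶠ n : ℕ in atTop, ∑ m ∈ Finset.range (n + 1), Φ (x m) k ^ 2 ≠ 0 := by
      intro k
      filter_upwards [(hB k).eventually_const_lt (featureMass_pos hΦ hdpos k)] with n hn h0
      rw [h0, mul_zero] at hn
      exact hn.false
    filter_upwards [eventually_all.2 h1] with n hn
    rw [empB_eq_diagonal hΦ, det_diagonal, isUnit_iff_ne_zero]
    exact Finset.prod_ne_zero_iff.2 fun k _ => hn k
  set Gn : ℕ → Matrix (Fin x₂) (Fin x₂) ℝ := fun n => (empB Φ x n)⁻¹ * empA M α Φ x z n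
    with hGn_def
  -- the conjugation with the limiting weights turns the matrices of the recursion into
  -- approximately stochastic ones and the limiting weights into the constant vector
  set Kn : ℕ → Matrix (Fin x₂) (Fin x₂) ℝ := fun n =>
    Matrix.of fun k l => Gn n k l * rθ l / (γ * rθ k) with hKn_def
  have hKn : Tendsto Kn atTop (𝓝 (criticMatrix d Φ Q γ rθ)) := by
    refine tendsto_pi_nhds.2 fun k => tendsto_pi_nhds.2 fun l => ?_
    have h1 := ((((hB k).inv₀ (featureMass_pos hΦ hdpos k).ne').mul (hA k l)).mul_const
      (rθ l)).div_const (γ * rθ k)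
    refine h1.congr' ?_
    filter_upwards [hunit] with n hn
    have h2 : (n : ℝ) + 1 ≠ 0 := by positivity
    simp only [hKn_def, hGn_def, of_apply]
    rw [empB_inv_mul_empA_apply hΦ hn, mul_inv, inv_inv]
    congr 2
    field_simp
  set y : ℕ → Fin x₂ → ℝ := fun n k => r n k / rθ k with hy_def
  have hry : ∀ n k, r n k = rθ k * y n k := fun n k => by
    simp only [hy_def]
    rw [mul_div_cancel₀ _ (hpos k).ne']
  set h : Fin x₂ → ℝ := fun k => Φ i₀ k * rθ k / γ with hh_def
  have hh : ∑ k, h k = 1 := by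
    simp only [hh_def, ← Finset.sum_div]
    rw [div_eq_one_iff_eq hγ.ne']
    exact hrθ.normalized.symm
  have hmax : ∀ n, max (Φ i₀ ⬝ᵥ r n) δ₁ = γ * max (h ⬝ᵥ y n) (δ₁ / γ) := by
    intro n
    rw [mul_max_of_nonneg _ _ hγ.le, mul_div_cancel₀ _ hγ.ne']
    congr 1
    simp only [dotProduct, Finset.mul_sum, hh_def]
    refine Finset.sum_congr rfl fun k _ => ?_
    rw [hry n k]
    field_simp
  have hyt : ∀ k, Tendsto (fun n => y n k) atTop (𝓝 1) := by
    refine tendsto_one_of_normalized_recursion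
      (criticMatrix_mem_rowStochastic hQ hrθ hγ hΦ hdpos)
      (noProperClosedSet_criticMatrix hQ hQP hrθ hγ hΦ hdpos) ha0 ha1 ha ha_sum
      (δ := δ₁ / γ) (by positivity) ((div_lt_one hγ).2 hδγ) hh hKn
      (fun n k => div_nonneg ((hnn n).1 k) (hpos k).le) (fun n h0 => (hnn n).2 ?_) ?_
    · funext k
      rw [hry, h0]
      simp
    · filter_upwards [hunit] with n hn
      funext k
      have h1 := congrFun (hr.step n hn) k
      rw [hmax, sub_mulVec, one_mulVec, smul_mulVec] at h1
      simp only [Pi.add_apply, Pi.smul_apply, Pi.sub_apply, smul_eq_mul] at h1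
      have h2 : (Gn n *ᵥ r n) k = γ * rθ k * (Kn n *ᵥ y n) k := by
        simp only [mulVec, dotProduct, hKn_def, of_apply, Finset.mul_sum]
        refine Finset.sum_congr rfl fun l _ => ?_
        rw [hry n l]
        have := (hpos k).ne'
        field_simp
      rw [h2, hry n k] at h1
      simp only [Pi.add_apply, Pi.smul_apply, smul_eq_mul]
      have h3 : y (n + 1) k = r (n + 1) k / rθ k := rfl
      have h4 := (hpos k).ne'
      have h5 : 0 < max (h ⬝ᵥ y n) (δ₁ / γ) := lt_max_of_lt_right (by positivity)
      rw [h3, h1]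
      field_simp
      ring
  refine tendsto_pi_nhds.2 fun k => ?_
  have h1 := (hyt k).const_mul (rθ k)
  rw [mul_one] at h1
  exact h1.congr fun n => (hry n k).symm

end ValuePath

/-! ### A Lyapunov function for the gradient recursion -/

section Lyapunov

variable {ι : Type*} [Fintype ι]

/-- A positive quadratic form dominates every other one, up to a constant. -/
theorem exists_pos_mul_le_of_homogeneous {f g : (ι → ℝ) → ℝ} (hf : Continuous f)
    (hg : Continuous g) (hf2 : ∀ (c : ℝ) x, f (c • x) = c ^ 2 * f x)
    (hg2 : ∀ (c : ℝ) x, g (c • x) = c ^ 2 * g x) (hpos : ∀ x, x ≠ 0 → 0 < f x) :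
    ∃ c, 0 < c ∧ ∀ x, c * g x ≤ f x := by
  have hzero : ∀ {F : (ι → ℝ) → ℝ}, (∀ (c : ℝ) x, F (c • x) = c ^ 2 * F x) → F 0 = 0 :=
    fun {F} hF => by simpa using hF 0 0
  have hs : IsCompact (Metric.sphere (0 : ι → ℝ) 1) := isCompact_sphere 0 1
  obtain ⟨c, hc, hcs⟩ : ∃ c, 0 < c ∧ ∀ x ∈ Metric.sphere (0 : ι → ℝ) 1, c * g x ≤ f x := by
    rcases (Metric.sphere (0 : ι → ℝ) 1).eq_empty_or_nonempty with he | hne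
    · exact ⟨1, one_pos, by simp [he]⟩
    · obtain ⟨x₁, hx₁, h1⟩ := hs.exists_isMinOn hne hf.continuousOn
      obtain ⟨x₂, hx₂, h2⟩ := hs.exists_isMaxOn hne hg.continuousOn
      have hf1 : 0 < f x₁ := hpos x₁ fun h => by simp [h] at hx₁
      have hG : 0 < max (g x₂) 1 := lt_max_of_lt_right one_pos
      refine ⟨f x₁ / max (g x₂) 1, by positivity, fun x hx => ?_⟩
      have h3 : f x₁ ≤ f x := h1 hx
      have h4 : g x ≤ max (g x₂) 1 := (h2 hx : g x ≤ g x₂).trans (le_max_left _ _)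
      calc f x₁ / max (g x₂) 1 * g x ≤ f x₁ / max (g x₂) 1 * max (g x₂) 1 :=
            mul_le_mul_of_nonneg_left h4 (by positivity)
        _ = f x₁ := by field_simp
        _ ≤ f x := h3
  refine ⟨c, hc, fun x => ?_⟩
  by_cases hx : x = 0
  · rw [hx, hzero hf2, hzero hg2, mul_zero]
  have hn : 0 < ‖x‖ := norm_pos_iff.2 hx
  have h1 := hcs (‖x‖⁻¹ • x) (by simp [norm_smul, hn.ne'])
  rw [hf2, hg2, mul_left_comm] at h1
  exact le_of_mul_le_mul_left h1 (by positivity)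

variable [DecidableEq ι]

/-- The mean matrix of the coupled recursion for the rows of `u` and `w`. -/
def gtdMean (C A : Matrix ι ι ℝ) : Matrix (ι ⊕ ι) (ι ⊕ ι) ℝ := fromBlocks (-C) (-A) Aᵀ 0

/-- The shear `(u, w) ↦ (u + η A w, w)`. -/
def shear (A : Matrix ι ι ℝ) (η : ℝ) : Matrix (ι ⊕ ι) (ι ⊕ ι) ℝ := fromBlocks 1 (η • A) 0 1

theorem shear_neg_mul_shear (A : Matrix ι ι ℝ) (η : ℝ) : shear A (-η) * shear A η = 1 := by
  simp [shear, fromBlocks_multiply]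

/-- After a small shear, the mean matrix is negative definite. Without the shear its quadratic form
is `-⟨u, C u⟩`, which gives no decay in the direction of `w`; the coupling `-A w` of the two
components makes up for it. -/
theorem exists_shear_dissipative {C A : Matrix ι ι ℝ} (hC : ∀ x, x ≠ 0 → 0 < x ⬝ᵥ C *ᵥ x)
    (hA : IsUnit A.det) :
    ∃ η c : ℝ, 0 < c ∧ ∀ y, y ⬝ᵥ (shear A η * gtdMean C A * shear A (-η)) *ᵥ y ≤ -c * (y ⬝ᵥ y) := by
  have hself : ∀ x : ι → ℝ, x ≠ 0 → 0 < x ⬝ᵥ x := fun x hx => by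
    have h1 : 0 ≤ x ⬝ᵥ x := Finset.sum_nonneg fun i _ => mul_self_nonneg _
    exact lt_of_le_of_ne h1 fun h => hx (dotProduct_self_eq_zero.1 h.symm)
  have hinj : ∀ x : ι → ℝ, x ≠ 0 → A *ᵥ x ≠ 0 := fun x hx h =>
    hx (mulVec_injective_iff_isUnit.2 ((isUnit_iff_isUnit_det A).2 hA) (by rw [h, mulVec_zero]))
  have hcont : ∀ B B' : Matrix ι ι ℝ, Continuous fun x : ι → ℝ => (B *ᵥ x) ⬝ᵥ (B' *ᵥ x) :=
    fun B B' => by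
      simp only [mulVec, dotProduct]
      fun_prop
  have hhom : ∀ (B B' : Matrix ι ι ℝ) (c : ℝ) (x : ι → ℝ),
      (B *ᵥ (c • x)) ⬝ᵥ (B' *ᵥ (c • x)) = c ^ 2 * ((B *ᵥ x) ⬝ᵥ (B' *ᵥ x)) := fun B B' c x => by
    simp only [mulVec_smul, dotProduct_smul, smul_dotProduct, smul_eq_mul]
    ring
  obtain ⟨c₀, hc₀, h₀⟩ := exists_pos_mul_le_of_homogeneous (hcont 1 C) (hcont 1 1) (hhom 1 C)
    (hhom 1 1) (fun x hx => by simpa using hC x hx)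
  obtain ⟨a₀, ha₀, h₁⟩ := exists_pos_mul_le_of_homogeneous (hcont A A) (hcont 1 1) (hhom A A)
    (hhom 1 1) (fun x hx => hself _ (hinj x hx))
  obtain ⟨k₁, hk₁, h₂⟩ := exists_pos_mul_le_of_homogeneous (hcont 1 1) (hcont Aᵀ Aᵀ) (hhom 1 1)
    (hhom Aᵀ Aᵀ) (fun x hx => by simpa using hself x hx)
  obtain ⟨k₂, hk₂, h₃⟩ := exists_pos_mul_le_of_homogeneous (hcont 1 1) (hcont Cᵀ Cᵀ) (hhom 1 1)
    (hhom Cᵀ Cᵀ) (fun x hx => by simpa using hself x hx)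
  obtain ⟨k₃, hk₃, h₄⟩ := exists_pos_mul_le_of_homogeneous (hcont 1 1)
    (hcont (A * Aᵀ) (A * Aᵀ)) (hhom 1 1) (hhom (A * Aᵀ) (A * Aᵀ))
    (fun x hx => by simpa using hself x hx)
  simp only [one_mulVec] at h₀ h₁ h₂ h₃ h₄
  set K : ℝ := k₁⁻¹ + k₂⁻¹ + k₃⁻¹ with hK_def
  have hK : 0 < K := by positivity
  set η : ℝ := min 1 (c₀ / (2 * K)) with hη_def
  have hη : 0 < η := lt_min one_pos (by positivity)
  have hη1 : η ≤ 1 := min_le_left _ _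
  have hηK : η * K ≤ c₀ / 2 := by
    calc η * K ≤ c₀ / (2 * K) * K := mul_le_mul_of_nonneg_right (min_le_right _ _) hK.le
      _ = c₀ / 2 := by field_simp
  refine ⟨η, min (c₀ / 2) (η * a₀ / 2), lt_min (by positivity) (by positivity), fun y => ?_⟩
  set p : ι → ℝ := y ∘ Sum.inl with hp_def
  set w : ι → ℝ := y ∘ Sum.inr with hw_def
  have hy : y = Sum.elim p w := (Sum.elim_comp_inl_inr y).symm
  have hmat : shear A η * gtdMean C A * shear A (-η) =
      fromBlocks (-C + η • (A * Aᵀ)) (η • (C * A) - A - (η ^ 2) • (A * Aᵀ * A)) Aᵀ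
        (-(η • (Aᵀ * A))) := by
    simp only [shear, gtdMean, fromBlocks_multiply]
    congr 1
    · simp
    · simp only [Matrix.one_mul, Matrix.mul_one, Matrix.smul_mul, Matrix.mul_smul, neg_smul,
        Matrix.mul_neg, Matrix.neg_mul, Matrix.add_mul, Matrix.mul_zero, smul_add, smul_neg]
      rw [pow_two, smul_smul]
      abel
    · simp
    · simp
  set s := Aᵀ *ᵥ p with hs_def
  set t := A *ᵥ w with ht_def
  have f1 : p ⬝ᵥ t = w ⬝ᵥ s := by
    rw [ht_def, hs_def, dotProduct_mulVec, ← mulVec_transpose, dotProduct_comm]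
  have hform : y ⬝ᵥ (shear A η * gtdMean C A * shear A (-η)) *ᵥ y =
      -(p ⬝ᵥ C *ᵥ p) + η * (s ⬝ᵥ s) + η * ((Cᵀ *ᵥ p) ⬝ᵥ t)
        - η ^ 2 * (((A * Aᵀ) *ᵥ p) ⬝ᵥ t) - η * (t ⬝ᵥ t) := by
    rw [hmat, hy, fromBlocks_mulVec, sumElim_dotProduct_sumElim]
    simp only [Sum.elim_comp_inl, Sum.elim_comp_inr, add_mulVec, sub_mulVec, neg_mulVec,
      smul_mulVec, dotProduct_add, dotProduct_sub, dotProduct_neg, dotProduct_smul, smul_eq_mul]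
    have e1 : p ⬝ᵥ (A * Aᵀ) *ᵥ p = s ⬝ᵥ s := by
      rw [← mulVec_mulVec, dotProduct_mulVec, ← mulVec_transpose]
    have e2 : p ⬝ᵥ (C * A) *ᵥ w = (Cᵀ *ᵥ p) ⬝ᵥ t := by
      rw [← mulVec_mulVec, dotProduct_mulVec, ← mulVec_transpose]
    have e3 : p ⬝ᵥ (A * Aᵀ * A) *ᵥ w = ((A * Aᵀ) *ᵥ p) ⬝ᵥ t := by
      rw [← mulVec_mulVec, dotProduct_mulVec, ← mulVec_transpose, transpose_mul,
        transpose_transpose]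
    have e4 : w ⬝ᵥ (Aᵀ * A) *ᵥ w = t ⬝ᵥ t := by
      rw [← mulVec_mulVec, dotProduct_mulVec, ← mulVec_transpose, transpose_transpose]
    rw [e1, e2, e3, e4, f1]
    ring
  have hyy : y ⬝ᵥ y = p ⬝ᵥ p + w ⬝ᵥ w := by
    conv_lhs => rw [hy]
    exact sumElim_dotProduct_sumElim _ _ _ _
  have hpp : 0 ≤ p ⬝ᵥ p := Finset.sum_nonneg fun i _ => mul_self_nonneg _
  have hww : 0 ≤ w ⬝ᵥ w := Finset.sum_nonneg fun i _ => mul_self_nonneg _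
  -- `2 ⟨v, t⟩ ≤ 2 ⟨v, v⟩ + ⟨t, t⟩ / 2` and its analogue with the opposite sign
  have hyoung : ∀ v : ι → ℝ, |v ⬝ᵥ t| ≤ v ⬝ᵥ v + (t ⬝ᵥ t) / 4 := by
    intro v
    have e1 : 0 ≤ ((2 : ℝ) • v + t) ⬝ᵥ ((2 : ℝ) • v + t) :=
      Finset.sum_nonneg fun i _ => mul_self_nonneg _
    have e2 : 0 ≤ ((2 : ℝ) • v - t) ⬝ᵥ ((2 : ℝ) • v - t) :=
      Finset.sum_nonneg fun i _ => mul_self_nonneg _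
    have e3 := dotProduct_comm v t
    simp only [dotProduct_add, add_dotProduct, dotProduct_sub, sub_dotProduct, dotProduct_smul,
      smul_dotProduct, smul_eq_mul] at e1 e2
    exact abs_le.2 ⟨by linarith, by linarith⟩
  have g1 := (le_abs_self _).trans (hyoung (Cᵀ *ᵥ p))
  have g2 := (neg_abs_le _).trans' (neg_le_neg (hyoung ((A * Aᵀ) *ᵥ p)))
  have i1 : s ⬝ᵥ s ≤ k₁⁻¹ * (p ⬝ᵥ p) := by
    rw [← div_eq_inv_mul, le_div_iff₀ hk₁, mul_comm]; exact h₂ p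
  have i2 : (Cᵀ *ᵥ p) ⬝ᵥ (Cᵀ *ᵥ p) ≤ k₂⁻¹ * (p ⬝ᵥ p) := by
    rw [← div_eq_inv_mul, le_div_iff₀ hk₂, mul_comm]; exact h₃ p
  have i3 : ((A * Aᵀ) *ᵥ p) ⬝ᵥ ((A * Aᵀ) *ᵥ p) ≤ k₃⁻¹ * (p ⬝ᵥ p) := by
    rw [← div_eq_inv_mul, le_div_iff₀ hk₃, mul_comm]; exact h₄ p
  have hq3 : 0 ≤ ((A * Aᵀ) *ᵥ p) ⬝ᵥ ((A * Aᵀ) *ᵥ p) :=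
    Finset.sum_nonneg fun i _ => mul_self_nonneg _
  have htt : 0 ≤ t ⬝ᵥ t := Finset.sum_nonneg fun i _ => mul_self_nonneg _
  have j1 := mul_le_mul_of_nonneg_left g1 hη.le
  have j2 : -(η ^ 2 * (((A * Aᵀ) *ᵥ p) ⬝ᵥ t)) ≤
      η * (((A * Aᵀ) *ᵥ p) ⬝ᵥ ((A * Aᵀ) *ᵥ p) + (t ⬝ᵥ t) / 4) := by
    have e1 : η ^ 2 ≤ η := by nlinarith
    have e2 := mul_le_mul_of_nonneg_left g2 (sq_nonneg η)
    have e3 := mul_le_mul_of_nonneg_right e1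
      (by positivity : 0 ≤ ((A * Aᵀ) *ᵥ p) ⬝ᵥ ((A * Aᵀ) *ᵥ p) + (t ⬝ᵥ t) / 4)
    linarith
  have j3 : η * (s ⬝ᵥ s + (Cᵀ *ᵥ p) ⬝ᵥ (Cᵀ *ᵥ p) + ((A * Aᵀ) *ᵥ p) ⬝ᵥ ((A * Aᵀ) *ᵥ p)) ≤
      c₀ / 2 * (p ⬝ᵥ p) := by
    calc _ ≤ η * (K * (p ⬝ᵥ p)) := by
          refine mul_le_mul_of_nonneg_left ?_ hη.le
          rw [hK_def]
          linarith
      _ = η * K * (p ⬝ᵥ p) := by ring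
      _ ≤ _ := mul_le_mul_of_nonneg_right hηK hpp
  have j4 := h₀ p
  have j5 := mul_le_mul_of_nonneg_left (h₁ w) hη.le
  have m1 := mul_le_mul_of_nonneg_right (min_le_left (c₀ / 2) (η * a₀ / 2)) hpp
  have m2 := mul_le_mul_of_nonneg_right (min_le_right (c₀ / 2) (η * a₀ / 2)) hww
  have m3 : η * (a₀ * (w ⬝ᵥ w)) ≤ η * (t ⬝ᵥ t) := j5
  rw [hform, hyy]
  linarith

end Lyapunov

/-- A real matrix which is similar to a matrix with negative definite quadratic form is Hurwitz:
test the form on the real and imaginary parts of an eigenvector. -/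
theorem isHurwitz_of_dissipative {n : Type*} [Fintype n] [DecidableEq n] {G T T' : Matrix n n ℝ}
    (hT : T' * T = 1) {c : ℝ} (hc : 0 < c)
    (hdiss : ∀ y, y ⬝ᵥ (T * G * T') *ᵥ y ≤ -c * (y ⬝ᵥ y)) : IsHurwitz G := by
  intro z hz
  rw [spectrum.mem_iff, isUnit_iff_isUnit_det, isUnit_iff_ne_zero, not_not] at hz
  obtain ⟨v, hv0, hv⟩ := exists_mulVec_eq_zero_iff.2 hz
  rw [sub_mulVec, sub_eq_zero, Algebra.algebraMap_eq_smul_one, smul_mulVec, one_mulVec] at hv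
  set x : n → ℝ := fun i => (v i).re with hx_def
  set y : n → ℝ := fun i => (v i).im with hy_def
  have hre : G *ᵥ x = z.re • x - z.im • y := by
    funext i
    have h1 := congrArg Complex.re (congrFun hv i)
    simp only [mulVec, dotProduct, Pi.smul_apply, smul_eq_mul, Complex.mul_re, map_apply,
      Complex.coe_algebraMap, Complex.re_sum, Complex.ofReal_re, Complex.ofReal_im, zero_mul,
      sub_zero] at h1
    simpa [mulVec, dotProduct] using h1.symm
  have him : G *ᵥ y = z.re • y + z.im • x := by
    funext i
    have h1 := congrArg Complex.im (congrFun hv i)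
    simp only [mulVec, dotProduct, Pi.smul_apply, smul_eq_mul, Complex.mul_im, map_apply,
      Complex.coe_algebraMap, Complex.im_sum, Complex.ofReal_re, Complex.ofReal_im, zero_mul,
      add_zero] at h1
    simpa [mulVec, dotProduct] using h1.symm
  have hconj : ∀ x, (T * G * T') *ᵥ (T *ᵥ x) = T *ᵥ (G *ᵥ x) := fun x => by
    rw [mulVec_mulVec, Matrix.mul_assoc, hT, Matrix.mul_one, mulVec_mulVec]
  have hx := hdiss (T *ᵥ x)
  have hy := hdiss (T *ᵥ y)
  rw [hconj, hre, mulVec_sub, mulVec_smul, mulVec_smul, dotProduct_sub, dotProduct_smul,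
    dotProduct_smul, smul_eq_mul, smul_eq_mul] at hx
  rw [hconj, him, mulVec_add, mulVec_smul, mulVec_smul, dotProduct_add, dotProduct_smul,
    dotProduct_smul, smul_eq_mul, smul_eq_mul, dotProduct_comm (T *ᵥ y) (T *ᵥ x)] at hy
  have hx0 : 0 ≤ (T *ᵥ x) ⬝ᵥ (T *ᵥ x) := Finset.sum_nonneg fun i _ => mul_self_nonneg _
  have hy0 : 0 ≤ (T *ᵥ y) ⬝ᵥ (T *ᵥ y) := Finset.sum_nonneg fun i _ => mul_self_nonneg _
  have hpos : 0 < (T *ᵥ x) ⬝ᵥ (T *ᵥ x) + (T *ᵥ y) ⬝ᵥ (T *ᵥ y) := by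
    refine lt_of_le_of_ne (by positivity) fun h => hv0 ?_
    have hinj : ∀ x, T *ᵥ x = 0 → x = 0 := fun x hx => by
      rw [← one_mulVec x, ← hT, ← mulVec_mulVec, hx, mulVec_zero]
    have h1 : x = 0 := hinj x (dotProduct_self_eq_zero.1 (by linarith))
    have h2 : y = 0 := hinj y (dotProduct_self_eq_zero.1 (by linarith))
    funext i
    exact Complex.ext (congrFun h1 i) (congrFun h2 i)
  by_contra hz0
  nlinarith

/-- Short Euler steps of a dissipative operator are contractions. -/
theorem eventually_norm_add_smul_le {E : Type*} [NormedAddCommGroup E] [InnerProductSpace ℝ E]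
    {L : E →L[ℝ] E} {c : ℝ} (hc : 0 < c) (hdiss : ∀ x, inner ℝ x (L x) ≤ -c * ‖x‖ ^ 2) :
    ∀ᶠ β in 𝓝[>] (0 : ℝ), ∀ x, ‖x + β • L x‖ ≤ (1 - c / 2 * β) * ‖x‖ := by
  have h1 : ∀ᶠ β in 𝓝[>] (0 : ℝ), β * ‖L‖ ^ 2 ≤ c := by
    have : Tendsto (fun β : ℝ => β * ‖L‖ ^ 2) (𝓝[>] 0) (𝓝 (0 * ‖L‖ ^ 2)) :=
      (tendsto_id.mono_left nhdsWithin_le_nhds).mul_const _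
    rw [zero_mul] at this
    exact this.eventually_le_const hc
  have h2 : ∀ᶠ β in 𝓝[>] (0 : ℝ), c / 2 * β ≤ 1 := by
    have : Tendsto (fun β : ℝ => c / 2 * β) (𝓝[>] 0) (𝓝 (c / 2 * 0)) :=
      (tendsto_id.mono_left nhdsWithin_le_nhds).const_mul _
    rw [mul_zero] at this
    exact this.eventually_le_const one_pos
  filter_upwards [h1, h2, self_mem_nhdsWithin] with β h1 h2 (hβ : 0 < β) x
  have hx := norm_nonneg x
  refine le_of_sq_le_sq ?_ (mul_nonneg (by linarith) hx)
  rw [norm_add_sq_real, inner_smul_right, norm_smul, Real.norm_of_nonneg hβ.le]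
  have h3 : ‖L x‖ ^ 2 ≤ ‖L‖ ^ 2 * ‖x‖ ^ 2 := by
    rw [← mul_pow]
    exact pow_le_pow_left₀ (norm_nonneg _) (L.le_opNorm x) 2
  have h4 := mul_le_mul_of_nonneg_left (hdiss x) hβ.le
  have h5 := mul_le_mul_of_nonneg_left h3 (sq_nonneg β)
  have h6 := mul_le_mul_of_nonneg_right h1 (mul_nonneg hβ.le (sq_nonneg ‖x‖))
  nlinarith [mul_nonneg (sq_nonneg (c / 2 * β)) (sq_nonneg ‖x‖)]

/-! ### The mean of the gradient recursion -/

section Gradient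

variable {S A : Type*} {x₁ x₃ : ℕ} {Ψ : Matrix S (Fin x₃) ℝ} {i₀ : S}

/-- The matrix of one step of the coupled recursion, acting on a row of `u` and the corresponding
row of `w`, for the transition from `i` to `j` and the importance sampling ratio `ρ`. -/
def gtdMatrix (Ψ : Matrix S (Fin x₃) ℝ) (i₀ : S) (ρ : ℝ) (i j : S) :
    Matrix (Fin x₃ ⊕ Fin x₃) (Fin x₃ ⊕ Fin x₃) ℝ :=
  fromBlocks (-vecMulVec (Ψ i) (Ψ i)) (-vecMulVec (Ψ i) (Ψ i + Ψ i₀ - ρ • Ψ j))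
    (vecMulVec (Ψ i + Ψ i₀ - ρ • Ψ j) (Ψ i)) 0

/-- The forcing term of one step of the coupled recursion, for the component `s` of the score
function `∇_θ log π_θ`. -/
def gtdForcing (Ψ : Matrix S (Fin x₃) ℝ) (ρ s : ℝ) (i : S) : Fin x₃ ⊕ Fin x₃ → ℝ :=
  Sum.elim (((ρ - 1) * s) • Ψ i) 0

theorem gtdMatrix_eq_affine (ρ : ℝ) (i j : S) :
    gtdMatrix Ψ i₀ ρ i j =
      gtdMatrix Ψ i₀ 0 i j + ρ • (gtdMatrix Ψ i₀ 1 i j - gtdMatrix Ψ i₀ 0 i j) := by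
  ext (k | k) (l | l) <;> simp [gtdMatrix, vecMulVec_apply] <;> ring

theorem gtdForcing_eq_affine (ρ s : ℝ) (i : S) :
    gtdForcing Ψ ρ s i = gtdForcing Ψ 0 s i + ρ • (gtdForcing Ψ 1 s i - gtdForcing Ψ 0 s i) := by
  ext (k | k)
  · simp [gtdForcing]
    ring
  · simp [gtdForcing]

/-- The likelihood ratio identity `π ∇ log π = ∇ π`. -/
theorem PolicyFamily.gradient_log [Fintype A] (pol : PolicyFamily S A x₁)
    (θ : EuclideanSpace ℝ (Fin x₁)) (i : S) (a : A) (l : Fin x₁) :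
    pol.prob θ i a * gradient (fun t => Real.log (pol.prob t i a)) θ l =
      gradient (fun t => pol.prob t i a) θ l := by
  have h1 : DifferentiableAt ℝ (fun t => pol.prob t i a) θ :=
    ((pol.contDiff i a).differentiable (by norm_num)).differentiableAt
  have h2 := (pol.prob_pos θ i a).ne'
  have h3 : gradient (fun t => Real.log (pol.prob t i a)) θ =
      (pol.prob θ i a)⁻¹ • gradient (fun t => pol.prob t i a) θ := by
    simp only [gradient, (h1.hasFDerivAt.log h2).fderiv, map_smulₛₗ]
    simp
  rw [h3, PiLp.smul_apply, smul_eq_mul, ← mul_assoc, mul_inv_cancel₀ h2, one_mul]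

theorem IsGTD2Iterate.row_succ [Fintype A] {pol : PolicyFamily S A x₁}
    {θ : EuclideanSpace ℝ (Fin x₁)} {b : ℕ → ℝ} {x : ℕ → S} {z : ℕ → A} {ρ : ℕ → ℝ}
    {u w : ℕ → Matrix (Fin x₁) (Fin x₃) ℝ} (h : IsGTD2Iterate pol θ Ψ i₀ b x z ρ u w)
    (l : Fin x₁) (n : ℕ) :
    Sum.elim (u (n + 1) l) (w (n + 1) l) = Sum.elim (u n l) (w n l) + b n •
      (gtdMatrix Ψ i₀ (ρ n) (x n) (x (n + 1)) *ᵥ Sum.elim (u n l) (w n l) +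
        gtdForcing Ψ (ρ n)
          (gradient (fun t => Real.log (pol.prob t (x n) (z n))) θ l) (x n)) := by
  rw [gtdMatrix, fromBlocks_mulVec]
  have hw : ∀ y, (w n *ᵥ y) l = w n l ⬝ᵥ y := fun y => rfl
  have hu : ∀ y, (u n *ᵥ y) l = u n l ⬝ᵥ y := fun y => rfl
  funext k
  rcases k with k | k
  · rw [Sum.elim_inl, h.step_u n]
    simp [gtdForcing, tdError, vecMulVec_apply, neg_mulVec, vecMulVec_mulVec, hw, hu,
      dotProduct_comm]
    ring
  · rw [Sum.elim_inr, h.step_w n]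
    simp [gtdForcing, vecMulVec_apply, vecMulVec_mulVec, hu, dotProduct_comm]

variable [Fintype S] [Fintype A] {M : MDP S A} {q : S → A → ℝ} {d : S → ℝ}

variable [DecidableEq S]

theorem C1_apply (k l : Fin x₃) : C1 d Ψ k l = ∑ i, d i * (Ψ i k * Ψ i l) := by
  rw [C1, mul_apply]
  exact Finset.sum_congr rfl fun i _ => by rw [mul_diagonal, transpose_apply]; ring

theorem A1_apply (R : Matrix S S ℝ) (k l : Fin x₃) :
    A1 d Ψ R i₀ k l = ∑ i, d i * (Ψ i k * (Ψ i l + Ψ i₀ l - ∑ j, R i j * Ψ j l)) := by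
  have h1 : ∀ i, ((1 + refMatrix i₀ - R : Matrix S S ℝ) * Ψ : Matrix S (Fin x₃) ℝ) i l =
      Ψ i l + Ψ i₀ l - ∑ j, R i j * Ψ j l := by
    intro i
    rw [Matrix.sub_mul, Matrix.add_mul, Matrix.one_mul, Matrix.sub_apply, Matrix.add_apply,
      mul_apply, mul_apply]
    simp [refMatrix]
  rw [A1, Matrix.mul_assoc, mul_apply]
  exact Finset.sum_congr rfl fun i _ => by rw [mul_diagonal, transpose_apply, h1]; ring

/-- In the mean, the coupled recursion has the matrix with blocks `-C`, `-A`, `Aᵀ`, `0`. -/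
theorem stationaryMean_gtdMatrix (hq1 : ∀ i, ∑ a, q i a = 1) (g : S → A → S → ℝ) :
    (stationaryMean M q d fun i a j => gtdMatrix Ψ i₀ (g i a j) i j) =
      gtdMean (C1 d Ψ) (A1 d Ψ (ratioMatrix M q g) i₀) := by
  have hC : ∀ k l, (stationaryMean M q d fun i _ _ => Ψ i k * Ψ i l) = C1 d Ψ k l := fun k l => by
    rw [stationaryMean_const_right hq1, C1_apply]
  have hA : ∀ k l, (stationaryMean M q d fun i a j =>
      Ψ i k * (Ψ i l + Ψ i₀ l - g i a j * Ψ j l)) =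
      A1 d Ψ (ratioMatrix M q g) i₀ k l := fun k l => by
    rw [A1_apply]
    simp only [stationaryMean, smul_eq_mul]
    refine Finset.sum_congr rfl fun i _ => ?_
    have h1 : ∑ j, ratioMatrix M q g i j * Ψ j l =
        ∑ a, ∑ j, q i a * M.p i a j * (g i a j * Ψ j l) := by
      simp only [ratioMatrix, of_apply, Finset.sum_mul]
      rw [Finset.sum_comm]
      exact Finset.sum_congr rfl fun a _ => Finset.sum_congr rfl fun j _ => by ring
    have h2 : ∑ a, ∑ j, q i a * M.p i a j = 1 := by
      simp only [← Finset.mul_sum, M.p_sum, mul_one, hq1]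
    have h3 : ∑ a, ∑ j, q i a * M.p i a j * (Ψ i k * (Ψ i l + Ψ i₀ l - g i a j * Ψ j l)) =
        Ψ i k * ((Ψ i l + Ψ i₀ l) * ∑ a, ∑ j, q i a * M.p i a j -
          ∑ a, ∑ j, q i a * M.p i a j * (g i a j * Ψ j l)) := by
      simp only [Finset.mul_sum, ← Finset.sum_sub_distrib]
      exact Finset.sum_congr rfl fun a _ => Finset.sum_congr rfl fun j _ => by ring
    rw [h1, ← mul_one (Ψ i l + Ψ i₀ l), ← h2, ← h3, h2]
    simp only [Finset.mul_sum, mul_one]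
    exact Finset.sum_congr rfl fun a _ => Finset.sum_congr rfl fun j _ => by ring
  have hneg : ∀ f : S → A → S → ℝ, (stationaryMean M q d fun i a j => -f i a j) =
      -stationaryMean M q d f := fun f => by
    simp only [stationaryMean, smul_neg, Finset.sum_neg_distrib]
  have hentry : ∀ r c, (stationaryMean M q d fun i a j => gtdMatrix Ψ i₀ (g i a j) i j) r c =
      stationaryMean M q d fun i a j => gtdMatrix Ψ i₀ (g i a j) i j r c := fun r c =>
    map_stationaryMean (entryLinearMap ℝ ℝ r c) _
  ext (k | k) (l | l)
  · rw [hentry]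
    simp only [gtdMatrix, gtdMean, fromBlocks_apply₁₁, Matrix.neg_apply, vecMulVec_apply]
    rw [hneg, hC]
  · rw [hentry]
    simp only [gtdMatrix, gtdMean, fromBlocks_apply₁₂, Matrix.neg_apply, vecMulVec_apply,
      Pi.sub_apply,
      Pi.add_apply, Pi.smul_apply, smul_eq_mul]
    rw [hneg, hA]
  · rw [hentry]
    simp only [gtdMatrix, gtdMean, fromBlocks_apply₂₁, vecMulVec_apply, Pi.sub_apply,
      Pi.add_apply, Pi.smul_apply, smul_eq_mul, transpose_apply, ← hA]
    congr 1
    funext i a j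
    ring
  · rw [hentry]
    simp [gtdMatrix, gtdMean, stationaryMean]

theorem stationaryMean_gtdForcing {pol : PolicyFamily S A x₁} {θ : EuclideanSpace ℝ (Fin x₁)}
    (g : S → A → S → ℝ) (l : Fin x₁) :
    (stationaryMean M (pol.prob θ) d fun i a j => gtdForcing Ψ (g i a j)
      (gradient (fun t => Real.log (pol.prob t i a)) θ l) i) =
      Sum.elim (fun k => b1 d Ψ (gradMatrix M pol θ g) k l) 0 := by
  have hentry : ∀ r, (stationaryMean M (pol.prob θ) d fun i a j => gtdForcing Ψ (g i a j)
      (gradient (fun t => Real.log (pol.prob t i a)) θ l) i) r =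
      stationaryMean M (pol.prob θ) d fun i a j => gtdForcing Ψ (g i a j)
        (gradient (fun t => Real.log (pol.prob t i a)) θ l) i r := fun r =>
    by simp only [stationaryMean, Finset.sum_apply, Pi.smul_apply]
  funext k
  rw [hentry]
  rcases k with k | k
  · simp only [gtdForcing, Sum.elim_inl, b1, Pi.smul_apply, smul_eq_mul, stationaryMean]
    rw [mul_apply]
    refine Finset.sum_congr rfl fun i _ => ?_
    rw [mul_diagonal, transpose_apply]
    simp only [gradMatrix, of_apply, Finset.mul_sum]
    refine Finset.sum_congr rfl fun a _ => Finset.sum_congr rfl fun j _ => ?_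
    rw [← pol.gradient_log θ i a l]
    ring
  · simp [gtdForcing, stationaryMean]

theorem dotProduct_C1_pos (hd : ∀ i, 0 < d i) (hC : IsUnit (C1 d Ψ).det) {v : Fin x₃ → ℝ}
    (hv : v ≠ 0) : 0 < v ⬝ᵥ C1 d Ψ *ᵥ v := by
  have h1 : v ⬝ᵥ C1 d Ψ *ᵥ v = ∑ i, d i * (Ψ *ᵥ v) i ^ 2 := by
    rw [C1, ← mulVec_mulVec, ← mulVec_mulVec, dotProduct_mulVec, vecMul_transpose]
    simp only [dotProduct, mulVec_diagonal]
    exact Finset.sum_congr rfl fun i _ => by ring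
  have hnn : ∀ i ∈ Finset.univ, 0 ≤ d i * (Ψ *ᵥ v) i ^ 2 := fun i _ =>
    mul_nonneg (hd i).le (sq_nonneg _)
  rw [h1]
  refine lt_of_le_of_ne (Finset.sum_nonneg hnn) fun h0 => hv ?_
  have h2 : Ψ *ᵥ v = 0 := funext fun i => by
    have h3 := (Finset.sum_eq_zero_iff_of_nonneg hnn).1 h0.symm i (Finset.mem_univ i)
    simpa [(hd i).ne'] using h3
  have h4 : C1 d Ψ *ᵥ v = 0 := by
    rw [C1, ← mulVec_mulVec, h2, mulVec_zero]
  exact mulVec_injective_iff_isUnit.2 ((isUnit_iff_isUnit_det _).2 hC) (by rw [h4, mulVec_zero])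

end Gradient

/-! ### Linear recursions along a path -/

section Path

variable {S A : Type*} [Fintype S] [Fintype A] {M : MDP S A} {q : S → A → ℝ} {d : S → ℝ}
  {b : ℕ → ℝ} {x : ℕ → S} {z : ℕ → A}

theorem tendsto_zero_along_path {V : Type*} [NormedAddCommGroup V] {F : ℕ → S → A → S → V}
    (hF : ∀ i a j, Tendsto (fun n => F n i a j) atTop (𝓝 0)) :
    Tendsto (fun n => F n (x n) (z n) (x (n + 1))) atTop (𝓝 0) := by
  have h1 : Tendsto (fun n => ∑ t : S × A × S, ‖F n t.1 t.2.1 t.2.2‖) atTop (𝓝 0) := by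
    simpa using tendsto_finsetSum (Finset.univ : Finset (S × A × S)) fun t _ =>
      (hF t.1 t.2.1 t.2.2).norm
  exact squeeze_zero_norm (fun n => Finset.single_le_sum
    (f := fun t : S × A × S => ‖F n t.1 t.2.1 t.2.2‖) (fun t _ => norm_nonneg _)
    (Finset.mem_univ (x n, z n, x (n + 1)))) h1

/-- A linear recursion driven by the transitions of the chain converges to zero, if the coefficients
converge to limits for which the averaged operator is a contraction and the averaged forcing term
vanishes. -/
theorem HasConvergentFluctuations.tendsto_zero_of_linear_recursion {E : Type*}
    [NormedAddCommGroup E] [NormedSpace ℝ E] (hxz : HasConvergentFluctuations M q d b x z)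
    (hb_pos : ∀ n, 0 < b n) (hb_zero : Tendsto b atTop (𝓝 0))
    (hb_sum : Tendsto (fun N => ∑ n ∈ Finset.range N, b n) atTop atTop)
    {Ln : ℕ → S → A → S → E →L[ℝ] E} {L : S → A → S → E →L[ℝ] E}
    {Hn : ℕ → S → A → S → E} {H : S → A → S → E} {y : ℕ → E}
    (hL : ∀ i a j, Tendsto (fun n => Ln n i a j) atTop (𝓝 (L i a j)))
    (hH : ∀ i a j, Tendsto (fun n => Hn n i a j) atTop (𝓝 (H i a j)))
    {c : ℝ} (hc : 0 < c)
    (hcontr : ∀ᶠ β in 𝓝[>] (0 : ℝ), ∀ v,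
      ‖v + β • stationaryMean M q d L v‖ ≤ (1 - c * β) * ‖v‖)
    (hH0 : stationaryMean M q d H = 0)
    (hy : ∀ n, y (n + 1) = y n + b n •
      (Ln n (x n) (z n) (x (n + 1)) (y n) + Hn n (x n) (z n) (x (n + 1)))) :
    Tendsto y atTop (𝓝 0) := by
  obtain ⟨K, hK⟩ : ∃ K, ∀ i a j, max ‖L i a j‖ ‖H i a j‖ ≤ K := by
    obtain ⟨K, hK⟩ := (Set.finite_range fun t : S × A × S =>
      max ‖L t.1 t.2.1 t.2.2‖ ‖H t.1 t.2.1 t.2.2‖).bddAbove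
    exact ⟨K, fun i a j => hK ⟨(i, a, j), rfl⟩⟩
  obtain ⟨sL, hsL⟩ := hxz.tendsto L
  obtain ⟨sH, hsH⟩ := hxz.tendsto H
  simp only [hH0, sub_zero] at hsH
  refine RiskSensitive.tendsto_zero_of_linear_recursion hb_pos hb_zero hb_sum hc hcontr
    (L := fun n => L (x n) (z n) (x (n + 1)))
    (D := fun n => Ln n (x n) (z n) (x (n + 1)) - L (x n) (z n) (x (n + 1)))
    (h := fun n => H (x n) (z n) (x (n + 1)))
    (e := fun n => Hn n (x n) (z n) (x (n + 1)) - H (x n) (z n) (x (n + 1)))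
    (fun n => (le_max_left _ _).trans (hK _ _ _)) (fun n => (le_max_right _ _).trans (hK _ _ _))
    (tendsto_zero_along_path (F := fun n i a j => Ln n i a j - L i a j) fun i a j => by
      simpa using (hL i a j).sub_const (L i a j))
    (tendsto_zero_along_path (F := fun n i a j => Hn n i a j - H i a j) fun i a j => by
      simpa using (hH i a j).sub_const (H i a j)) hsL hsH fun n => ?_
  simp only [add_sub_cancel]
  exact hy n

end Path

/-! ### Convergence of the gradient recursion -/

section Rows

variable {S A : Type*} [Fintype S] [DecidableEq S] [Fintype A] {x₁ x₃ : ℕ}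
  {Ψ : Matrix S (Fin x₃) ℝ} {i₀ : S} {M : MDP S A} {d : S → ℝ} {pol : PolicyFamily S A x₁}
  {θ : EuclideanSpace ℝ (Fin x₁)} {b : ℕ → ℝ} {x : ℕ → S} {z : ℕ → A}
  {ρ : ℕ → S → A → S → ℝ} {g : S → A → S → ℝ} {u w : ℕ → Matrix (Fin x₁) (Fin x₃) ℝ}

/-- If the importance sampling ratios converge, then the rows of `w` converge to the columns of
`A⁻¹ b`. -/
theorem IsGTD2Iterate.tendsto_row (hd : ∀ i, 0 < d i)
    (hA : IsUnit (A1 d Ψ (ratioMatrix M (pol.prob θ) g) i₀).det) (hC : IsUnit (C1 d Ψ).det)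
    (hxz : HasConvergentFluctuations M (pol.prob θ) d b x z)
    (hb_pos : ∀ n, 0 < b n) (hb_zero : Tendsto b atTop (𝓝 0))
    (hb_sum : Tendsto (fun N => ∑ n ∈ Finset.range N, b n) atTop atTop)
    (hρ : ∀ i a j, Tendsto (fun n => ρ n i a j) atTop (𝓝 (g i a j)))
    (h : IsGTD2Iterate pol θ Ψ i₀ b x z (fun n => ρ n (x n) (z n) (x (n + 1))) u w)
    (l : Fin x₁) :
    Tendsto (fun n => w n l) atTop
      (𝓝 (((A1 d Ψ (ratioMatrix M (pol.prob θ) g) i₀)⁻¹ * b1 d Ψ (gradMatrix M pol θ g))ᵀ l)) := by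
  set A₁ := A1 d Ψ (ratioMatrix M (pol.prob θ) g) i₀ with hA₁
  set C₁ := C1 d Ψ with hC₁
  set b₁ := b1 d Ψ (gradMatrix M pol θ g) with hb₁
  obtain ⟨η, c, hc, hdiss⟩ := exists_shear_dissipative (C := C₁)
    (fun v hv => dotProduct_C1_pos hd hC hv) hA
  set T := shear A₁ η with hT
  set T' := shear A₁ (-η) with hT'
  have hTT : T' * T = 1 := shear_neg_mul_shear A₁ η
  -- the equilibrium of the mean recursion, at which the row of `u` vanishes
  set v₀ : Fin x₃ ⊕ Fin x₃ → ℝ := Sum.elim 0 ((A₁⁻¹ * b₁)ᵀ l) with hv₀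
  set v : ℕ → Fin x₃ ⊕ Fin x₃ → ℝ := fun n => Sum.elim (u n l) (w n l) with hv
  set s : S → A → ℝ := fun i a => gradient (fun t => Real.log (pol.prob t i a)) θ l with hs
  have hq1 := pol.prob_sum θ
  let Tc := toEuclideanCLM (n := Fin x₃ ⊕ Fin x₃) (𝕜 := ℝ)
  let Lf : ℝ → S → S → EuclideanSpace ℝ (Fin x₃ ⊕ Fin x₃) →L[ℝ]
      EuclideanSpace ℝ (Fin x₃ ⊕ Fin x₃) := fun ρ i j => Tc (T * gtdMatrix Ψ i₀ ρ i j * T')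
  -- the norm is Euclidean after the shear `T`
  let lift : (Fin x₃ ⊕ Fin x₃ → ℝ) →ₗ[ℝ] EuclideanSpace ℝ (Fin x₃ ⊕ Fin x₃) :=
    (WithLp.linearEquiv 2 ℝ (Fin x₃ ⊕ Fin x₃ → ℝ)).symm.toLinearMap ∘ₗ T.mulVecLin
  let Hf : ℝ → S → A → S → EuclideanSpace ℝ (Fin x₃ ⊕ Fin x₃) := fun ρ i a j =>
    lift (gtdMatrix Ψ i₀ ρ i j *ᵥ v₀ + gtdForcing Ψ ρ (s i a) i)
  have hLaff : ∀ ρ i j, Lf ρ i j = Lf 0 i j + ρ • (Lf 1 i j - Lf 0 i j) := fun ρ i j => by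
    simp only [Lf]
    rw [gtdMatrix_eq_affine, ← map_sub, ← map_smul, ← map_add]
    congr 1
    simp only [Matrix.mul_add, Matrix.add_mul, Matrix.mul_sub, Matrix.sub_mul, Matrix.mul_smul,
      Matrix.smul_mul]
  have hHaff : ∀ ρ i a j, Hf ρ i a j = Hf 0 i a j + ρ • (Hf 1 i a j - Hf 0 i a j) :=
    fun ρ i a j => by
      simp only [Hf]
      rw [gtdMatrix_eq_affine, gtdForcing_eq_affine, ← map_sub, ← map_smul, ← map_add]
      congr 1
      rw [add_mulVec, smul_mulVec, sub_mulVec]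
      module
  have hmeanL : stationaryMean M (pol.prob θ) d (fun i a j => Lf (g i a j) i j) =
      Tc (T * gtdMean C₁ A₁ * T') := by
    rw [← stationaryMean_gtdMatrix hq1 g]
    let φ : Matrix (Fin x₃ ⊕ Fin x₃) (Fin x₃ ⊕ Fin x₃) ℝ →ₗ[ℝ]
        EuclideanSpace ℝ (Fin x₃ ⊕ Fin x₃) →L[ℝ] EuclideanSpace ℝ (Fin x₃ ⊕ Fin x₃) :=
      Tc.toAlgEquiv.toLinearMap ∘ₗ LinearMap.mulRight ℝ T' ∘ₗ LinearMap.mulLeft ℝ T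
    exact (map_stationaryMean φ _).symm
  have hmeanH : stationaryMean M (pol.prob θ) d (fun i a j => Hf (g i a j) i a j) = 0 := by
    have h1 : stationaryMean M (pol.prob θ) d (fun i a j =>
        gtdMatrix Ψ i₀ (g i a j) i j *ᵥ v₀ + gtdForcing Ψ (g i a j) (s i a) i) =
        gtdMean C₁ A₁ *ᵥ v₀ + Sum.elim (fun k => b₁ k l) 0 := by
      rw [← stationaryMean_gtdMatrix hq1 g, hb₁, ← stationaryMean_gtdForcing g l]
      have h2 := map_stationaryMean (M := M) (q := pol.prob θ) (d := d)
        ((mulVecBilin ℝ ℝ).flip v₀) fun i a j => gtdMatrix Ψ i₀ (g i a j) i j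
      simp only [LinearMap.flip_apply, mulVecBilin_apply] at h2
      rw [h2]
      simp only [stationaryMean, smul_add, Finset.sum_add_distrib, hs]
    have h2 : gtdMean C₁ A₁ *ᵥ v₀ + Sum.elim (fun k => b₁ k l) 0 = 0 := by
      have h3 : A₁ *ᵥ ((A₁⁻¹ * b₁)ᵀ l) = fun k => b₁ k l := by
        have h4 : A₁ *ᵥ ((A₁⁻¹ * b₁)ᵀ l) = fun k => (A₁ * (A₁⁻¹ * b₁)) k l := rfl
        rw [h4, ← Matrix.mul_assoc, mul_nonsing_inv _ hA, Matrix.one_mul]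
      rw [gtdMean, fromBlocks_mulVec, hv₀]
      funext k
      rcases k with k | k <;> simp [neg_mulVec, h3, -transpose_mul]
    rw [← map_stationaryMean lift, h1, h2, map_zero]
  have hmain : Tendsto (fun n => lift (v n - v₀)) atTop (𝓝 0) := by
    refine hxz.tendsto_zero_of_linear_recursion hb_pos hb_zero hb_sum
      (Ln := fun n i a j => Lf (ρ n i a j) i j) (L := fun i a j => Lf (g i a j) i j)
      (Hn := fun n i a j => Hf (ρ n i a j) i a j) (H := fun i a j => Hf (g i a j) i a j)
      (fun i a j => ?_) (fun i a j => ?_) (half_pos hc)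
      (eventually_norm_add_smul_le hc fun y => ?_) hmeanH fun n => ?_
    · simp only [hLaff (ρ _ i a j), hLaff (g i a j)]
      exact ((hρ i a j).smul_const _).const_add _
    · simp only [hHaff (ρ _ i a j), hHaff (g i a j)]
      exact ((hρ i a j).smul_const _).const_add _
    · rw [hmeanL]
      have h1 := hdiss y.ofLp
      rw [EuclideanSpace.real_norm_sq_eq]
      have h2 : inner ℝ y (Tc (T * gtdMean C₁ A₁ * T') y) =
          y.ofLp ⬝ᵥ (T * gtdMean C₁ A₁ * T') *ᵥ y.ofLp := by
        rw [inner_toEuclideanCLM]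
      rw [h2]
      refine h1.trans_eq ?_
      simp only [dotProduct, pow_two]
    · have h1 := h.row_succ l n
      have h2 : v (n + 1) - v₀ = (v n - v₀) + b n •
          (gtdMatrix Ψ i₀ (ρ n (x n) (z n) (x (n + 1))) (x n) (x (n + 1)) *ᵥ (v n - v₀) +
          (gtdMatrix Ψ i₀ (ρ n (x n) (z n) (x (n + 1))) (x n) (x (n + 1)) *ᵥ v₀ +
            gtdForcing Ψ (ρ n (x n) (z n) (x (n + 1))) (s (x n) (z n)) (x n))) := by
        simp only [hv]
        rw [h1, mulVec_sub]
        module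
      rw [h2, map_add, map_smul, map_add]
      congr 3
      simp only [Lf, lift, Tc]
      refine PiLp.ext fun k => ?_
      have h3 : ∀ (G : Matrix (Fin x₃ ⊕ Fin x₃) (Fin x₃ ⊕ Fin x₃) ℝ) (y : Fin x₃ ⊕ Fin x₃ → ℝ),
          (T * G * T') *ᵥ (T *ᵥ y) = T *ᵥ (G *ᵥ y) := fun G y => by
        rw [mulVec_mulVec, Matrix.mul_assoc, hTT, Matrix.mul_one, mulVec_mulVec]
      exact (congrFun (h3 _ (v n - v₀)) k).symm
  have hback : Tendsto (fun n => T' *ᵥ (lift (v n - v₀)).ofLp) atTop (𝓝 0) := by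
    have h1 : Continuous fun y : EuclideanSpace ℝ (Fin x₃ ⊕ Fin x₃) => T' *ᵥ y.ofLp :=
      continuous_const.matrix_mulVec (PiLp.continuous_ofLp 2 _)
    have h2 := (h1.tendsto 0).comp hmain
    simpa [Function.comp_def] using h2
  have hv' : ∀ n, T' *ᵥ (lift (v n - v₀)).ofLp = v n - v₀ := fun n => by
    change T' *ᵥ (T *ᵥ (v n - v₀)) = _
    rw [mulVec_mulVec, hTT, one_mulVec]
  simp only [hv'] at hback
  refine tendsto_pi_nhds.2 fun k => ?_
  have h1 := (tendsto_pi_nhds.1 hback (Sum.inr k)).add_const (v₀ (Sum.inr k))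
  simpa [hv, hv₀, -transpose_mul] using h1

end Rows

theorem tendsto_isRatio {S A : Type*} [Fintype S] {x₂ : ℕ} (M : MDP S A) (α : ℝ)
    (Φ : Matrix S (Fin x₂) ℝ) (i₀ : S) {δ₂ : ℝ} (hδ₂ : 0 < δ₂) {r : ℕ → Fin x₂ → ℝ}
    {r' : Fin x₂ → ℝ} (hr : Tendsto r atTop (𝓝 r')) (i : S) (a : A) (j : S) :
    Tendsto (fun n => isRatio M α Φ i₀ δ₂ (r n) i a j) atTop
      (𝓝 (isRatio M α Φ i₀ δ₂ r' i a j)) := by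
  have hdot : ∀ y : Fin x₂ → ℝ, Tendsto (fun n => r n ⬝ᵥ y) atTop (𝓝 (r' ⬝ᵥ y)) := fun y =>
    ((continuous_id.dotProduct continuous_const).tendsto r').comp hr
  exact ((hdot (Φ j)).const_mul _).div (((hdot (Φ i)).mul (hdot (Φ i₀))).max tendsto_const_nhds)
    (lt_max_of_lt_right hδ₂).ne'

theorem StepSizes.summable_sq {a b : ℕ → ℝ} (h : StepSizes a b) :
    (Summable fun n => a n ^ 2) ∧ Summable fun n => b n ^ 2 :=
  ⟨Summable.of_nonneg_of_le (fun n => sq_nonneg _) (fun n => by nlinarith [sq_nonneg (b n)])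
    h.sq_summable,
   Summable.of_nonneg_of_le (fun n => sq_nonneg _) (fun n => by nlinarith [sq_nonneg (a n)])
    h.sq_summable⟩

end RiskSensitive

theorem theorem3 {S A : Type*} [Fintype S] [DecidableEq S] [Fintype A]
    {x₁ x₂ x₃ : ℕ}
    (M : RiskSensitive.MDP S A) (pol : RiskSensitive.PolicyFamily S A x₁)
    (θ : EuclideanSpace ℝ (Fin x₁)) (α : ℝ) (i₀ : S)
    (Φ : Matrix S (Fin x₂) ℝ) (Ψ : Matrix S (Fin x₃) ℝ)
    -- the chain under the fixed policy
    (P : Matrix S S ℝ) (hP : P = RiskSensitive.transMatrix M (pol.prob θ))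
    (hirr : P.IsIrreducible) (haper : RiskSensitive.IsAperiodic P)
    (d : S → ℝ) (hd : RiskSensitive.IsStationary P d)
    (hΦ : RiskSensitive.FeatureAssumption P Φ)
    -- step sizes and thresholds
    (a b : ℕ → ℝ) (hab : RiskSensitive.StepSizes a b) (ha : ∀ n, a n < 1)
    (δ₁ δ₂ : ℝ) (hδ₁ : 0 < δ₁) (hδ₂ : 0 < δ₂)
    -- the Perron-Frobenius eigenvalue and the limiting value weights
    (γ : ℝ) (rθ : Fin x₂ → ℝ)
    (hr : RiskSensitive.IsPerronCritic d Φ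
      (RiskSensitive.expMatrix M α (pol.prob θ)) i₀ γ rθ)
    (hδγ : δ₁ < γ)
    -- the limiting matrices
    (g : S → A → S → ℝ) (hg : g = RiskSensitive.isRatio M α Φ i₀ δ₂ rθ)
    (C₁ A₁ : Matrix (Fin x₃) (Fin x₃) ℝ) (b₁ : Matrix (Fin x₃) (Fin x₁) ℝ)
    (hC₁ : C₁ = RiskSensitive.C1 d Ψ)
    (hA₁ : A₁ = RiskSensitive.A1 d Ψ (RiskSensitive.ratioMatrix M (pol.prob θ) g) i₀)
    (hb₁ : b₁ = RiskSensitive.b1 d Ψ (RiskSensitive.gradMatrix M pol θ g))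
    (hA_ns : IsUnit A₁.det) (hC_ns : IsUnit C₁.det)
    -- the sample path and the iterates
    {Ω : Type*} [MeasurableSpace Ω] (μ : Measure Ω) [IsProbabilityMeasure μ]
    (X : ℕ → Ω → S) (Z : ℕ → Ω → A)
    (hX : RiskSensitive.IsControlledChain μ M (pol.prob θ) X Z)
    (r : ℕ → Ω → Fin x₂ → ℝ) (u w : ℕ → Ω → Matrix (Fin x₁) (Fin x₃) ℝ)
    (hrn : ∀ ω, RiskSensitive.IsValueIterate M α Φ i₀ δ₁ a
      (fun n => X n ω) (fun n => Z n ω) (fun n => r n ω))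
    (huw : ∀ ω, RiskSensitive.IsGTD2Iterate pol θ Ψ i₀ b
      (fun n => X n ω) (fun n => Z n ω)
      (fun n => RiskSensitive.isRatio M α Φ i₀ δ₂ (r n ω) (X n ω) (Z n ω) (X (n + 1) ω))
      (fun n => u n ω) (fun n => w n ω)) :
    RiskSensitive.IsHurwitz (Matrix.fromBlocks (-C₁) (-A₁) A₁ᵀ 0) ∧
    ∀ᵐ ω ∂μ, Tendsto (fun n => w n ω) atTop (𝓝 (A₁⁻¹ * b₁)ᵀ) := by
  subst hP hg hC₁ hA₁ hb₁
  have hd0 := RiskSensitive.IsStationary.pos hd hirr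
  refine ⟨?_, ?_⟩
  · obtain ⟨η, c, hc, hdiss⟩ := RiskSensitive.exists_shear_dissipative
      (fun v hv => RiskSensitive.dotProduct_C1_pos hd0 hC_ns hv) hA_ns
    exact RiskSensitive.isHurwitz_of_dissipative (RiskSensitive.shear_neg_mul_shear _ η) hc hdiss
  obtain ⟨ha2, hb2⟩ := hab.summable_sq
  have hn2 : Summable fun n : ℕ => ((n : ℝ) + 1)⁻¹ ^ 2 := by
    have h1 := (summable_nat_add_iff 1).2 (Real.summable_nat_pow_inv.2 one_lt_two)
    simpa using h1
  filter_upwards [RiskSensitive.ae_hasConvergentFluctuations hX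
      (fun i a => (pol.prob_pos θ i a).le) (pol.prob_sum θ) hirr haper hd
      (fun n => (hab.b_pos n).le) hb2,
    RiskSensitive.ae_hasConvergentFluctuations hX (fun i a => (pol.prob_pos θ i a).le)
      (pol.prob_sum θ) hirr haper hd (b := fun n => ((n : ℝ) + 1)⁻¹)
      (fun n => by positivity) hn2] with ω hω hω'
  have hr' := (hrn ω).tendsto hδ₁ hab.a_pos ha
    (RiskSensitive.tendsto_zero_of_summable_sq ha2) hab.a_sum (pol.prob_pos θ) (pol.prob_sum θ)
    hirr hd hΦ hr hδγ hω'
  exact tendsto_pi_nhds.2 fun l => (huw ω).tendsto_row hd0 hA_ns hC_ns hω hab.b_pos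
    (RiskSensitive.tendsto_zero_of_summable_sq hb2) hab.b_sum
    (ρ := fun n => RiskSensitive.isRatio M α Φ i₀ δ₂ (r n ω))
    (fun i a j => RiskSensitive.tendsto_isRatio M α Φ i₀ hδ₂ hr' i a j) l
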